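/- Let $k \ge 0$ and let $\mathbb{R}^k$ carry the Euclidean distance $d$. A closed polygonal curve $X$ with $m \ge 1$ vertices $x_0,\dots,x_{m-1}\in\mathbb{R}^k$ is given by these vertices; put $x_m = x_0$ and let $f_X:[0,m]\to\mathbb{R}^k$ be defined by $f_X(i+\alpha)=(1-\alpha)x_i+\alpha x_{i+1}$ for $i\in\{0,\dots,m-1\}$, $0\le\alpha\le1$. For $\tau\in[0,m]$ let $s(t;\tau)=t+\tau$ if $t+\tau\le m$ and $s(t;\tau)=t+\tau-m$ otherwise. A monotone reparametrization of $X$ is a function $\varphi:[0,1]\to\mathbb{R}^k$ of the form $\varphi(t)=f_X(s(w(t);\tau))$ with $\tau\in[0,m]$ and $w:[0,1]\to[0,m]$ continuous and non-decreasing, $w(0)=0$, $w(1)=m$; let $\Phi_X$ be the set of these. The Fréchet distance of closed polygonal curves $X$, $Y$ is $$\delta(X,Y)=\inf_{\varphi\in\Phi_X,\ \psi\in\Phi_Y}\ \max_{0\le t\le1} d(\varphi(t),\psi(t))$$ (the infimum is attained). Consider the real RAM with square roots: a random access machine whose memory has cells for natural numbers and cells for real numbers, and that performs each memory access (with indirect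 addressing), each operation $+,-,\times$ on natural numbers, each operation $+,-,\times,/,\sqrt{\ }$ on real numbers, each conversion of a natural number into a real number, and each comparison in one unit of time; its programs contain only rational constants. Theorem. For every fixed dimension $k$ there are a program of this machine and a constant $C$ such that, for all $m,n\ge1$, all closed polygonal curves $X$ and $Y$ in $\mathbb{R}^k$ with $m$ and $n$ vertices and every real number $\varepsilon$, the program, given $m$, $n$, $\varepsilon$ and the coordinates of the vertices of $X$ and $Y$, halts after at most $C\,mn$ units of time and correctly reports whether $\delta(X,Y)\le\varepsilon$. -/

import Mathlib

noncomputable section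

/-! ### Closed polygonal curves and their Fréchet distance -/

/-- A closed `m`-gonal curve in `ℝ^k` with the Euclidean distance, given by its vertices
`x_0, …, x_{m-1}`; the vertex `x_m` is `x_0`. -/
abbrev ClosedPolygon (k m : ℕ) : Type := Fin m → EuclideanSpace ℝ (Fin k)

namespace ClosedPolygon

variable {k m n : ℕ} [NeZero m] [NeZero n]

/-- The vertex `x_i`, with the index taken modulo `m`. -/
def vertex (X : ClosedPolygon k m) (i : ℕ) : EuclideanSpace ℝ (Fin k) := X (Fin.ofNat m i)

/-- The function `f_X`, used on `[0, m]` only: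
`f_X (i + α) = (1 - α) x_i + α x_{i+1}` for `i < m` and `0 ≤ α ≤ 1` (see `curve_add`). -/
def curve (X : ClosedPolygon k m) (t : ℝ) : EuclideanSpace ℝ (Fin k) :=
  (1 - Int.fract t) • X.vertex ⌊t⌋₊ + Int.fract t • X.vertex (⌊t⌋₊ + 1)

theorem curve_add (X : ClosedPolygon k m) (i : ℕ) (α : ℝ) (h0 : 0 ≤ α) (h1 : α ≤ 1) :
    X.curve (i + α) = (1 - α) • X.vertex i + α • X.vertex (i + 1) := by
  rcases h1.lt_or_eq with h | rfl
  · have hf : Int.fract ((i : ℝ) + α) = α := by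
      rw [Int.fract_natCast_add]; exact Int.fract_eq_self.2 ⟨h0, h⟩
    have hn : ⌊(i : ℝ) + α⌋₊ = i := by
      rw [add_comm, Nat.floor_add_natCast h0, Nat.floor_eq_zero.2 h, zero_add]
    simp [curve, hf, hn]
  · have hn : ⌊(i : ℝ) + 1⌋₊ = i + 1 := by exact_mod_cast Nat.floor_natCast (R := ℝ) (i + 1)
    simp [curve, hn]

/-- The cyclic shift `s(t; τ)` of the interval `[0, m]`. -/
def shift (m : ℕ) (τ t : ℝ) : ℝ := if t + τ ≤ m then t + τ else t + τ - m

/-- The set `W_m` of continuous non-decreasing functions `w` from `[0, 1]` to `[0, m]` with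
`w(0) = 0` and `w(1) = m`. -/
def timeChanges (m : ℕ) : Set (unitInterval → ℝ) :=
  {w | Continuous w ∧ Monotone w ∧ w 0 = 0 ∧ w 1 = m}

/-- The set `Φ_X` of monotone reparametrizations of the closed curve `X`. -/
def reparametrizations (X : ClosedPolygon k m) :
    Set (unitInterval → EuclideanSpace ℝ (Fin k)) :=
  {φ | ∃ w ∈ timeChanges m, ∃ τ ∈ Set.Icc (0 : ℝ) m, ∀ t, φ t = X.curve (shift m τ (w t))}

/-- The Fréchet distance `δ(X, Y)` of closed polygonal curves. -/
def frechetDist (X : ClosedPolygon k m) (Y : ClosedPolygon k n) : ℝ :=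
  sInf {r | ∃ φ ∈ X.reparametrizations, ∃ ψ ∈ Y.reparametrizations,
    r = ⨆ t : unitInterval, dist (φ t) (ψ t)}

end ClosedPolygon

/-! ### A real RAM with square roots

The memory consists of an array of cells for natural numbers and an array of cells for real
numbers, both with indirect addressing. Every memory access, every arithmetic operation (on
reals: `+`, `-`, `*`, `/` and the square root; on naturals: `+`, `-`, `*`), every comparison,
every constant and every branching takes one unit of time. There is no rounding of reals to
integers. Control flow is structured (branches and loops), which is a special case of jumps. -/

namespace RealRAM

/-- The contents of the memory. -/
@[ext]
structure Store where
  /-- the cells for natural numbers -/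
  nat : ℕ → ℕ
  /-- the cells for real numbers -/
  real : ℕ → ℝ

/-- Expressions of type natural number; `sub` is truncated at `0`. -/
inductive NExpr : Type
  | const (a : ℕ)
  | load (addr : NExpr)
  | add (a b : NExpr)
  | sub (a b : NExpr)
  | mul (a b : NExpr)

/-- Expressions of type real number. Only rational constants may occur in a program. -/
inductive RExpr : Type
  | const (q : ℚ)
  | load (addr : NExpr)
  | cast (a : NExpr)
  | add (a b : RExpr)
  | sub (a b : RExpr)
  | mul (a b : RExpr)
  | div (a b : RExpr)
  | sqrt (a : RExpr)

/-- Conditions. -/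
inductive Cond : Type
  | natLE (a b : NExpr)
  | realLE (a b : RExpr)
  | neg (c : Cond)
  | and (c d : Cond)

/-- Programs. -/
inductive Program : Type
  | skip
  | setNat (addr val : NExpr)
  | setReal (addr : NExpr) (val : RExpr)
  | seq (p q : Program)
  | branch (c : Cond) (p q : Program)
  | loop (c : Cond) (p : Program)

/-- The value of an expression. -/
def NExpr.eval (s : Store) : NExpr → ℕ
  | const a => a
  | load e => s.nat (e.eval s)
  | add a b => a.eval s + b.eval s
  | sub a b => a.eval s - b.eval s
  | mul a b => a.eval s * b.eval s

/-- The number of operations in an expression. -/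
def NExpr.cost : NExpr → ℕ
  | const _ => 1
  | load e => e.cost + 1
  | add a b => a.cost + b.cost + 1
  | sub a b => a.cost + b.cost + 1
  | mul a b => a.cost + b.cost + 1

/-- The value of an expression. A division by zero and the square root of a negative number
return `0`. -/
def RExpr.eval (s : Store) : RExpr → ℝ
  | const q => (q : ℝ)
  | load e => s.real (e.eval s)
  | cast e => (e.eval s : ℝ)
  | add a b => a.eval s + b.eval s
  | sub a b => a.eval s - b.eval s
  | mul a b => a.eval s * b.eval s
  | div a b => a.eval s / b.eval s
  | sqrt a => Real.sqrt (a.eval s)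

/-- The number of operations in an expression. -/
def RExpr.cost : RExpr → ℕ
  | const _ => 1
  | load e => e.cost + 1
  | cast e => e.cost + 1
  | add a b => a.cost + b.cost + 1
  | sub a b => a.cost + b.cost + 1
  | mul a b => a.cost + b.cost + 1
  | div a b => a.cost + b.cost + 1
  | sqrt a => a.cost + 1

/-- The truth of a condition. -/
def Cond.Holds (s : Store) : Cond → Prop
  | natLE a b => a.eval s ≤ b.eval s
  | realLE a b => a.eval s ≤ b.eval s
  | neg c => ¬ c.Holds s
  | and c d => c.Holds s ∧ d.Holds s

/-- The number of operations in a condition. -/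
def Cond.cost : Cond → ℕ
  | natLE a b => a.cost + b.cost + 1
  | realLE a b => a.cost + b.cost + 1
  | neg c => c.cost + 1
  | and c d => c.cost + d.cost + 1

/-- Write a natural number into a cell. -/
def Store.setNat (s : Store) (addr val : ℕ) : Store :=
  { s with nat := Function.update s.nat addr val }

/-- Write a real number into a cell. -/
def Store.setReal (s : Store) (addr : ℕ) (val : ℝ) : Store :=
  { s with real := Function.update s.real addr val }

/-- `Runs p s s' t`: the program `p`, started on the memory `s`, halts after `t` units of time
with the memory `s'`. -/
inductive Runs : Program → Store → Store → ℕ → Prop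
  | skip (s : Store) : Runs .skip s s 1
  | setNat (s : Store) (a e : NExpr) :
      Runs (.setNat a e) s (s.setNat (a.eval s) (e.eval s)) (a.cost + e.cost + 1)
  | setReal (s : Store) (a : NExpr) (e : RExpr) :
      Runs (.setReal a e) s (s.setReal (a.eval s) (e.eval s)) (a.cost + e.cost + 1)
  | seq {p q : Program} {s s' s'' : Store} {t t' : ℕ} :
      Runs p s s' t → Runs q s' s'' t' → Runs (.seq p q) s s'' (t + t')
  | branch_true {c : Cond} {p q : Program} {s s' : Store} {t : ℕ} :
      c.Holds s → Runs p s s' t → Runs (.branch c p q) s s' (c.cost + 1 + t)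
  | branch_false {c : Cond} {p q : Program} {s s' : Store} {t : ℕ} :
      ¬ c.Holds s → Runs q s s' t → Runs (.branch c p q) s s' (c.cost + 1 + t)
  | loop_true {c : Cond} {p : Program} {s s' s'' : Store} {t t' : ℕ} :
      c.Holds s → Runs p s s' t → Runs (.loop c p) s' s'' t' →
        Runs (.loop c p) s s'' (c.cost + 1 + t + t')
  | loop_false {c : Cond} {p : Program} {s : Store} :
      ¬ c.Holds s → Runs (.loop c p) s s (c.cost + 1)

/-- The machine is deterministic: the final memory and the running time are unique. -/
theorem Runs.unique {p : Program} {s s₁ s₂ : Store} {t₁ t₂ : ℕ}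
    (h₁ : Runs p s s₁ t₁) (h₂ : Runs p s s₂ t₂) : s₁ = s₂ ∧ t₁ = t₂ := by
  induction h₁ generalizing s₂ t₂ with
  | skip | setNat | setReal => cases h₂; exact ⟨rfl, rfl⟩
  | seq _ _ ih ih' =>
    cases h₂ with
    | seq g g' =>
      obtain ⟨rfl, rfl⟩ := ih g
      obtain ⟨rfl, rfl⟩ := ih' g'
      exact ⟨rfl, rfl⟩
  | branch_true hc _ ih =>
    cases h₂ with
    | branch_true _ g => obtain ⟨rfl, rfl⟩ := ih g; exact ⟨rfl, rfl⟩
    | branch_false hc' _ => exact absurd hc hc'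
  | branch_false hc _ ih =>
    cases h₂ with
    | branch_true hc' _ => exact absurd hc' hc
    | branch_false _ g => obtain ⟨rfl, rfl⟩ := ih g; exact ⟨rfl, rfl⟩
  | loop_true hc _ _ ih ih' =>
    cases h₂ with
    | loop_true _ g g' =>
      obtain ⟨rfl, rfl⟩ := ih g
      obtain ⟨rfl, rfl⟩ := ih' g'
      exact ⟨rfl, rfl⟩
    | loop_false hc' => exact absurd hc hc'
  | loop_false hc =>
    cases h₂ with
    | loop_true hc' _ _ => exact absurd hc' hc
    | loop_false _ => exact ⟨rfl, rfl⟩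

/-- The coordinates of the vertices, one vertex after the other: entry `k * i + c` is
coordinate `c` of vertex `i`; entries from `m * k` on are `0`. -/
def coordinates {k m : ℕ} (X : ClosedPolygon k m) (a : ℕ) : ℝ :=
  if h : a < m * k then
    X (finProdFinEquiv.symm ⟨a, h⟩).1 (finProdFinEquiv.symm ⟨a, h⟩).2
  else 0

/-- The input: the cells `0` and `1` for naturals hold `m` and `n`; the cells for reals hold `ε`,
then the coordinates of the vertices of `X`, then those of `Y`. All other cells hold `0`. -/
def input {k m n : ℕ} (X : ClosedPolygon k m) (Y : ClosedPolygon k n) (ε : ℝ) : Store where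
  nat a := if a = 0 then m else if a = 1 then n else 0
  real a := if a = 0 then ε else if a - 1 < m * k then coordinates X (a - 1)
    else coordinates Y (a - 1 - m * k)

end RealRAM

end

/-! Put the parameters of the two curves on the axes of a free space diagram, where (u, v) is free
if the corresponding points of `X` and `Y` have distance at most ε, and extend both curves
periodically. After cutting and translating, δ(X, Y) ≤ ε means that for some a in [0, n] a monotone
path of free points leads from (0, a) to (m, a + n) (`ClosedPolygon.frechetDist_le_iff`). That the
infimum is attained is a compactness statement about paths parametrized by the sum of their
coordinates (`exists_path_of_forall_gt`).

All values of a are tested at once by planarity. Suppose that one path ends in (m, a + n) and starts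
at or below (0, a), and that another starts in (0, a) and ends at or below (m, a + n). Then the two
meet, and changing from the second to the first at the common point gives a path from (0, a) to (m,
a + n) (`MonoPath.cross`). Hence it is enough to know the lowest start for every end point and the
lowest end for every start point. With both curves reversed the second problem takes the form of the
first: among the starts from which a point is reached, find the largest label, the label of a start
(x, y) being y - x. Each problem is solved by one sweep.

Free space is convex in every cell, so reachability spreads from edge to edge (`Grid.Reach`,
`MonoPath.enter`). Consider the staircase between the cells already swept and the others. From its
upper left to its lower right end the best labels never increase; `Grid.Common` carries this order
along. A horizontal edge therefore needs only its leftmost reached point and one label. On a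
vertical edge the best label at height q is the minimum of q and a step function, and the steps form
a queue in which positions and labels both decrease. A cell appends at most one step, at the back,
and removes steps only at the ends (`Grid.RowInv.mid`, `Grid.MidInv.popFront`, `Grid.MidInv.cap`,
`Grid.MidInv.popBack`, `Grid.MidInv.raise`). So the amortized time per cell is constant, without any
searching or sorting.

For each of the n edges of `Y` the first sweep leaves one interval with one label and the second a
queue of at most m + 1 entries. Apart from freeness, the conditions on a only get weaker when a
grows, so only the positions in the queue are candidates (`ClosedPolygon.exists_reach_iff`), at most
n (m + 1) in all.

On the machine the ends of the free intervals are expressions without branching (`segLo`, `segHi`).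
Correctness and time are proved together in a logic with time credits (`RealRAM.WP`), where a
multiple of the length of the queue serves as potential. -/

namespace RealRAM

/-! ### Programs without loops -/

open Classical in
/-- The memory after the execution of a program without loops. -/
noncomputable def Program.exec : Program → Store → Store
  | .skip, s => s
  | .setNat a e, s => s.setNat (a.eval s) (e.eval s)
  | .setReal a e, s => s.setReal (a.eval s) (e.eval s)
  | .seq p q, s => q.exec (p.exec s)
  | .branch c p q, s => if c.Holds s then p.exec s else q.exec s
  | .loop _ _, s => s

/-- An upper bound for the running time of a program without loops. -/
def Program.bound : Program → ℕ
  | .skip => 1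
  | .setNat a e => a.cost + e.cost + 1
  | .setReal a e => a.cost + e.cost + 1
  | .seq p q => p.bound + q.bound
  | .branch c p q => c.cost + 1 + (p.bound + q.bound)
  | .loop _ _ => 0

/-- The program contains no loop. -/
def Program.LoopFree : Program → Prop
  | .seq p q => p.LoopFree ∧ q.LoopFree
  | .branch _ p q => p.LoopFree ∧ q.LoopFree
  | .loop _ _ => False
  | _ => True

theorem Program.LoopFree.runs {p : Program} (hp : p.LoopFree) (s : Store) :
    ∃ t ≤ p.bound, Runs p s (p.exec s) t := by
  induction p generalizing s with
  | skip => exact ⟨_, le_rfl, Runs.skip s⟩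
  | setNat a e => exact ⟨_, le_rfl, Runs.setNat s a e⟩
  | setReal a e => exact ⟨_, le_rfl, Runs.setReal s a e⟩
  | seq p q ihp ihq =>
    obtain ⟨t, ht, h⟩ := ihp hp.1 s
    obtain ⟨t', ht', h'⟩ := ihq hp.2 (p.exec s)
    exact ⟨t + t', Nat.add_le_add ht ht', h.seq h'⟩
  | branch c p q ihp ihq =>
    by_cases hc : c.Holds s
    · obtain ⟨t, ht, h⟩ := ihp hp.1 s
      refine ⟨c.cost + 1 + t, by simp only [Program.bound]; omega, ?_⟩
      simpa [Program.exec, hc] using Runs.branch_true (q := q) hc h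
    · obtain ⟨t, ht, h⟩ := ihq hp.2 s
      refine ⟨c.cost + 1 + t, by simp only [Program.bound]; omega, ?_⟩
      simpa [Program.exec, hc] using Runs.branch_false (p := p) hc h
  | loop c p => exact hp.elim

/-! ### Total correctness with time credits -/

/-- The program `p`, started on `s` with `c` units of time to spend, halts within this time, and
`Q` holds for the final memory and some number of units that are left. -/
def WP (p : Program) (s : Store) (c : ℕ) (Q : Store → ℕ → Prop) : Prop :=
  ∃ s' t c', Runs p s s' t ∧ t + c' ≤ c ∧ Q s' c'

theorem WP.mono {p : Program} {s : Store} {c : ℕ} {Q Q' : Store → ℕ → Prop}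
    (h : WP p s c Q) (hQ : ∀ s c, Q s c → Q' s c) : WP p s c Q' := by
  obtain ⟨s', t, c', h1, h2, h3⟩ := h
  exact ⟨s', t, c', h1, h2, hQ _ _ h3⟩

theorem WP.loopFree {p : Program} (hp : p.LoopFree) {s : Store} {c : ℕ} (c' : ℕ)
    {Q : Store → ℕ → Prop} (hc : p.bound + c' ≤ c) (h : Q (p.exec s) c') : WP p s c Q := by
  obtain ⟨t, ht, hr⟩ := hp.runs s
  exact ⟨_, t, c', hr, by omega, h⟩

theorem WP.seq {p q : Program} {s : Store} {c : ℕ} {Q : Store → ℕ → Prop}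
    (h : WP p s c fun s' c' => WP q s' c' Q) : WP (.seq p q) s c Q := by
  obtain ⟨s', t, c', h1, h2, s'', t', c'', h3, h4, h5⟩ := h
  exact ⟨s'', t + t', c'', h1.seq h3, by omega, h5⟩

theorem WP.branch {b : Cond} {p q : Program} {s : Store} {c : ℕ} (c' : ℕ)
    {Q : Store → ℕ → Prop} (hc : b.cost + 1 + c' ≤ c) (hp : b.Holds s → WP p s c' Q)
    (hq : ¬ b.Holds s → WP q s c' Q) : WP (.branch b p q) s c Q := by
  by_cases hb : b.Holds s
  · obtain ⟨s', t, c'', h1, h2, h3⟩ := hp hb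
    exact ⟨s', _, c'', Runs.branch_true hb h1, by omega, h3⟩
  · obtain ⟨s', t, c'', h1, h2, h3⟩ := hq hb
    exact ⟨s', _, c'', Runs.branch_false hb h1, by omega, h3⟩

/-- Every pass through a loop takes time, so that no further termination argument is needed. -/
theorem WP.loop {b : Cond} {p : Program} {Q : Store → ℕ → Prop} (I : Store → ℕ → Prop)
    (hI : ∀ s c, I s c → ∃ c', b.cost + 1 + c' ≤ c ∧
      ((b.Holds s → WP p s c' I) ∧ (¬ b.Holds s → Q s c')))
    {s : Store} {c : ℕ} (h : I s c) : WP (.loop b p) s c Q := by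
  induction c using Nat.strong_induction_on generalizing s with
  | _ c ih =>
    obtain ⟨c', hc', h1, h2⟩ := hI s c h
    by_cases hb : b.Holds s
    · obtain ⟨s', t, c'', h3, h4, h5⟩ := h1 hb
      obtain ⟨s'', t', d, h6, h7, h8⟩ := ih c'' (by omega) h5
      exact ⟨s'', _, d, Runs.loop_true hb h3 h6, by omega, h8⟩
    · exact ⟨s, _, c', Runs.loop_false hb, hc', h2 hb⟩

/-! ### Derived expressions -/

/-- The maximum of two real expressions. -/
def RExpr.max (a b : RExpr) : RExpr :=
  .div (.add (.add a b) (.sqrt (.mul (.sub a b) (.sub a b)))) (.const 2)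

/-- The minimum of two real expressions. -/
def RExpr.min (a b : RExpr) : RExpr :=
  .div (.sub (.add a b) (.sqrt (.mul (.sub a b) (.sub a b)))) (.const 2)

/-- The indicator of positivity of a real number, as a term in the operations of the machine;
the quotient `0 / 0` is `0`. -/
noncomputable def posInd (x : ℝ) : ℝ := (Real.sqrt (x * x) + x) / (Real.sqrt (x * x) + x)

/-- The indicator of positivity of a real expression. -/
def RExpr.posInd (a : RExpr) : RExpr :=
  .div (.add (.sqrt (.mul a a)) a) (.add (.sqrt (.mul a a)) a)

/-- A sum of `k` real expressions. -/
def RExpr.sum (f : ℕ → RExpr) : ℕ → RExpr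
  | 0 => .const 0
  | k + 1 => .add (RExpr.sum f k) (f k)

theorem posInd_of_pos {x : ℝ} (h : 0 < x) : posInd x = 1 := by
  rw [posInd, Real.sqrt_mul_self h.le, div_self (by linarith)]

theorem posInd_of_nonpos {x : ℝ} (h : x ≤ 0) : posInd x = 0 := by
  rw [posInd, Real.sqrt_mul_self_eq_abs, abs_of_nonpos h]; simp

-- Expressions cannot branch, but √(x²) = |x| gives the larger and the smaller of two numbers as (a
-- + b ± |a - b|) / 2.
@[simp] theorem RExpr.eval_max (s : Store) (a b : RExpr) :
    (RExpr.max a b).eval s = Max.max (a.eval s) (b.eval s) := by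
  simp only [RExpr.max, RExpr.eval, Real.sqrt_mul_self_eq_abs]
  push_cast
  rcases le_total (a.eval s) (b.eval s) with h | h
  · rw [max_eq_right h, abs_of_nonpos (by linarith)]; ring
  · rw [max_eq_left h, abs_of_nonneg (by linarith)]; ring

@[simp] theorem RExpr.eval_min (s : Store) (a b : RExpr) :
    (RExpr.min a b).eval s = Min.min (a.eval s) (b.eval s) := by
  simp only [RExpr.min, RExpr.eval, Real.sqrt_mul_self_eq_abs]
  push_cast
  rcases le_total (a.eval s) (b.eval s) with h | h
  · rw [min_eq_left h, abs_of_nonpos (by linarith)]; ring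
  · rw [min_eq_right h, abs_of_nonneg (by linarith)]; ring

@[simp] theorem RExpr.eval_posInd (s : Store) (a : RExpr) :
    (RExpr.posInd a).eval s = RealRAM.posInd (a.eval s) := rfl

@[simp] theorem RExpr.eval_sum (s : Store) (f : ℕ → RExpr) (k : ℕ) :
    (RExpr.sum f k).eval s = ∑ c ∈ Finset.range k, (f c).eval s := by
  induction k with
  | zero => simp [RExpr.sum, RExpr.eval]
  | succ k ih => simp [RExpr.sum, RExpr.eval, ih, Finset.sum_range_succ]

end RealRAM

/-! ### Reachability in a grid of free intervals -/

/-- The two kinds of edges of a grid. -/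
inductive Side : Type
  | vert
  | horiz

/-- The free intervals on the edges of a grid: `[VL i j, VH i j]` on the edge from `(i, j)` to
`(i, j + 1)` and `[HL i j, HR i j]` on the edge from `(i, j)` to `(i + 1, j)`. The monotone paths
start on the left side below `SL` or on the lower side to the left of `SB`. -/
structure Grid where
  (VL VH HL HR : ℕ → ℕ → ℝ)
  (SL SB : ℕ)
  hV : ∀ i j : ℕ, ((j : ℝ) ≤ VL i j ∧ VL i j ≤ VH i j ∧ VH i j ≤ j + 1) ∨
    (VL i j = j + 2 ∧ VH i j = j - 1)
  hH : ∀ i j : ℕ, ((i : ℝ) ≤ HL i j ∧ HL i j ≤ HR i j ∧ HR i j ≤ i + 1) ∨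
    (HL i j = i + 2 ∧ HR i j = i - 1)

namespace Grid

/-- A point of an edge is reached by a monotone path that starts at a point `(u, v)` of the left
or the lower side with `σ ≤ v - u`. -/
inductive Reach (G : Grid) (σ : ℝ) : Side → ℕ → ℕ → ℝ → Prop
  | left {j : ℕ} {q : ℝ} : j < G.SL → G.VL 0 j ≤ q → q ≤ G.VH 0 j → σ ≤ q →
      Reach G σ .vert 0 j q
  | lower {i : ℕ} {x y : ℝ} : i < G.SB → G.HL i 0 ≤ y → y ≤ x → x ≤ G.HR i 0 → σ ≤ -y →
      Reach G σ .horiz i 0 x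
  | horiz_vert {i j : ℕ} {q x : ℝ} : Reach G σ .horiz i j x → G.VL (i + 1) j ≤ q →
      q ≤ G.VH (i + 1) j → Reach G σ .vert (i + 1) j q
  | vert_vert {i j : ℕ} {q p : ℝ} : Reach G σ .vert i j p → p ≤ q → G.VL (i + 1) j ≤ q →
      q ≤ G.VH (i + 1) j → Reach G σ .vert (i + 1) j q
  | vert_horiz {i j : ℕ} {x p : ℝ} : Reach G σ .vert i j p → G.HL i (j + 1) ≤ x →
      x ≤ G.HR i (j + 1) → Reach G σ .horiz i (j + 1) x
  | horiz_horiz {i j : ℕ} {x y : ℝ} : Reach G σ .horiz i j y → y ≤ x → G.HL i (j + 1) ≤ x →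
      x ≤ G.HR i (j + 1) → Reach G σ .horiz i (j + 1) x

variable {G : Grid} {σ : ℝ} {i j M : ℕ}

/-! ### Inversion of the rules of `Reach` -/

theorem reach_vert_zero {q : ℝ} :
    G.Reach σ .vert 0 j q ↔ j < G.SL ∧ G.VL 0 j ≤ q ∧ q ≤ G.VH 0 j ∧ σ ≤ q := by
  constructor
  · rintro ⟨⟩; exact ⟨‹_›, ‹_›, ‹_›, ‹_›⟩
  · rintro ⟨h1, h2, h3, h4⟩; exact .left h1 h2 h3 h4

theorem reach_vert_succ {q : ℝ} :
    G.Reach σ .vert (i + 1) j q ↔ G.VL (i + 1) j ≤ q ∧ q ≤ G.VH (i + 1) j ∧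
      ((∃ x, G.Reach σ .horiz i j x) ∨ ∃ p ≤ q, G.Reach σ .vert i j p) := by
  constructor
  · intro h
    cases h with
    | horiz_vert h h1 h2 => exact ⟨h1, h2, .inl ⟨_, h⟩⟩
    | vert_vert h h0 h1 h2 => exact ⟨h1, h2, .inr ⟨_, h0, h⟩⟩
  · rintro ⟨h1, h2, ⟨x, h⟩ | ⟨p, h0, h⟩⟩
    · exact .horiz_vert h h1 h2
    · exact .vert_vert h h0 h1 h2

/-- Among the start points on the edge its left free end has the largest label, and the rest of the
free interval is reached from there; hence one label serves the whole edge. -/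
theorem reach_horiz_zero {x : ℝ} :
    G.Reach σ .horiz i 0 x ↔ i < G.SB ∧ G.HL i 0 ≤ x ∧ x ≤ G.HR i 0 ∧ σ ≤ -G.HL i 0 := by
  constructor
  · intro h
    cases h with
    | lower h1 h2 h3 h4 h5 => exact ⟨h1, h2.trans h3, h4, by linarith⟩
  · rintro ⟨h1, h2, h3, h4⟩; exact .lower h1 le_rfl h2 h3 h4

theorem reach_horiz_succ {x : ℝ} :
    G.Reach σ .horiz i (j + 1) x ↔ G.HL i (j + 1) ≤ x ∧ x ≤ G.HR i (j + 1) ∧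
      ((∃ p, G.Reach σ .vert i j p) ∨ ∃ y ≤ x, G.Reach σ .horiz i j y) := by
  constructor
  · intro h
    cases h with
    | vert_horiz h h1 h2 => exact ⟨h1, h2, .inl ⟨_, h⟩⟩
    | horiz_horiz h h0 h1 h2 => exact ⟨h1, h2, .inr ⟨_, h0, h⟩⟩
  · rintro ⟨h1, h2, ⟨x, h⟩ | ⟨p, h0, h⟩⟩
    · exact .vert_horiz h h1 h2
    · exact .horiz_horiz h h0 h1 h2

/-! ### The sweep

For a horizontal edge the reached points form an interval that starts at `bp`, and the largest
label of a start point is the same number `bv` for all of them. For a vertical edge this largest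
label is a step function, which is kept in a double-ended queue with the entries
`(dp e, dv e)`, `H ≤ e < T`. -/

/-- The data of the sweep. -/
structure State where
  (bp bv dp dv : ℕ → ℝ)
  (H T : ℕ)

/-- The numbers `p`, `v` describe the reached points of a horizontal edge. -/
def RepH (G : Grid) (i j : ℕ) (p v : ℝ) : Prop :=
  (G.HL i j ≤ p ∧ p ≤ G.HR i j ∧ v ≤ j ∧
    ∀ σ x, G.Reach σ .horiz i j x ↔ p ≤ x ∧ x ≤ G.HR i j ∧ σ ≤ v) ∨
  (p = i + 2 ∧ ∀ σ x, ¬ G.Reach σ .horiz i j x)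

theorem HR_le (G : Grid) (i j : ℕ) : G.HR i j ≤ i + 1 := by
  rcases G.hH i j with h | h <;> linarith [h.1, h.2]

theorem VH_le (G : Grid) (i j : ℕ) : G.VH i j ≤ j + 1 := by
  rcases G.hV i j with h | h <;> linarith [h.1, h.2]

theorem RepH.reach {p v : ℝ} (h : G.RepH i j p v) (hp : p ≤ i + 1) :
    G.HL i j ≤ p ∧ p ≤ G.HR i j ∧ v ≤ j ∧
      ∀ σ x, G.Reach σ .horiz i j x ↔ p ≤ x ∧ x ≤ G.HR i j ∧ σ ≤ v := by
  rcases h with h | h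
  · exact h
  · linarith [h.1]

theorem RepH.not_reach {p v : ℝ} (h : G.RepH i j p v) (hp : ¬ p ≤ i + 1) (x : ℝ) :
    ¬ G.Reach σ .horiz i j x := by
  rcases h with h | h
  · exact absurd (h.2.1.trans (G.HR_le i j)) hp
  · exact h.2 _ _

/-- The properties that the rows share while the sweep has passed the columns below `i` of the
row `j`. -/
structure Common (G : Grid) (M j i : ℕ) (S : State) : Prop where
  le : S.H ≤ S.T
  dp_mono : ∀ e f, S.H ≤ e → e < f → f < S.T → S.dp f ≤ S.dp e
  dv_mono : ∀ e f, S.H ≤ e → e < f → f < S.T → S.dv f ≤ S.dv e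
  dv_le : ∀ e, S.H < e → e < S.T → S.dv e ≤ j
  passed : ∀ i' < i, i' < M → G.RepH i' (j + 1) (S.bp i') (S.bv i')
  ahead : ∀ i', i ≤ i' → i' < M → G.RepH i' j (S.bp i') (S.bv i')
  bv_mono : ∀ i₁ i₂, i₁ < i₂ → i₂ < M → S.bp i₁ ≤ i₁ + 1 → S.bp i₂ ≤ i₂ + 1 →
    S.bv i₂ ≤ S.bv i₁
  bv_le_dv : ∀ e i', S.H ≤ e → e < S.T → i ≤ i' → i' < M → S.bp i' ≤ i' + 1 →
    S.bv i' ≤ S.dv e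
  dv_le_bv : ∀ e i₀, S.H ≤ e → e < S.T → i₀ < i → i₀ < M → S.bp i₀ ≤ i₀ + 1 →
    S.dv e ≤ S.bv i₀

/-- The queue describes the reached points of the vertical edge `(i, j)`. -/
structure RowInv (G : Grid) (M j i : ℕ) (S : State) : Prop extends Common G M j i S where
  bounds : ∀ e, S.H ≤ e → e < S.T →
    G.VL i j ≤ S.dp e ∧ S.dp e ≤ G.VH i j ∧ S.dv e ≤ G.VH i j
  reach : ∀ σ q, G.Reach σ .vert i j q ↔ q ≤ G.VH i j ∧
    ∃ e, S.H ≤ e ∧ e < S.T ∧ S.dp e ≤ q ∧ σ ≤ S.dv e ∧ σ ≤ q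

/-- The queue describes the reached points of the vertical edge `(i + 1, j)`, but may hold
superfluous entries. -/
structure MidInv (G : Grid) (M j i : ℕ) (S : State) : Prop extends Common G M j (i + 1) S where
  le_dp : ∀ e, S.H ≤ e → e < S.T → (j : ℝ) ≤ S.dp e
  reach : ∀ σ q, G.Reach σ .vert (i + 1) j q ↔ G.VL (i + 1) j ≤ q ∧ q ≤ G.VH (i + 1) j ∧
    ∃ e, S.H ≤ e ∧ e < S.T ∧ S.dp e ≤ q ∧ σ ≤ S.dv e ∧ σ ≤ q

/-! ### The step through a cell -/

open Classical in
/-- Append the label of the lower edge of a cell to the queue. -/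
noncomputable def State.push (S : State) (i j : ℕ) : State :=
  if S.bp i ≤ i + 1 then
    { S with
      dp := Function.update S.dp S.T j
      dv := Function.update S.dv S.T (S.bv i)
      T := S.T + 1 }
  else S

open Classical in
/-- Pass from the lower edge to the upper edge of a cell; `B` is the end of the queue of the left
edge. -/
noncomputable def State.upper (S : State) (G : Grid) (i j B : ℕ) : State :=
  let S' : State := if S.H + 1 ≤ B then
      { S with
        bp := Function.update S.bp i (G.HL i (j + 1))
        bv := Function.update S.bv i (S.dv S.H) }
    else { S with bp := Function.update S.bp i (max (S.bp i) (G.HL i (j + 1))) }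
  if S'.bp i ≤ G.HR i (j + 1) then S' else { S' with bp := Function.update S'.bp i (i + 2) }

/-- Every point of the left edge reaches the whole free part of the upper edge, so only the best
label of the left edge counts. This is the label at the head: labels decrease along the queue,
`bounds` keeps them at most `VH`, so that the top point of the edge attains this one, and by
`bv_le_dv` the lower edge offers nothing better. -/
theorem RowInv.upper_left {S : State} (h : RowInv G M j i S) (hi : i < M) (hL : S.H < S.T)
    (hF : G.HL i (j + 1) ≤ G.HR i (j + 1)) :
    G.RepH i (j + 1) (G.HL i (j + 1)) (S.dv S.H) := by
  have hb := h.bounds S.H le_rfl hL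
  refine .inl ⟨le_rfl, hF, by push_cast; linarith [G.VH_le i j], fun σ x => ?_⟩
  rw [reach_horiz_succ]
  refine and_congr_right fun h1 => and_congr_right fun h2 => ?_
  constructor
  · rintro (⟨p, hp⟩ | ⟨y, -, hy⟩)
    · obtain ⟨-, e, he1, he2, -, he4, -⟩ := (h.reach σ p).1 hp
      rcases he1.eq_or_lt with rfl | he
      · exact he4
      · exact he4.trans (h.dv_mono _ _ le_rfl he he2)
    · by_cases hr : S.bp i ≤ i + 1
      · exact ((((h.ahead i le_rfl hi).reach hr).2.2.2 σ y).1 hy).2.2.trans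
          (h.bv_le_dv _ _ le_rfl hL le_rfl hi hr)
      · exact absurd hy ((h.ahead i le_rfl hi).not_reach hr y)
  · intro hs
    exact .inl ⟨G.VH i j, (h.reach _ _).2 ⟨le_rfl, S.H, le_rfl, hL, hb.2.1, hs,
      hs.trans hb.2.2⟩⟩

/-- With an empty queue paths come only from the lower edge. They cannot move to the left, which
gives the maximum, and the label stays the same. -/
theorem RowInv.upper_lower {S : State} (h : RowInv G M j i S) (hi : i < M) (hL : ¬ S.H < S.T)
    (hF : max (S.bp i) (G.HL i (j + 1)) ≤ G.HR i (j + 1)) :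
    G.RepH i (j + 1) (max (S.bp i) (G.HL i (j + 1))) (S.bv i) := by
  have hr : S.bp i ≤ i + 1 := (le_max_left _ _).trans (hF.trans (G.HR_le _ _))
  obtain ⟨h1, h2, h3, h4⟩ := (h.ahead i le_rfl hi).reach hr
  refine .inl ⟨le_max_right _ _, hF, by push_cast; linarith, fun σ x => ?_⟩
  rw [reach_horiz_succ, max_le_iff]
  constructor
  · rintro ⟨h5, h6, ⟨p, hp⟩ | ⟨y, hyx, hy⟩⟩
    · obtain ⟨-, e, he1, he2, -⟩ := (h.reach σ p).1 hp
      omega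
    · obtain ⟨h7, h8, h9⟩ := (h4 σ y).1 hy
      exact ⟨⟨h7.trans hyx, h5⟩, h6, h9⟩
  · rintro ⟨⟨h5, h6⟩, h7, h8⟩
    exact ⟨h6, h7, .inr ⟨S.bp i, h5, (h4 _ _).2 ⟨le_rfl, h2, h8⟩⟩⟩

theorem repH_upper_empty
    (hF : ¬ G.HL i (j + 1) ≤ G.HR i (j + 1)) (v : ℝ) :
    G.RepH i (j + 1) (i + 2) v := by
  refine .inr ⟨rfl, fun σ x hx => ?_⟩
  rw [reach_horiz_succ] at hx
  exact hF (hx.1.trans hx.2.1)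

theorem RowInv.upper_lower_empty {S : State} (h : RowInv G M j i S) (hi : i < M)
    (hL : ¬ S.H < S.T) (hF : ¬ max (S.bp i) (G.HL i (j + 1)) ≤ G.HR i (j + 1)) (v : ℝ) :
    G.RepH i (j + 1) (i + 2) v := by
  refine .inr ⟨rfl, fun σ x hx => hF ?_⟩
  rw [reach_horiz_succ] at hx
  obtain ⟨h5, h6, ⟨p, hp⟩ | ⟨y, hyx, hy⟩⟩ := hx
  · obtain ⟨-, e, he1, he2, -⟩ := (h.reach σ p).1 hp
    omega
  · by_cases hr : S.bp i ≤ i + 1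
    · have := (((h.ahead i le_rfl hi).reach hr).2.2.2 σ y).1 hy
      exact max_le (this.1.trans (hyx.trans h6)) (h5.trans h6)
    · exact absurd hy ((h.ahead i le_rfl hi).not_reach hr y)

/-- What the passage through a cell does to the arrays of the horizontal edges. -/
theorem upper_push_spec (S : State) (G : Grid) (i j : ℕ) :
    let S' := (S.push i j).upper G i j S.T
    S'.H = S.H ∧ S'.T = (S.push i j).T ∧ S'.dp = (S.push i j).dp ∧ S'.dv = (S.push i j).dv ∧
    (∀ i', i' ≠ i → S'.bp i' = S.bp i' ∧ S'.bv i' = S.bv i') ∧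
    ((S.H < S.T ∧ S'.bv i = S.dv S.H ∧
      ((G.HL i (j + 1) ≤ G.HR i (j + 1) ∧ S'.bp i = G.HL i (j + 1)) ∨
        (¬ G.HL i (j + 1) ≤ G.HR i (j + 1) ∧ S'.bp i = i + 2))) ∨
     (¬ S.H < S.T ∧ S'.bv i = S.bv i ∧
      ((max (S.bp i) (G.HL i (j + 1)) ≤ G.HR i (j + 1) ∧
          S'.bp i = max (S.bp i) (G.HL i (j + 1))) ∨
        (¬ max (S.bp i) (G.HL i (j + 1)) ≤ G.HR i (j + 1) ∧ S'.bp i = i + 2)))) := by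
  intro S'
  have e1 : (S.push i j).H = S.H := by unfold State.push; split_ifs <;> rfl
  have e2 : (S.push i j).bp = S.bp := by unfold State.push; split_ifs <;> rfl
  have e3 : (S.push i j).bv = S.bv := by unfold State.push; split_ifs <;> rfl
  -- The new entry occupies the slot `S.T`, which is the head only if the queue was empty.
  have e4 : S.H < S.T → (S.push i j).dv S.H = S.dv S.H := by
    intro h
    unfold State.push
    split_ifs
    · simp [Function.update_of_ne h.ne]
    · rfl
  by_cases hL : S.H < S.T
  · have hL' : S.H + 1 ≤ S.T := hL
    by_cases hF : G.HL i (j + 1) ≤ G.HR i (j + 1)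
    · simp [S', State.upper, e1, e2, e3, e4 hL, hL, hL', hF]
      intro i' h; simp [h]
    · simp [S', State.upper, e1, e2, e3, e4 hL, hL, hL', hF]
      intro i' h; simp [h]
  · have hL' : ¬ S.H + 1 ≤ S.T := hL
    by_cases hF : max (S.bp i) (G.HL i (j + 1)) ≤ G.HR i (j + 1)
    · have := max_le_iff.1 hF
      simp [S', State.upper, e1, e2, e3, hL, hL', this]
      intro i' h; simp [h]
    · simp only [S', State.upper, e1, e2, e3, hL', if_false, Function.update_self, hF, hL]
      refine ⟨trivial, trivial, trivial, trivial, fun i' h => ⟨by simp [h], trivial⟩,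
        .inr ⟨not_false, trivial, .inr ⟨not_false, trivial⟩⟩⟩

theorem push_cases (S : State) (i j : ℕ) :
    (S.bp i ≤ i + 1 ∧ (S.push i j).T = S.T + 1 ∧ (S.push i j).dp S.T = j ∧
      (S.push i j).dv S.T = S.bv i ∧
      ∀ e, e ≠ S.T → (S.push i j).dp e = S.dp e ∧ (S.push i j).dv e = S.dv e) ∨
    (¬ S.bp i ≤ i + 1 ∧ S.push i j = S) := by
  by_cases h : S.bp i ≤ i + 1
  · left
    simp only [State.push, h, if_true]
    refine ⟨trivial, trivial, by simp, by simp, fun e he => by simp [he]⟩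
  · right; simp [State.push, h]

/-- The passage through a cell, before the superfluous entries are removed. -/
theorem RowInv.mid {S : State} (h : RowInv G M j i S) (hi : i < M) :
    MidInv G M j i ((S.push i j).upper G i j S.T) := by
  obtain ⟨hH, hT, hdp, hdv, hne, hcase⟩ := upper_push_spec S G i j
  set S' := (S.push i j).upper G i j S.T with hS'
  have hT' : S.T ≤ S'.T ∧ S'.T ≤ S.T + 1 := by
    rw [hT]; rcases push_cases S i j with hp | hp
    · omega
    · rw [hp.2]; omega
  have hnew : S.T < S'.T → S.bp i ≤ i + 1 ∧ S'.dp S.T = j ∧ S'.dv S.T = S.bv i := by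
    rw [hT, hdp, hdv]; rcases push_cases S i j with hp | hp
    · exact fun _ => ⟨hp.1, hp.2.2.1, hp.2.2.2.1⟩
    · rw [hp.2]; omega
  have hpush : S.bp i ≤ i + 1 → S.T < S'.T := by
    rw [hT]; rcases push_cases S i j with hp | hp
    · omega
    · exact fun hh => absurd hh hp.1
  have hold : ∀ e < S.T, S'.dp e = S.dp e ∧ S'.dv e = S.dv e := by
    intro e he
    rw [hdp, hdv]; rcases push_cases S i j with hp | hp
    · exact hp.2.2.2.2 e he.ne
    · rw [hp.2]; exact ⟨rfl, rfl⟩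
  have hbj : S.bp i ≤ i + 1 → S.bv i ≤ j := fun hr => ((h.ahead i le_rfl hi).reach hr).2.2.1
  have hVL : ∀ e, S.H ≤ e → e < S.T → (j : ℝ) ≤ S.dp e := by
    intro e h1 h2
    have := h.bounds e h1 h2
    rcases G.hV i j with hh | hh <;> linarith [hh.1, hh.2]
  have hrep : G.RepH i (j + 1) (S'.bp i) (S'.bv i) := by
    rcases hcase with ⟨hL, hv, ⟨hF, hp⟩ | ⟨hF, hp⟩⟩ | ⟨hL, hv, ⟨hF, hp⟩ | ⟨hF, hp⟩⟩ <;>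
      rw [hp, hv]
    · exact h.upper_left hi hL hF
    · exact repH_upper_empty hF _
    · exact h.upper_lower hi hL hF
    · exact h.upper_lower_empty hi hL hF _
  -- if the upper edge is reached from the lower edge then so was the lower edge
  have hlow : ¬ S.H < S.T → S'.bp i ≤ i + 1 → S.bp i ≤ i + 1 ∧ S'.bv i = S.bv i := by
    intro hL hr
    rcases hcase with ⟨hL', -⟩ | ⟨-, hv, ⟨hF, hp⟩ | ⟨hF, hp⟩⟩
    · exact absurd hL' hL
    · exact ⟨(le_max_left _ _).trans (hF.trans (G.HR_le _ _)), hv⟩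
    · rw [hp] at hr; linarith
  have hlab : S.H < S.T → S'.bv i = S.dv S.H := by
    intro hL
    rcases hcase with ⟨-, hv, -⟩ | ⟨hL', -⟩
    · exact hv
    · exact absurd hL hL'
  have hle := h.le
  refine ⟨⟨by omega, ?_, ?_, ?_, ?_, ?_, ?_, ?_, ?_⟩, ?_, ?_⟩
  · intro e f h1 h2 h3
    rw [hH] at h1
    rw [(hold e (by omega)).1]
    rcases (show f < S.T ∨ f = S.T by omega) with hf | rfl
    · rw [(hold f hf).1]; exact h.dp_mono e f h1 h2 hf
    · rw [(hnew h3).2.1]; exact hVL e h1 h2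
  · intro e f h1 h2 h3
    rw [hH] at h1
    rw [(hold e (by omega)).2]
    rcases (show f < S.T ∨ f = S.T by omega) with hf | rfl
    · rw [(hold f hf).2]; exact h.dv_mono e f h1 h2 hf
    · rw [(hnew h3).2.2]; exact h.bv_le_dv e i h1 h2 le_rfl hi (hnew h3).1
  · intro e h1 h2
    rw [hH] at h1
    rcases (show e < S.T ∨ e = S.T by omega) with hf | rfl
    · rw [(hold e hf).2]; exact h.dv_le e h1 hf
    · rw [(hnew h2).2.2]; exact hbj (hnew h2).1
  · intro i' h1 h2
    rcases (show i' < i ∨ i' = i by omega) with h3 | rfl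
    · rw [(hne i' h3.ne).1, (hne i' h3.ne).2]; exact h.passed i' h3 h2
    · exact hrep
  · intro i' h1 h2
    rw [(hne i' (by omega)).1, (hne i' (by omega)).2]; exact h.ahead i' (by omega) h2
  -- The label of the new upper edge is either that of the head of the queue, which ranks between
  -- the upper edges on its left and the lower edges on its right, or that of the lower edge it
  -- replaces. Either way the order along the staircase survives.
  · intro i₁ i₂ h1 h2 h3 h4
    by_cases e1 : i₁ = i
    · subst e1
      rw [(hne i₂ h1.ne').1] at h4
      rw [(hne i₂ h1.ne').2]
      by_cases hL : S.H < S.T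
      · rw [hlab hL]; exact h.bv_le_dv _ _ le_rfl hL h1.le h2 h4
      · rw [(hlow hL h3).2]; exact h.bv_mono _ _ h1 h2 (hlow hL h3).1 h4
    · rw [(hne i₁ e1).1] at h3
      rw [(hne i₁ e1).2]
      by_cases e2 : i₂ = i
      · subst e2
        by_cases hL : S.H < S.T
        · rw [hlab hL]; exact h.dv_le_bv _ _ le_rfl hL h1 (h1.trans h2) h3
        · rw [(hlow hL h4).2]; exact h.bv_mono _ _ h1 h2 h3 (hlow hL h4).1
      · rw [(hne i₂ e2).1] at h4
        rw [(hne i₂ e2).2]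
        exact h.bv_mono _ _ h1 h2 h3 h4
  · intro e i' h1 h2 h3 h4 h5
    rw [hH] at h1
    rw [(hne i' (by omega)).1] at h5
    rw [(hne i' (by omega)).2]
    rcases (show e < S.T ∨ e = S.T by omega) with hf | rfl
    · rw [(hold e hf).2]; exact h.bv_le_dv e i' h1 hf (by omega) h4 h5
    · rw [(hnew h2).2.2]; exact h.bv_mono _ _ (by omega) h4 (hnew h2).1 h5
  · intro e i' h1 h2 h3 h4 h5
    rw [hH] at h1
    rcases (show i' < i ∨ i' = i by omega) with h6 | rfl
    · rw [(hne i' h6.ne).1] at h5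
      rw [(hne i' h6.ne).2]
      rcases (show e < S.T ∨ e = S.T by omega) with hf | rfl
      · rw [(hold e hf).2]; exact h.dv_le_bv e i' h1 hf h6 h4 h5
      · rw [(hnew h2).2.2]; exact h.bv_mono _ _ h6 hi h5 (hnew h2).1
    · by_cases hL : S.H < S.T
      · rw [hlab hL]
        rcases (show e < S.T ∨ e = S.T by omega) with hf | rfl
        · rw [(hold e hf).2]
          rcases h1.eq_or_lt with rfl | h1
          · exact le_rfl
          · exact h.dv_mono _ _ le_rfl h1 hf
        · rw [(hnew h2).2.2]; exact h.bv_le_dv _ _ le_rfl hL le_rfl hi (hnew h2).1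
      · obtain rfl : e = S.T := by omega
        rw [(hnew h2).2.2, (hlow hL h5).2]
  · intro e h1 h2
    rw [hH] at h1
    rcases (show e < S.T ∨ e = S.T by omega) with hf | rfl
    · rw [(hold e hf).1]; exact hVL e h1 hf
    · rw [(hnew h2).2.1]
  · intro σ q
    rw [reach_vert_succ]
    refine and_congr_right fun hq1 => and_congr_right fun hq2 => ?_
    have hjq : (j : ℝ) ≤ q := by
      rcases G.hV (i + 1) j with hh | hh <;> linarith [hh.1, hh.2]
    constructor
    · rintro (⟨x, hx⟩ | ⟨p, hpq, hp⟩)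
      · by_cases hr : S.bp i ≤ i + 1
        · have h3 := ((((h.ahead i le_rfl hi).reach hr).2.2.2 σ x).1 hx).2.2
          have hlt := hpush hr
          -- The new entry sits at the bottom `j` of the right edge because from the lower edge
          -- every free point of the right edge can be reached. The condition `σ ≤ q` costs nothing,
          -- since labels of the lower edge are at most `j`.
          refine ⟨S.T, by omega, hlt, by rw [(hnew hlt).2.1]; exact hjq,
            by rw [(hnew hlt).2.2]; exact h3, by linarith [hbj hr]⟩
        · exact absurd hx ((h.ahead i le_rfl hi).not_reach hr x)
      · obtain ⟨-, e, he1, he2, he3, he4, he5⟩ := (h.reach σ p).1 hp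
        exact ⟨e, by omega, by omega, by rw [(hold e he2).1]; linarith,
          by rw [(hold e he2).2]; exact he4, by linarith⟩
    · rintro ⟨e, he1, he2, he3, he4, he5⟩
      rw [hH] at he1
      rcases (show e < S.T ∨ e = S.T by omega) with hf | rfl
      · right
        rw [(hold e hf).1] at he3
        rw [(hold e hf).2] at he4
        have hb := h.bounds e he1 hf
        -- If `q` lies above the left free interval, the path leaves the left edge at its upper end;
        -- no label is lost there because `dv e ≤ VH i j`.
        refine ⟨min q (G.VH i j), min_le_left _ _, (h.reach _ _).2 ⟨min_le_right _ _, e, he1, hf,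
          le_min he3 hb.2.1, he4, le_min he5 (he4.trans hb.2.2)⟩⟩
      · left
        rw [(hnew he2).2.2] at he4
        obtain ⟨h5, h6, h7, h8⟩ := (h.ahead i le_rfl hi).reach (hnew he2).1
        exact ⟨S.bp i, (h8 _ _).2 ⟨le_rfl, h6, he4⟩⟩

/-! ### Cleaning up the queue -/

/-- The properties that the rows share are inherited by a part of the queue. -/
theorem Common.sub {S : State} (h : Common G M j i S) {H T : ℕ} (h1 : S.H ≤ H) (h2 : T ≤ S.T)
    (h3 : H ≤ T) : Common G M j i { S with H := H, T := T } where
  le := h3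
  dp_mono e f h4 h5 h6 := h.dp_mono e f (h1.trans h4) h5 (lt_of_lt_of_le h6 h2)
  dv_mono e f h4 h5 h6 := h.dv_mono e f (h1.trans h4) h5 (lt_of_lt_of_le h6 h2)
  dv_le e h4 h5 := h.dv_le e (lt_of_le_of_lt h1 h4) (lt_of_lt_of_le h5 h2)
  passed := h.passed
  ahead := h.ahead
  bv_mono := h.bv_mono
  bv_le_dv e i' h4 h5 := h.bv_le_dv e i' (h1.trans h4) (lt_of_lt_of_le h5 h2)
  dv_le_bv e i' h4 h5 := h.dv_le_bv e i' (h1.trans h4) (lt_of_lt_of_le h5 h2)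

/-- No free point of the new edge is as high as the position of this entry, so the entry serves none
of them. -/
theorem MidInv.popFront {S : State} (h : MidInv G M j i S) (hL : S.H < S.T)
    (hp : ¬ S.dp S.H ≤ G.VH (i + 1) j) : MidInv G M j i { S with H := S.H + 1 } where
  toCommon := h.toCommon.sub (H := S.H + 1) (T := S.T) (by omega) le_rfl (by omega)
  le_dp e h1 h2 := h.le_dp e (by simp only at h1; omega) h2
  reach σ q := by
    rw [h.reach]
    refine and_congr_right fun hq1 => and_congr_right fun hq2 => ?_
    constructor
    · rintro ⟨e, he1, he2, he3, he4⟩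
      rcases he1.eq_or_lt with rfl | he
      · exact absurd (he3.trans hq2) hp
      · exact ⟨e, he, he2, he3, he4⟩
    · rintro ⟨e, he1, he2, he3⟩
      exact ⟨e, by simp only at he1; omega, he2, he3⟩

/-- After the removal of entries at the front the vertical edge has free points. -/
theorem MidInv.nonempty {S : State} (h : MidInv G M j i S) (hL : S.H < S.T)
    (hp : S.dp S.H ≤ G.VH (i + 1) j) :
    (j : ℝ) ≤ G.VL (i + 1) j ∧ G.VL (i + 1) j ≤ G.VH (i + 1) j := by
  have := h.le_dp S.H le_rfl hL
  rcases G.hV (i + 1) j with hh | hh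
  · exact ⟨hh.1, hh.2.1⟩
  · linarith [hh.2]

/-- At a free point `q` the condition `σ ≤ q` already excludes labels above `VH`, so nothing is
lost. The bound ensures that the label at the head is attained at the top of the edge, as
`upper_left` needs. Later entries stem from lower edges, whose labels are at most `j` (`dv_le`);
therefore the head is the only entry to be changed and the order is kept. -/
theorem MidInv.cap {S : State} (h : MidInv G M j i S) (hL : S.H < S.T)
    (hp : S.dp S.H ≤ G.VH (i + 1) j) :
    MidInv G M j i
      { S with dv := Function.update S.dv S.H (min (S.dv S.H) (G.VH (i + 1) j)) } := by
  have hn := h.nonempty hL hp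
  have hne : ∀ e, S.H < e →
      Function.update S.dv S.H (min (S.dv S.H) (G.VH (i + 1) j)) e = S.dv e :=
    fun e he => Function.update_of_ne he.ne' _ _
  refine ⟨⟨h.le, h.dp_mono, ?_, ?_, h.passed, h.ahead, h.bv_mono, ?_, ?_⟩, h.le_dp, ?_⟩
  · intro e f h1 h2 h3
    simp only at h1 h3 ⊢
    rw [hne f (by omega)]
    rcases h1.eq_or_lt with rfl | he
    · rw [Function.update_self]
      exact le_min (h.dv_mono _ _ le_rfl h2 h3) (by linarith [h.dv_le f h2 h3, hn.1, hn.2])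
    · rw [hne e he]; exact h.dv_mono _ _ h1 h2 h3
  · intro e h1 h2
    simp only at h1 h2 ⊢
    rw [hne e h1]; exact h.dv_le e h1 h2
  · intro e i' h1 h2 h3 h4 h5
    simp only at h1 h2 ⊢
    rcases h1.eq_or_lt with rfl | he
    · rw [Function.update_self]
      exact le_min (h.bv_le_dv _ _ le_rfl hL h3 h4 h5)
        (by linarith [((h.ahead i' h3 h4).reach h5).2.2.1, hn.1, hn.2])
    · rw [hne e he]; exact h.bv_le_dv _ _ h1 h2 h3 h4 h5
  · intro e i' h1 h2 h3 h4 h5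
    simp only at h1 h2 ⊢
    rcases h1.eq_or_lt with rfl | he
    · rw [Function.update_self]
      exact (min_le_left _ _).trans (h.dv_le_bv _ _ le_rfl hL h3 h4 h5)
    · rw [hne e he]; exact h.dv_le_bv _ _ h1 h2 h3 h4 h5
  · intro σ q
    rw [h.reach]
    refine and_congr_right fun hq1 => and_congr_right fun hq2 => exists_congr fun e => ?_
    simp only
    refine and_congr_right fun h1 => and_congr_right fun h2 => and_congr_right fun h3 => ?_
    rcases h1.eq_or_lt with rfl | he
    · rw [Function.update_self]
      exact ⟨fun h => ⟨le_min h.1 (h.2.trans hq2), h.2⟩,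
        fun h => ⟨h.1.trans (min_le_left _ _), h.2⟩⟩
    · rw [hne e he]

/-- The last entry but one is in force on the whole free interval and its label is at least as good,
so the last one is superfluous. -/
theorem MidInv.popBack {S : State} (h : MidInv G M j i S) (hL : S.H + 2 ≤ S.T)
    (hp : S.dp (S.T - 2) ≤ G.VL (i + 1) j) : MidInv G M j i { S with T := S.T - 1 } where
  toCommon := h.toCommon.sub (H := S.H) (T := S.T - 1) le_rfl (by omega) (by omega)
  le_dp e h1 h2 := h.le_dp e h1 (by simp only at h2; omega)
  reach σ q := by
    rw [h.reach]
    refine and_congr_right fun hq1 => and_congr_right fun hq2 => ?_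
    constructor
    · rintro ⟨e, he1, he2, he3, he4, he5⟩
      by_cases he : e < S.T - 1
      · exact ⟨e, he1, he, he3, he4, he5⟩
      · exact ⟨S.T - 2, by simp only; omega, by simp only; omega, by simp only; linarith,
          by simp only; linarith [h.dv_mono (S.T - 2) e (by omega) (by omega) he2], he5⟩
    · rintro ⟨e, he1, he2, he3⟩
      exact ⟨e, he1, by simp only at he2; omega, he3⟩

open Classical in
/-- Move the last entry of the queue into the free interval that starts at `l`. -/
noncomputable def State.raise (S : State) (l : ℝ) : State :=
  if S.H + 1 ≤ S.T ∧ S.dp (S.T - 1) ≤ l then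
    { S with dp := Function.update S.dp (S.T - 1) l } else S

/-- By `hback` only the last entry can still lie below the free interval. Lifting it to the lower
end makes every position a free point of the edge; the final comparison uses these positions as
candidates. -/
theorem MidInv.raise {S : State} (h : MidInv G M j i S)
    (hfront : ∀ e, S.H ≤ e → e < S.T → S.dp e ≤ G.VH (i + 1) j ∧ S.dv e ≤ G.VH (i + 1) j)
    (hback : S.H + 2 ≤ S.T → G.VL (i + 1) j < S.dp (S.T - 2)) :
    RowInv G M j (i + 1) (S.raise (G.VL (i + 1) j)) := by
  have hlast : ∀ e, S.H ≤ e → e < S.T - 1 → G.VL (i + 1) j < S.dp e := by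
    intro e h1 h2
    have h3 := hback (by omega)
    rcases (show e = S.T - 2 ∨ e < S.T - 2 by omega) with rfl | h4
    · exact h3
    · exact h3.trans_le (h.dp_mono _ _ h1 h4 (by omega))
  by_cases hc : S.H + 1 ≤ S.T ∧ S.dp (S.T - 1) ≤ G.VL (i + 1) j
  · obtain ⟨hL, hc⟩ := hc
    have hn := h.nonempty hL (hfront _ le_rfl hL).1
    have hne : ∀ e, e ≠ S.T - 1 →
        Function.update S.dp (S.T - 1) (G.VL (i + 1) j) e = S.dp e :=
      fun e he => Function.update_of_ne he _ _
    simp only [State.raise, hL, hc, and_self, if_true]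
    refine ⟨⟨h.le, ?_, h.dv_mono, h.dv_le, h.passed, h.ahead, h.bv_mono, h.bv_le_dv,
      h.dv_le_bv⟩, ?_, ?_⟩
    · intro e f h1 h2 h3
      simp only at h1 h3 ⊢
      rw [hne e (by omega)]
      by_cases hf : f = S.T - 1
      · subst hf
        rw [Function.update_self]; exact (hlast e h1 h2).le
      · rw [hne f hf]; exact h.dp_mono _ _ h1 h2 h3
    · intro e h1 h2
      simp only at h1 h2 ⊢
      have hf := hfront e h1 h2
      by_cases he : e = S.T - 1
      · subst he
        rw [Function.update_self]; exact ⟨le_rfl, hn.2, hf.2⟩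
      · rw [hne e he]; exact ⟨(hlast e h1 (by omega)).le, hf⟩
    · intro σ q
      rw [h.reach]
      simp only
      constructor
      · rintro ⟨hq1, hq2, e, he1, he2, he3, he4⟩
        refine ⟨hq2, e, he1, he2, ?_, he4⟩
        by_cases he : e = S.T - 1
        · subst he
          rwa [Function.update_self]
        · rwa [hne e he]
      · rintro ⟨hq2, e, he1, he2, he3, he4⟩
        by_cases he : e = S.T - 1
        · subst he
          rw [Function.update_self] at he3
          exact ⟨he3, hq2, _, he1, he2, hc.trans he3, he4⟩
        · rw [hne e he] at he3
          exact ⟨(hlast e he1 (by omega)).le.trans he3, hq2, e, he1, he2, he3, he4⟩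
  · rw [State.raise, if_neg hc]
    have hall : ∀ e, S.H ≤ e → e < S.T → G.VL (i + 1) j ≤ S.dp e := by
      intro e h1 h2
      by_cases he : e = S.T - 1
      · subst he
        exact (not_le.1 fun hh => hc ⟨by omega, hh⟩).le
      · exact (hlast e h1 (by omega)).le
    refine ⟨h.toCommon, fun e h1 h2 => ⟨hall e h1 h2, hfront e h1 h2⟩, fun σ q => ?_⟩
    rw [h.reach]
    constructor
    · rintro ⟨-, hq⟩; exact hq
    · rintro ⟨hq2, e, he1, he2, he3, he4⟩
      exact ⟨(hall e he1 he2).trans he3, hq2, e, he1, he2, he3, he4⟩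

/-! ### From row to row -/

/-- The properties of the horizontal edges before the row `j` is swept. -/
structure LineInv (G : Grid) (M j : ℕ) (bp bv : ℕ → ℝ) : Prop where
  rep : ∀ i < M, G.RepH i j (bp i) (bv i)
  mono : ∀ i₁ i₂, i₁ < i₂ → i₂ < M → bp i₁ ≤ i₁ + 1 → bp i₂ ≤ i₂ + 1 → bv i₂ ≤ bv i₁

theorem RowInv.line {S : State} (h : RowInv G M j M S) : LineInv G M (j + 1) S.bp S.bv :=
  ⟨fun i hi => h.passed i hi hi, h.bv_mono⟩

theorem LineInv.rowInv_empty {S : State} (h : LineInv G M j S.bp S.bv) (hT : S.T = S.H)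
    (hS : ¬ (j < G.SL ∧ G.VL 0 j ≤ G.VH 0 j)) : RowInv G M j 0 S where
  le := hT.ge
  dp_mono e f h1 h2 h3 := by omega
  dv_mono e f h1 h2 h3 := by omega
  dv_le e h1 h2 := by omega
  passed i' h1 := by omega
  ahead i' _ h2 := h.rep i' h2
  bv_mono := h.mono
  bv_le_dv e i' h1 h2 := by omega
  dv_le_bv e i' h1 h2 := by omega
  bounds e h1 h2 := by omega
  reach σ q := by
    rw [reach_vert_zero]
    constructor
    · rintro ⟨h1, h2, h3, -⟩
      exact absurd ⟨h1, h2.trans h3⟩ hS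
    · rintro ⟨-, e, h1, h2, -⟩
      omega

/-- A point `q` of the left side is itself a start with label `q`. The single entry `(VL, VH)`
expresses this, as the condition `σ ≤ q` of the representation does the rest; without that condition
the labels would not form a step function. -/
theorem LineInv.rowInv_single {S : State} (h : LineInv G M j S.bp S.bv) (hT : S.T = S.H + 1)
    (hj : j < G.SL) (hF : G.VL 0 j ≤ G.VH 0 j) (hp : S.dp S.H = G.VL 0 j)
    (hv : S.dv S.H = G.VH 0 j) : RowInv G M j 0 S := by
  have hjV : (j : ℝ) ≤ G.VH 0 j := by
    rcases G.hV 0 j with hh | hh <;> linarith [hh.1, hh.2]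
  refine ⟨⟨by omega, by omega, by omega, by omega, by omega, fun i' _ h2 => h.rep i' h2, h.mono,
    ?_, by omega⟩, ?_, ?_⟩
  · intro e i' h1 h2 h3 h4 h5
    obtain rfl : e = S.H := by omega
    rw [hv]
    exact ((h.rep i' h4).reach h5).2.2.1.trans hjV
  · intro e h1 h2
    obtain rfl : e = S.H := by omega
    rw [hp, hv]; exact ⟨le_rfl, hF, le_rfl⟩
  · intro σ q
    rw [reach_vert_zero]
    constructor
    · rintro ⟨-, h2, h3, h4⟩
      exact ⟨h3, S.H, le_rfl, by omega, by rwa [hp], by rw [hv]; linarith, h4⟩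
    · rintro ⟨h3, e, h1, h2, h4, h5, h6⟩
      obtain rfl : e = S.H := by omega
      exact ⟨hj, by rwa [hp] at h4, h3, h6⟩

/-- The labels `-HL i 0` decrease with `i` because `HL i 0` lies between `i` and `i + 1`. The
position `i + 2` is beyond the edge and so marks edges without reached points. -/
theorem lineInv_zero {bp bv : ℕ → ℝ}
    (h : ∀ i < M, (i < G.SB ∧ G.HL i 0 ≤ G.HR i 0 ∧ bp i = G.HL i 0 ∧ bv i = -G.HL i 0) ∨
      (¬ (i < G.SB ∧ G.HL i 0 ≤ G.HR i 0) ∧ bp i = i + 2)) : LineInv G M 0 bp bv := by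
  have hpos : ∀ i, G.HL i 0 ≤ G.HR i 0 → (i : ℝ) ≤ G.HL i 0 := by
    intro i hi
    rcases G.hH i 0 with hh | hh <;> linarith [hh.1, hh.2]
  constructor
  · intro i hi
    rcases h i hi with ⟨h1, h2, h3, h4⟩ | ⟨h1, h2⟩
    · rw [h3, h4]
      refine .inl ⟨le_rfl, h2, ?_, fun σ x => ?_⟩
      · have h0 : (0 : ℝ) ≤ i := i.cast_nonneg
        push_cast
        linarith [hpos i h2]
      · rw [reach_horiz_zero]; tauto
    · refine .inr ⟨h2, fun σ x hx => h1 ?_⟩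
      rw [reach_horiz_zero] at hx
      exact ⟨hx.1, hx.2.1.trans hx.2.2.1⟩
  · intro i₁ i₂ h12 h2 hr1 hr2
    have hi : (i₁ : ℝ) + 1 ≤ i₂ := by exact_mod_cast h12
    rcases h i₁ (h12.trans h2) with ⟨-, a2, a3, a4⟩ | ⟨-, a2⟩
    · rcases h i₂ h2 with ⟨-, b2, b3, b4⟩ | ⟨-, b2⟩
      · rw [a4, b4]; linarith [hpos i₂ b2]
      · linarith
    · linarith

end Grid

open RealRAM (posInd posInd_of_pos posInd_of_nonpos)

/-! ### The free interval on an edge -/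

section Quadratic

/-- The point of `[0, 1]` where `a t² - 2 b t + c` is smallest. -/
noncomputable def segMin (a b : ℝ) : ℝ := max 0 (min 1 (b / a))

/-- The indicator of the emptiness of `{t ∈ [0, 1] | a t² - 2 b t + c ≤ 0}`. -/
noncomputable def segEmpty (a b c : ℝ) : ℝ :=
  posInd (a * segMin a b * segMin a b - 2 * b * segMin a b + c)

/-- The lower end of `{t ∈ [0, 1] | a t² - 2 b t + c ≤ 0}`, or `2` if this set is empty. -/
noncomputable def segLo (a b c : ℝ) : ℝ :=
  segEmpty a b c * 2 + (1 - segEmpty a b c) * (posInd c * ((b - √(b * b - a * c)) / a))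

/-- The upper end of `{t ∈ [0, 1] | a t² - 2 b t + c ≤ 0}`, or `-1` if this set is empty. -/
noncomputable def segHi (a b c : ℝ) : ℝ :=
  (1 - segEmpty a b c) *
    (1 - posInd (a - 2 * b + c) * (1 - (b + √(b * b - a * c)) / a)) - segEmpty a b c

variable {a b c : ℝ}

theorem segMin_mem (a b : ℝ) : 0 ≤ segMin a b ∧ segMin a b ≤ 1 :=
  ⟨le_max_left _ _, max_le zero_le_one (min_le_left _ _)⟩

/-- For `a > 0` the minimum of the parabola over [0, 1] is at the point nearest to its vertex `b /
a`; for `a = 0` the hypothesis makes the function constant. -/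
theorem segMin_le (ha : 0 ≤ a) (hb : a = 0 → b = 0) {t : ℝ} (h0 : 0 ≤ t) (h1 : t ≤ 1) :
    a * segMin a b * segMin a b - 2 * b * segMin a b + c ≤ a * t ^ 2 - 2 * b * t + c := by
  rcases ha.eq_or_lt with rfl | ha
  · simp [hb rfl]
  · have hba : b = a * (b / a) := by field_simp
    set r := b / a with hr
    rw [hba]
    rcases le_total r 0 with h | h
    · have : segMin a (a * r) = 0 := by
        rw [← hba, segMin, ← hr, min_eq_right (h.trans zero_le_one), max_eq_left h]
      rw [this]
      nlinarith [mul_nonneg ha.le (sq_nonneg t), mul_nonneg (mul_nonneg ha.le h0) (neg_nonneg.2 h)]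
    · rcases le_total 1 r with h' | h'
      · have : segMin a (a * r) = 1 := by
          rw [← hba, segMin, ← hr, min_eq_left h', max_eq_right zero_le_one]
        rw [this]
        nlinarith [mul_nonneg (mul_nonneg ha.le (sub_nonneg.2 h1)) (sub_nonneg.2 h'),
          mul_nonneg ha.le (sq_nonneg (1 - t))]
      · have : segMin a (a * r) = r := by
          rw [← hba, segMin, ← hr, min_eq_right h', max_eq_right h]
        rw [this]
        nlinarith [mul_nonneg ha.le (sq_nonneg (t - r))]

theorem seg_of_pos (h : 0 < a * segMin a b * segMin a b - 2 * b * segMin a b + c) :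
    segLo a b c = 2 ∧ segHi a b c = -1 := by
  simp [segLo, segHi, segEmpty, posInd_of_pos h]

theorem seg_of_nonpos (h : a * segMin a b * segMin a b - 2 * b * segMin a b + c ≤ 0) :
    segLo a b c = posInd c * ((b - √(b * b - a * c)) / a) ∧
      segHi a b c = 1 - posInd (a - 2 * b + c) * (1 - (b + √(b * b - a * c)) / a) := by
  simp [segLo, segHi, segEmpty, posInd_of_nonpos h]

/-- Completing the square gives the solutions between (b - r) / a and (b + r) / a. The lower end
becomes 0 exactly if 0 is a solution, that is `c ≤ 0`, and the upper end becomes 1 exactly if 1 is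
one, that is `a - 2 b + c ≤ 0`. For a degenerate segment, `a = 0`, both happen, and the quotients by
zero are multiplied by zero. -/
theorem seg_iff_of_nonpos (ha : 0 ≤ a) (hb : a = 0 → b = 0)
    (h : a * segMin a b * segMin a b - 2 * b * segMin a b + c ≤ 0) :
    0 ≤ segLo a b c ∧ segHi a b c ≤ 1 ∧ ∀ t, 0 ≤ t → t ≤ 1 →
      (a * t ^ 2 - 2 * b * t + c ≤ 0 ↔ segLo a b c ≤ t ∧ t ≤ segHi a b c) := by
  obtain ⟨e1, e2⟩ := seg_of_nonpos h
  rcases ha.eq_or_lt with rfl | ha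
  · have hb' := hb rfl
    subst hb'
    have hc : c ≤ 0 := by simpa using h
    rw [e1, e2, posInd_of_nonpos hc, posInd_of_nonpos (by simpa using hc)]
    refine ⟨by simp, by simp, fun t h0 h1 => ?_⟩
    simp [hc, h0, h1]
  · obtain ⟨m0, m1⟩ := segMin_mem a b
    set m := segMin a b
    have key : ∀ t, (a * t - b) ^ 2 - (b * b - a * c) = a * (a * t ^ 2 - 2 * b * t + c) := by
      intro t; ring
    have hd : 0 ≤ b * b - a * c := by
      have h2 : a * (a * m ^ 2 - 2 * b * m + c) ≤ 0 :=
        mul_nonpos_of_nonneg_of_nonpos ha.le (by linarith [h])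
      nlinarith [key m, sq_nonneg (a * m - b)]
    set r := √(b * b - a * c) with hr
    have hr0 : 0 ≤ r := Real.sqrt_nonneg _
    have hr2 : r ^ 2 = b * b - a * c := Real.sq_sqrt hd
    have hiff : ∀ t, a * t ^ 2 - 2 * b * t + c ≤ 0 ↔ (b - r) / a ≤ t ∧ t ≤ (b + r) / a := by
      intro t
      rw [div_le_iff₀ ha, le_div_iff₀ ha]
      have : a * t ^ 2 - 2 * b * t + c ≤ 0 ↔ (a * t - b) ^ 2 ≤ r ^ 2 := by
        rw [hr2, ← sub_nonpos (a := (a * t - b) ^ 2), key]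
        exact ⟨fun hh => mul_nonpos_of_nonneg_of_nonpos ha.le hh,
          fun hh => nonpos_of_mul_nonpos_right hh ha⟩
      rw [this, sq_le_sq, abs_of_nonneg hr0, abs_le]
      constructor <;> rintro ⟨h1, h2⟩ <;> constructor <;> linarith
    obtain ⟨n1, n2⟩ := (hiff m).1 (by linarith [h])
    have hlo : 0 ≤ segLo a b c ∧ ∀ t, 0 ≤ t → (segLo a b c ≤ t ↔ (b - r) / a ≤ t) := by
      rw [e1]
      rcases le_or_gt c 0 with hc | hc
      · have h0 := ((hiff 0).1 (by simpa using hc)).1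
        rw [posInd_of_nonpos hc, zero_mul]
        exact ⟨le_rfl, fun t ht => ⟨fun _ => h0.trans ht, fun _ => ht⟩⟩
      · rw [posInd_of_pos hc, one_mul]
        refine ⟨?_, fun t _ => Iff.rfl⟩
        -- A negative smaller root would put 0 between the roots, as the larger root is at least `m
        -- ≥ 0`; but 0 is no solution when `c > 0`.
        by_contra hneg
        have := (hiff 0).2 ⟨(not_le.1 hneg).le, m0.trans n2⟩
        simp at this
        linarith
    have hhi : segHi a b c ≤ 1 ∧ ∀ t, t ≤ 1 → (t ≤ segHi a b c ↔ t ≤ (b + r) / a) := by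
      rw [e2]
      rcases le_or_gt (a - 2 * b + c) 0 with hc | hc
      · have h0 := ((hiff 1).1 (by linarith)).2
        rw [posInd_of_nonpos hc, zero_mul, sub_zero]
        exact ⟨le_rfl, fun t ht => ⟨fun _ => ht.trans h0, fun _ => ht⟩⟩
      · rw [posInd_of_pos hc, one_mul, sub_sub_cancel]
        refine ⟨?_, fun t _ => Iff.rfl⟩
        by_contra hneg
        have := (hiff 1).2 ⟨n1.trans m1, (not_le.1 hneg).le⟩
        linarith
    exact ⟨hlo.1, hhi.1, fun t h0 h1 => by rw [hiff, hlo.2 t h0, hhi.2 t h1]⟩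

theorem seg_iff (ha : 0 ≤ a) (hb : a = 0 → b = 0) {t : ℝ} (h0 : 0 ≤ t) (h1 : t ≤ 1) :
    a * t ^ 2 - 2 * b * t + c ≤ 0 ↔ segLo a b c ≤ t ∧ t ≤ segHi a b c := by
  rcases le_or_gt (a * segMin a b * segMin a b - 2 * b * segMin a b + c) 0 with h | h
  · exact (seg_iff_of_nonpos ha hb h).2.2 t h0 h1
  · rw [(seg_of_pos h).1, (seg_of_pos h).2]
    constructor
    · intro h2; linarith [segMin_le (c := c) ha hb h0 h1]
    · rintro ⟨h2, h3⟩; linarith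

theorem seg_cases (ha : 0 ≤ a) (hb : a = 0 → b = 0) :
    (0 ≤ segLo a b c ∧ segLo a b c ≤ segHi a b c ∧ segHi a b c ≤ 1) ∨
      (segLo a b c = 2 ∧ segHi a b c = -1) := by
  rcases le_or_gt (a * segMin a b * segMin a b - 2 * b * segMin a b + c) 0 with h | h
  · left
    obtain ⟨h1, h2, h3⟩ := seg_iff_of_nonpos ha hb h
    obtain ⟨m0, m1⟩ := segMin_mem a b
    obtain ⟨h4, h5⟩ := (h3 _ m0 m1).1 (by linarith [h])
    exact ⟨h1, h4.trans h5, h2⟩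
  · exact .inr (seg_of_pos h)

end Quadratic

/-! ### Polygonal chains and their free space -/

section Chain

variable {E : Type*} [NormedAddCommGroup E] [InnerProductSpace ℝ E]

/-- The lower end of the free interval on the segment from `y` to `z` with respect to `x`. -/
noncomputable def freeLo (ε : ℝ) (x y z : E) : ℝ :=
  segLo (‖z - y‖ ^ 2) (inner ℝ (x - y) (z - y)) (‖x - y‖ ^ 2 - ε ^ 2)

/-- The upper end of the free interval on the segment from `y` to `z` with respect to `x`. -/
noncomputable def freeHi (ε : ℝ) (x y z : E) : ℝ :=
  segHi (‖z - y‖ ^ 2) (inner ℝ (x - y) (z - y)) (‖x - y‖ ^ 2 - ε ^ 2)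

theorem free_aux (w d : E) : ‖d‖ ^ 2 = 0 → (inner ℝ w d : ℝ) = 0 := by
  intro h
  have : d = 0 := by simpa using h
  simp [this]

/-- The squared distance from a fixed point to a point moving along a segment is a quadratic
polynomial in the parameter; `0 ≤ ε` permits squaring the inequality. -/
theorem free_iff {ε : ℝ} (hε : 0 ≤ ε) (x y z : E) {t : ℝ} (h0 : 0 ≤ t) (h1 : t ≤ 1) :
    dist x ((1 - t) • y + t • z) ≤ ε ↔ freeLo ε x y z ≤ t ∧ t ≤ freeHi ε x y z := by
  rw [freeLo, freeHi, ← seg_iff (by positivity) (free_aux _ _) h0 h1, dist_eq_norm]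
  have e : x - ((1 - t) • y + t • z) = (x - y) - t • (z - y) := by module
  rw [e, ← abs_of_nonneg hε, ← abs_norm, ← sq_le_sq, norm_sub_sq_real, norm_smul, inner_smul_right,
    mul_pow, Real.norm_eq_abs, sq_abs, ← sub_nonpos, sq_abs]
  have : ‖x - y‖ ^ 2 - 2 * (t * inner ℝ (x - y) (z - y)) + t ^ 2 * ‖z - y‖ ^ 2 - ε ^ 2 =
    ‖z - y‖ ^ 2 * t ^ 2 - 2 * inner ℝ (x - y) (z - y) * t + (‖x - y‖ ^ 2 - ε ^ 2) := by ring
  rw [this]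

theorem free_cases (ε : ℝ) (x y z : E) :
    (0 ≤ freeLo ε x y z ∧ freeLo ε x y z ≤ freeHi ε x y z ∧ freeHi ε x y z ≤ 1) ∨
      (freeLo ε x y z = 2 ∧ freeHi ε x y z = -1) :=
  seg_cases (by positivity) (free_aux _ _)

/-- The polygonal chain with the vertices `p 0, p 1, …`, used for `0 ≤ t`. -/
noncomputable def chain (p : ℕ → E) (t : ℝ) : E :=
  (1 - Int.fract t) • p ⌊t⌋₊ + Int.fract t • p (⌊t⌋₊ + 1)

theorem chain_add (p : ℕ → E) (i : ℕ) {t : ℝ} (h0 : 0 ≤ t) (h1 : t ≤ 1) :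
    chain p (i + t) = (1 - t) • p i + t • p (i + 1) := by
  rcases h1.lt_or_eq with h | rfl
  · have hf : Int.fract ((i : ℝ) + t) = t := by
      rw [Int.fract_natCast_add]; exact Int.fract_eq_self.2 ⟨h0, h⟩
    have hn : ⌊(i : ℝ) + t⌋₊ = i := by
      rw [add_comm, Nat.floor_add_natCast h0, Nat.floor_eq_zero.2 h, zero_add]
    simp [chain, hf, hn]
  · have hn : ⌊(i : ℝ) + 1⌋₊ = i + 1 := by exact_mod_cast Nat.floor_natCast (R := ℝ) (i + 1)
    simp [chain, hn]

theorem chain_of_mem (p : ℕ → E) {i : ℕ} {t : ℝ} (h0 : (i : ℝ) ≤ t) (h1 : t ≤ i + 1) :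
    chain p t = (1 - (t - i)) • p i + (t - i) • p (i + 1) := by
  rw [← chain_add p i (by linarith) (by linarith)]; congr 1; ring

theorem chain_natCast (p : ℕ → E) (i : ℕ) : chain p i = p i := by
  rw [chain_of_mem p le_rfl (by linarith)]; simp

theorem exists_cell {t : ℝ} (h : 0 ≤ t) : ∃ i : ℕ, (i : ℝ) ≤ t ∧ t ≤ i + 1 :=
  ⟨⌊t⌋₊, Nat.floor_le h, (Nat.lt_floor_add_one t).le⟩

/-- The free space of two polygonal chains. -/
def Free (p q : ℕ → E) (ε u v : ℝ) : Prop := dist (chain p u) (chain q v) ≤ ε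

/-- The free intervals of two polygonal chains. -/
noncomputable def chainGrid (p q : ℕ → E) (ε : ℝ) (SL SB : ℕ) : Grid where
  VL i j := j + freeLo ε (p i) (q j) (q (j + 1))
  VH i j := j + freeHi ε (p i) (q j) (q (j + 1))
  HL i j := i + freeLo ε (q j) (p i) (p (i + 1))
  HR i j := i + freeHi ε (q j) (p i) (p (i + 1))
  SL := SL
  SB := SB
  hV i j := by
    rcases free_cases ε (p i) (q j) (q (j + 1)) with ⟨h1, h2, h3⟩ | ⟨h1, h2⟩
    · left; refine ⟨?_, ?_, ?_⟩ <;> linarith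
    · right; rw [h1, h2]; exact ⟨rfl, rfl⟩
  hH i j := by
    rcases free_cases ε (q j) (p i) (p (i + 1)) with ⟨h1, h2, h3⟩ | ⟨h1, h2⟩
    · left; refine ⟨?_, ?_, ?_⟩ <;> linarith
    · right; rw [h1, h2]; exact ⟨rfl, rfl⟩

variable {p q : ℕ → E} {ε : ℝ} {SL SB i j : ℕ}

theorem free_vert_iff (hε : 0 ≤ ε) {v : ℝ} (h0 : (j : ℝ) ≤ v) (h1 : v ≤ j + 1) :
    Free p q ε i v ↔ (chainGrid p q ε SL SB).VL i j ≤ v ∧ v ≤ (chainGrid p q ε SL SB).VH i j := by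
  rw [Free, chain_natCast, chain_of_mem q h0 h1, free_iff hε _ _ _ (by linarith) (by linarith)]
  simp only [chainGrid]
  constructor <;> rintro ⟨h2, h3⟩ <;> constructor <;> linarith

theorem free_horiz_iff (hε : 0 ≤ ε) {u : ℝ} (h0 : (i : ℝ) ≤ u) (h1 : u ≤ i + 1) :
    Free p q ε u j ↔ (chainGrid p q ε SL SB).HL i j ≤ u ∧ u ≤ (chainGrid p q ε SL SB).HR i j := by
  rw [Free, chain_natCast, chain_of_mem p h0 h1, dist_comm,
    free_iff hε _ _ _ (by linarith) (by linarith)]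
  simp only [chainGrid]
  constructor <;> rintro ⟨h2, h3⟩ <;> constructor <;> linarith

theorem Grid.vert_mem (G : Grid) {i j : ℕ} {v : ℝ} (h0 : G.VL i j ≤ v) (h1 : v ≤ G.VH i j) :
    (j : ℝ) ≤ v ∧ v ≤ j + 1 := by
  rcases G.hV i j with h | h <;> constructor <;> linarith [h.1, h.2]

theorem Grid.horiz_mem (G : Grid) {i j : ℕ} {u : ℝ} (h0 : G.HL i j ≤ u) (h1 : u ≤ G.HR i j) :
    (i : ℝ) ≤ u ∧ u ≤ i + 1 := by
  rcases G.hH i j with h | h <;> constructor <;> linarith [h.1, h.2]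

theorem chain_convex (p : ℕ → E) {u₀ u₁ θ : ℝ} (h0 : (i : ℝ) ≤ u₀) (h1 : u₀ ≤ i + 1)
    (h2 : (i : ℝ) ≤ u₁) (h3 : u₁ ≤ i + 1) (hθ0 : 0 ≤ θ) (hθ1 : θ ≤ 1) :
    chain p (u₀ + θ * (u₁ - u₀)) = (1 - θ) • chain p u₀ + θ • chain p u₁ := by
  rw [chain_of_mem p h0 h1, chain_of_mem p h2 h3,
    chain_of_mem p (i := i) (by nlinarith) (by nlinarith)]
  module

/-- The free space is convex in every cell. -/
theorem Free.convex {u₀ u₁ v₀ v₁ θ : ℝ} (hu0 : (i : ℝ) ≤ u₀) (hu : u₀ ≤ u₁)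
    (hu1 : u₁ ≤ i + 1) (hv0 : (j : ℝ) ≤ v₀) (hv : v₀ ≤ v₁) (hv1 : v₁ ≤ j + 1)
    (h0 : Free p q ε u₀ v₀) (h1 : Free p q ε u₁ v₁) (hθ0 : 0 ≤ θ) (hθ1 : θ ≤ 1) :
    Free p q ε (u₀ + θ * (u₁ - u₀)) (v₀ + θ * (v₁ - v₀)) := by
  rw [Free, chain_convex p hu0 (hu.trans hu1) (hu0.trans hu) hu1 hθ0 hθ1,
    chain_convex q hv0 (hv.trans hv1) (hv0.trans hv) hv1 hθ0 hθ1, dist_eq_norm]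
  have e : (1 - θ) • chain p u₀ + θ • chain p u₁ - ((1 - θ) • chain q v₀ + θ • chain q v₁) =
      (1 - θ) • (chain p u₀ - chain q v₀) + θ • (chain p u₁ - chain q v₁) := by module
  rw [Free, dist_eq_norm] at h0 h1
  rw [e]
  refine (norm_add_le _ _).trans ?_
  rw [norm_smul, norm_smul, Real.norm_of_nonneg hθ0, Real.norm_of_nonneg (by linarith)]
  nlinarith

end Chain

section

open Set

/-! ### Monotone paths -/

/-- There is a monotone path from `(x₀, y₀)` to `(x₁, y₁)` in `D`. The parameter of the path is the
sum of the coordinates. -/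
def MonoPath (D : ℝ → ℝ → Prop) (x₀ y₀ x₁ y₁ : ℝ) : Prop :=
  x₀ ≤ x₁ ∧ y₀ ≤ y₁ ∧ ∃ U : ℝ → ℝ, MonotoneOn U (Icc (x₀ + y₀) (x₁ + y₁)) ∧
    MonotoneOn (fun s => s - U s) (Icc (x₀ + y₀) (x₁ + y₁)) ∧ U (x₀ + y₀) = x₀ ∧
    U (x₁ + y₁) = x₁ ∧ ∀ s ∈ Icc (x₀ + y₀) (x₁ + y₁), D (U s) (s - U s)

/-- A function such that it and its difference to the identity are monotone is continuous. -/
theorem continuousOn_of_monotoneOn_sub {U : ℝ → ℝ} {S : Set ℝ} (h1 : MonotoneOn U S)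
    (h2 : MonotoneOn (fun s => s - U s) S) : ContinuousOn U S := by
  refine LipschitzOnWith.continuousOn (K := 1) (LipschitzOnWith.of_dist_le_mul fun s hs t ht => ?_)
  rw [NNReal.coe_one, one_mul, Real.dist_eq, Real.dist_eq]
  rcases le_total s t with h | h
  · have a1 := h1 hs ht h
    have a2 := h2 hs ht h
    simp only at a2
    rw [abs_of_nonpos (by linarith), abs_of_nonpos (by linarith)]; linarith
  · have a1 := h1 ht hs h
    have a2 := h2 ht hs h
    simp only at a2
    rw [abs_of_nonneg (by linarith), abs_of_nonneg (by linarith)]; linarith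

namespace MonoPath

variable {D D' : ℝ → ℝ → Prop} {x₀ y₀ x₁ y₁ x₂ y₂ : ℝ}

theorem of_segment (hx : x₀ ≤ x₁) (hy : y₀ ≤ y₁)
    (h : ∀ θ, 0 ≤ θ → θ ≤ 1 → D (x₀ + θ * (x₁ - x₀)) (y₀ + θ * (y₁ - y₀))) :
    MonoPath D x₀ y₀ x₁ y₁ := by
  rcases (add_le_add hx hy).eq_or_lt with he | hlt
  · have e1 : x₁ = x₀ := by linarith
    have e2 : y₁ = y₀ := by linarith
    subst e1 e2
    refine ⟨le_rfl, le_rfl, fun _ => x₁, monotoneOn_const, ?_, rfl, rfl, ?_⟩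
    · intro s _ t _ hst; simpa using hst
    · rintro s ⟨h1, h2⟩
      obtain rfl : s = x₁ + y₁ := le_antisymm h2 h1
      simpa using h 0 le_rfl zero_le_one
  · have hL : 0 < x₁ + y₁ - (x₀ + y₀) := by linarith
    set L := x₁ + y₁ - (x₀ + y₀) with hLdef
    have hV : ∀ s, s - (x₀ + (s - (x₀ + y₀)) / L * (x₁ - x₀)) =
        y₀ + (s - (x₀ + y₀)) / L * (y₁ - y₀) := by
      intro s
      have : (s - (x₀ + y₀)) / L * L = s - (x₀ + y₀) := div_mul_cancel₀ _ hL.ne'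
      linear_combination (s - (x₀ + y₀)) / L * hLdef - this
    refine ⟨hx, hy, fun s => x₀ + (s - (x₀ + y₀)) / L * (x₁ - x₀), ?_, ?_, ?_, ?_, ?_⟩
    · intro s _ t _ hst
      have := sub_nonneg.2 hx
      simp only
      gcongr
    · intro s _ t _ hst
      have := sub_nonneg.2 hy
      simp only [hV]
      gcongr
    · simp
    · simp only; rw [← hLdef, div_self hL.ne']; ring
    · rintro s ⟨h1, h2⟩
      simp only [hV]
      exact h _ (div_nonneg (by linarith) hL.le) ((div_le_one hL).2 (by linarith))

theorem trans (h : MonoPath D x₀ y₀ x₁ y₁) (h' : MonoPath D x₁ y₁ x₂ y₂) :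
    MonoPath D x₀ y₀ x₂ y₂ := by
  obtain ⟨hx, hy, U, h1, h2, h3, h4, h5⟩ := h
  obtain ⟨hx', hy', U', h1', h2', h3', h4', h5'⟩ := h'
  have hs : x₀ + y₀ ≤ x₁ + y₁ := add_le_add hx hy
  have hs' : x₁ + y₁ ≤ x₂ + y₂ := add_le_add hx' hy'
  set W : ℝ → ℝ := fun s => if s ≤ x₁ + y₁ then U s else U' s with hW
  have eL : EqOn W U (Icc (x₀ + y₀) (x₁ + y₁)) := fun s hs => if_pos hs.2
  have eR : EqOn W U' (Icc (x₁ + y₁) (x₂ + y₂)) := by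
    intro s hs
    rcases hs.1.eq_or_lt with rfl | hlt
    · simp [hW, h4, h3']
    · exact if_neg (not_le.2 hlt)
  have hun : Icc (x₀ + y₀) (x₁ + y₁) ∪ Icc (x₁ + y₁) (x₂ + y₂) = Icc (x₀ + y₀) (x₂ + y₂) :=
    Icc_union_Icc_eq_Icc hs hs'
  have g1 := isGreatest_Icc hs
  have g2 := isLeast_Icc hs'
  refine ⟨hx.trans hx', hy.trans hy', W, ?_, ?_, ?_, ?_, ?_⟩
  · rw [← hun]
    exact (h1.congr eL.symm).union_right (h1'.congr eR.symm) g1 g2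
  · rw [← hun]
    exact (h2.congr fun s hs => by simp only [eL hs]).union_right
      (h2'.congr fun s hs => by simp only [eR hs]) g1 g2
  · rw [eL ⟨le_rfl, hs⟩, h3]
  · rw [eR ⟨hs', le_rfl⟩, h4']
  · intro s hs
    rw [← hun] at hs
    rcases hs with hs | hs
    · rw [eL hs]; exact h5 s hs
    · rw [eR hs]; exact h5' s hs

/-- The coordinates of the points of a monotone path. -/
theorem box {U : ℝ → ℝ} (hx : x₀ ≤ x₁) (hy : y₀ ≤ y₁)
    (h1 : MonotoneOn U (Icc (x₀ + y₀) (x₁ + y₁)))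
    (h2 : MonotoneOn (fun s => s - U s) (Icc (x₀ + y₀) (x₁ + y₁))) (h3 : U (x₀ + y₀) = x₀)
    (h4 : U (x₁ + y₁) = x₁) {s : ℝ} (hs : s ∈ Icc (x₀ + y₀) (x₁ + y₁)) :
    (x₀ ≤ U s ∧ U s ≤ x₁) ∧ y₀ ≤ s - U s ∧ s - U s ≤ y₁ := by
  have hss : x₀ + y₀ ≤ x₁ + y₁ := add_le_add hx hy
  have a1 := h1 ⟨le_rfl, hss⟩ hs hs.1
  have a2 := h1 hs ⟨hss, le_rfl⟩ hs.2
  have a3 := h2 ⟨le_rfl, hss⟩ hs hs.1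
  have a4 := h2 hs ⟨hss, le_rfl⟩ hs.2
  simp only [h3, h4] at a1 a2 a3 a4
  exact ⟨⟨a1, a2⟩, by linarith, by linarith⟩

/-- The image of a monotone path under a translation. -/
theorem translate (h : MonoPath D x₀ y₀ x₁ y₁) (c d : ℝ)
    (hD : ∀ u v, x₀ ≤ u → u ≤ x₁ → y₀ ≤ v → v ≤ y₁ → D u v → D' (u + c) (v + d)) :
    MonoPath D' (x₀ + c) (y₀ + d) (x₁ + c) (y₁ + d) := by
  obtain ⟨hx, hy, U, h1, h2, h3, h4, h5⟩ := h
  have hmem : ∀ s ∈ Icc (x₀ + c + (y₀ + d)) (x₁ + c + (y₁ + d)),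
      s - (c + d) ∈ Icc (x₀ + y₀) (x₁ + y₁) := fun s hs => ⟨by linarith [hs.1], by linarith [hs.2]⟩
  refine ⟨by linarith, by linarith, fun s => U (s - (c + d)) + c, ?_, ?_, ?_, ?_, ?_⟩
  · intro s hs t ht hst
    have := h1 (hmem s hs) (hmem t ht) (by linarith)
    simpa using this
  · intro s hs t ht hst
    have := h2 (hmem s hs) (hmem t ht) (by linarith)
    simp only at this ⊢
    linarith
  · simp only; rw [show x₀ + c + (y₀ + d) - (c + d) = x₀ + y₀ by ring, h3]
  · simp only; rw [show x₁ + c + (y₁ + d) - (c + d) = x₁ + y₁ by ring, h4]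
  · intro s hs
    have hb := box hx hy h1 h2 h3 h4 (hmem s hs)
    have := hD _ _ hb.1.1 hb.1.2 hb.2.1 hb.2.2 (h5 _ (hmem s hs))
    convert this using 1
    ring

/-- The image of a monotone path under a point reflection. -/
theorem reflect (h : MonoPath D x₀ y₀ x₁ y₁) (c d : ℝ)
    (hD : ∀ u v, x₀ ≤ u → u ≤ x₁ → y₀ ≤ v → v ≤ y₁ → D u v → D' (c - u) (d - v)) :
    MonoPath D' (c - x₁) (d - y₁) (c - x₀) (d - y₀) := by
  obtain ⟨hx, hy, U, h1, h2, h3, h4, h5⟩ := h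
  have hmem : ∀ s ∈ Icc (c - x₁ + (d - y₁)) (c - x₀ + (d - y₀)),
      c + d - s ∈ Icc (x₀ + y₀) (x₁ + y₁) := fun s hs => ⟨by linarith [hs.2], by linarith [hs.1]⟩
  refine ⟨by linarith, by linarith, fun s => c - U (c + d - s), ?_, ?_, ?_, ?_, ?_⟩
  · intro s hs t ht hst
    have := h1 (hmem t ht) (hmem s hs) (by linarith)
    simp only; linarith
  · intro s hs t ht hst
    have := h2 (hmem t ht) (hmem s hs) (by linarith)
    simp only at this ⊢
    linarith
  · simp only; rw [show c + d - (c - x₁ + (d - y₁)) = x₁ + y₁ by ring, h4]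
  · simp only; rw [show c + d - (c - x₀ + (d - y₀)) = x₀ + y₀ by ring, h3]
  · intro s hs
    have hb := box hx hy h1 h2 h3 h4 (hmem s hs)
    have := hD _ _ hb.1.1 hb.1.2 hb.2.1 hb.2.2 (h5 _ (hmem s hs))
    convert this using 1
    ring

/-- The image of a monotone path under the exchange of the coordinates. -/
theorem swap (h : MonoPath D x₀ y₀ x₁ y₁) (hD : ∀ u v, D u v → D' v u) :
    MonoPath D' y₀ x₀ y₁ x₁ := by
  obtain ⟨hx, hy, U, h1, h2, h3, h4, h5⟩ := h
  rw [add_comm x₀, add_comm x₁] at h1 h2 h5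
  rw [add_comm] at h3 h4
  refine ⟨hy, hx, fun s => s - U s, h2, ?_, by simp only; linarith, by simp only; linarith, ?_⟩
  · simpa only [sub_sub_cancel] using h1
  · intro s hs
    simpa only [sub_sub_cancel] using hD _ _ (h5 s hs)

theorem split {U : ℝ → ℝ} (hx : x₀ ≤ x₁) (hy : y₀ ≤ y₁)
    (h1 : MonotoneOn U (Icc (x₀ + y₀) (x₁ + y₁)))
    (h2 : MonotoneOn (fun s => s - U s) (Icc (x₀ + y₀) (x₁ + y₁))) (h3 : U (x₀ + y₀) = x₀)
    (h4 : U (x₁ + y₁) = x₁) (h5 : ∀ s ∈ Icc (x₀ + y₀) (x₁ + y₁), D (U s) (s - U s))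
    {s : ℝ} (hs : s ∈ Icc (x₀ + y₀) (x₁ + y₁)) :
    MonoPath D x₀ y₀ (U s) (s - U s) ∧ MonoPath D (U s) (s - U s) x₁ y₁ := by
  have hb := box hx hy h1 h2 h3 h4 hs
  have e : U s + (s - U s) = s := by ring
  have s1 : Icc (x₀ + y₀) s ⊆ Icc (x₀ + y₀) (x₁ + y₁) := Icc_subset_Icc le_rfl hs.2
  have s2 : Icc s (x₁ + y₁) ⊆ Icc (x₀ + y₀) (x₁ + y₁) := Icc_subset_Icc hs.1 le_rfl
  constructor
  · refine ⟨hb.1.1, hb.2.1, U, ?_, ?_, h3, ?_, ?_⟩ <;> rw [e]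
    · exact h1.mono s1
    · exact h2.mono s1
    · exact fun t ht => h5 t (s1 ht)
  · refine ⟨hb.1.2, hb.2.2, U, ?_, ?_, ?_, h4, ?_⟩ <;> rw [e]
    · exact h1.mono s2
    · exact h2.mono s2
    · exact fun t ht => h5 t (s2 ht)

/-- Two monotone paths across a strip of which one starts lower and ends higher than the other
have a common point. -/
theorem cross {a a' b b' : ℝ} (h : MonoPath D x₀ a' x₁ b) (h' : MonoPath D x₀ a x₁ b')
    (ha : a' ≤ a) (hb : b' ≤ b) : MonoPath D x₀ a x₁ b := by
  obtain ⟨hx, hy, U, h1, h2, h3, h4, h5⟩ := h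
  obtain ⟨hx', hy', U', h1', h2', h3', h4', h5'⟩ := h'
  have hsub : Icc (x₀ + a) (x₁ + b') ⊆ Icc (x₀ + a') (x₁ + b) :=
    Icc_subset_Icc (by linarith) (by linarith)
  have hle : x₀ + a ≤ x₁ + b' := add_le_add hx hy'
  -- At equal parameters both paths are on the same antidiagonal, so equal abscissas mean equal
  -- points. Where the second path starts, its abscissa `x₀` is the smallest possible, and where it
  -- ends, `x₁` is the largest; hence the difference of the abscissas has a zero in between.
  have hc : ContinuousOn (fun s => U' s - U s) (Icc (x₀ + a) (x₁ + b')) :=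
    (continuousOn_of_monotoneOn_sub h1' h2').sub
      ((continuousOn_of_monotoneOn_sub h1 h2).mono hsub)
  have b1 := box hx hy h1 h2 h3 h4 (hsub ⟨le_rfl, hle⟩)
  have b2 := box hx hy h1 h2 h3 h4 (hsub ⟨hle, le_rfl⟩)
  obtain ⟨s, hs, hs0⟩ := intermediate_value_Icc hle hc
    (show (0 : ℝ) ∈ Icc _ _ from ⟨by simp only [h3']; linarith [b1.1.1],
      by simp only [h4']; linarith [b2.1.2]⟩)
  have e : U' s = U s := by simp only at hs0; linarith
  have p1 := (split hx' hy' h1' h2' h3' h4' h5' hs).1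
  have p2 := (split hx hy h1 h2 h3 h4 h5 (hsub hs)).2
  rw [e] at p1
  exact p1.trans p2

/-- A monotone path given by any continuous parametrization. -/
theorem of_curve {x y : ℝ → ℝ} {a b : ℝ} (hab : a ≤ b) (cx : ContinuousOn x (Icc a b))
    (cy : ContinuousOn y (Icc a b)) (mx : MonotoneOn x (Icc a b)) (my : MonotoneOn y (Icc a b))
    (hD : ∀ t ∈ Icc a b, D (x t) (y t)) : MonoPath D (x a) (y a) (x b) (y b) := by
  have ma : a ∈ Icc a b := ⟨le_rfl, hab⟩
  have mb : b ∈ Icc a b := ⟨hab, le_rfl⟩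
  have hex : ∀ s ∈ Icc (x a + y a) (x b + y b), ∃ t ∈ Icc a b, x t + y t = s :=
    intermediate_value_Icc hab (cx.add cy)
  -- Since both coordinates are monotone, the curve meets each antidiagonal in a single point, so
  -- the choice of the parameter `g s` below does not matter.
  have huniq : ∀ t ∈ Icc a b, ∀ t' ∈ Icc a b, x t + y t ≤ x t' + y t' →
      x t ≤ x t' ∧ y t ≤ y t' := by
    intro t ht t' ht' hle
    rcases le_total t t' with h | h
    · exact ⟨mx ht ht' h, my ht ht' h⟩
    · have := mx ht' ht h
      have := my ht' ht h
      constructor <;> linarith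
  choose! g hg using hex
  have hgy : ∀ s ∈ Icc (x a + y a) (x b + y b), s - x (g s) = y (g s) := by
    intro s hs; linarith [(hg s hs).2]
  refine ⟨mx ma mb hab, my ma mb hab, fun s => x (g s), ?_, ?_, ?_, ?_, ?_⟩
  · intro s hs t ht hst
    exact (huniq _ (hg s hs).1 _ (hg t ht).1 (by rw [(hg s hs).2, (hg t ht).2]; exact hst)).1
  · intro s hs t ht hst
    simp only [hgy s hs, hgy t ht]
    exact (huniq _ (hg s hs).1 _ (hg t ht).1 (by rw [(hg s hs).2, (hg t ht).2]; exact hst)).2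
  · have hs : x a + y a ∈ Icc (x a + y a) (x b + y b) :=
      ⟨le_rfl, add_le_add (mx ma mb hab) (my ma mb hab)⟩
    have := hg _ hs
    exact le_antisymm (huniq _ this.1 _ ma this.2.le).1 (huniq _ ma _ this.1 this.2.ge).1
  · have hs : x b + y b ∈ Icc (x a + y a) (x b + y b) :=
      ⟨add_le_add (mx ma mb hab) (my ma mb hab), le_rfl⟩
    have := hg _ hs
    exact le_antisymm (huniq _ this.1 _ mb this.2.le).1 (huniq _ mb _ this.1 this.2.ge).1
  · intro s hs
    simp only [hgy s hs]
    exact hD _ (hg s hs).1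

end MonoPath

/-! ### Monotone paths in the free space of two chains -/

section Chain

variable {E : Type*} [NormedAddCommGroup E] [InnerProductSpace ℝ E]
  {p q : ℕ → E} {ε σ : ℝ} {SL SB i j : ℕ}

theorem MonoPath.of_cell {u₀ u₁ v₀ v₁ : ℝ} (hu0 : (i : ℝ) ≤ u₀) (hu : u₀ ≤ u₁)
    (hu1 : u₁ ≤ i + 1) (hv0 : (j : ℝ) ≤ v₀) (hv : v₀ ≤ v₁) (hv1 : v₁ ≤ j + 1)
    (h0 : Free p q ε u₀ v₀) (h1 : Free p q ε u₁ v₁) : MonoPath (Free p q ε) u₀ v₀ u₁ v₁ :=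
  .of_segment hu hv fun _ a b => Free.convex hu0 hu hu1 hv0 hv hv1 h0 h1 a b

/-- The points where the paths may start. -/
def IsStart (SL SB : ℕ) (x y : ℝ) : Prop :=
  (x = 0 ∧ 0 ≤ y ∧ y ≤ SL ∧ 0 < SL) ∨ (y = 0 ∧ 0 ≤ x ∧ x ≤ SB ∧ 0 < SB)

/-- The abscissa of a point of an edge. -/
def Side.abscissa (i : ℕ) (r : ℝ) : Side → ℝ
  | .vert => i
  | .horiz => r

/-- The ordinate of a point of an edge. -/
def Side.ordinate (j : ℕ) (r : ℝ) : Side → ℝ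
  | .vert => r
  | .horiz => j

theorem Grid.Reach.free (hε : 0 ≤ ε) {d : Side} {r : ℝ}
    (h : (chainGrid p q ε SL SB).Reach σ d i j r) :
    Free p q ε (d.abscissa i r) (d.ordinate j r) ∧
      ((i : ℝ) ≤ d.abscissa i r ∧ d.abscissa i r ≤ i + 1) ∧
      (j : ℝ) ≤ d.ordinate j r ∧ d.ordinate j r ≤ j + 1 := by
  have hv : ∀ {i j : ℕ} {r : ℝ}, (chainGrid p q ε SL SB).VL i j ≤ r →
      r ≤ (chainGrid p q ε SL SB).VH i j → Free p q ε i r ∧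
      ((i : ℝ) ≤ i ∧ (i : ℝ) ≤ i + 1) ∧ (j : ℝ) ≤ r ∧ r ≤ j + 1 := by
    intro i j r h1 h2
    have hm := Grid.vert_mem _ h1 h2
    exact ⟨(free_vert_iff hε hm.1 hm.2).2 ⟨h1, h2⟩, ⟨le_rfl, by linarith⟩, hm⟩
  have hh : ∀ {i j : ℕ} {r : ℝ}, (chainGrid p q ε SL SB).HL i j ≤ r →
      r ≤ (chainGrid p q ε SL SB).HR i j → Free p q ε r j ∧
      ((i : ℝ) ≤ r ∧ r ≤ i + 1) ∧ (j : ℝ) ≤ j ∧ (j : ℝ) ≤ j + 1 := by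
    intro i j r h1 h2
    have hm := Grid.horiz_mem _ h1 h2
    exact ⟨(free_horiz_iff hε hm.1 hm.2).2 ⟨h1, h2⟩, hm, ⟨le_rfl, by linarith⟩⟩
  cases h with
  | left h1 h2 h3 => exact hv h2 h3
  | lower h1 h2 h3 h4 => exact hh (h2.trans h3) h4
  | horiz_vert h h1 h2 => exact hv h1 h2
  | vert_vert h _ h1 h2 => exact hv h1 h2
  | vert_horiz h h1 h2 => exact hh h1 h2
  | horiz_horiz h _ h1 h2 => exact hh h1 h2

/-- Every rule of `Reach` joins two free points of the boundary of one cell, and by convexity the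
segment between them is free; the path is the chain of these segments. -/
theorem Grid.Reach.exists_path (hε : 0 ≤ ε) {d : Side} {r : ℝ}
    (h : (chainGrid p q ε SL SB).Reach σ d i j r) :
    ∃ x y, IsStart SL SB x y ∧ σ ≤ y - x ∧
      MonoPath (Free p q ε) x y (d.abscissa i r) (d.ordinate j r) := by
  have step : ∀ {i j : ℕ} {d₀ : Side} {r₀ u v : ℝ},
      (chainGrid p q ε SL SB).Reach σ d₀ i j r₀ →
      (∃ x y, IsStart SL SB x y ∧ σ ≤ y - x ∧
        MonoPath (Free p q ε) x y (d₀.abscissa i r₀) (d₀.ordinate j r₀)) →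
      Free p q ε u v → d₀.abscissa i r₀ ≤ u → u ≤ i + 1 → d₀.ordinate j r₀ ≤ v → v ≤ j + 1 →
      ∃ x y, IsStart SL SB x y ∧ σ ≤ y - x ∧ MonoPath (Free p q ε) x y u v := by
    rintro i j d₀ r₀ u v hr ⟨x, y, h1, h2, h3⟩ hf hu hu' hv hv'
    have hfr := hr.free hε
    exact ⟨x, y, h1, h2, h3.trans (.of_cell hfr.2.1.1 hu hu' hfr.2.2.1 hv hv' hfr.1 hf)⟩
  induction h with
  | @left j q h1 h2 h3 h4 =>
    have hf := (Grid.Reach.left (σ := σ) h1 h2 h3 h4).free hε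
    have hm := Grid.vert_mem _ h2 h3
    have h1' : ((j : ℕ) : ℝ) + 1 ≤ SL := by exact_mod_cast (show j + 1 ≤ SL from h1)
    refine ⟨0, q, .inl ⟨rfl, j.cast_nonneg.trans hm.1, by linarith, by
      have : j < SL := h1
      omega⟩, by simpa using h4, ?_⟩
    refine .of_cell (i := 0) (by simp) (by simp [Side.abscissa]) (by simp [Side.abscissa]) hm.1
      le_rfl hm.2 (by simpa [Side.abscissa, Side.ordinate] using hf.1) hf.1
  | @lower i x y h1 h2 h3 h4 h5 =>
    have hf := (Grid.Reach.lower (σ := σ) h1 h2 h3 h4 h5).free hε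
    have hf' := (Grid.Reach.lower (σ := σ) h1 h2 le_rfl (h3.trans h4) h5).free hε
    have hm := Grid.horiz_mem _ h2 (h3.trans h4)
    have h1' : ((i : ℕ) : ℝ) + 1 ≤ SB := by exact_mod_cast (show i + 1 ≤ SB from h1)
    refine ⟨y, 0, .inr ⟨rfl, i.cast_nonneg.trans hm.1, by linarith, by
      have : i < SB := h1
      omega⟩, by simpa using h5, ?_⟩
    refine .of_cell hm.1 h3 hf.2.1.2 (j := 0) (by simp) (by simp [Side.ordinate])
      (by simp [Side.ordinate]) (by simpa [Side.abscissa, Side.ordinate] using hf'.1) hf.1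
  | horiz_vert h h1 h2 ih =>
    have hf := (Grid.Reach.horiz_vert h h1 h2).free hε
    have hf0 := h.free hε
    exact step h ih hf.1 (by simpa [Side.abscissa] using hf0.2.1.2)
      (by simp [Side.abscissa]) hf.2.2.1 hf.2.2.2
  | vert_vert h h0 h1 h2 ih =>
    have hf := (Grid.Reach.vert_vert h h0 h1 h2).free hε
    exact step h ih hf.1 (by simp [Side.abscissa])
      (by simp [Side.abscissa]) h0 hf.2.2.2
  | vert_horiz h h1 h2 ih =>
    have hf := (Grid.Reach.vert_horiz h h1 h2).free hε
    have hf0 := h.free hε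
    exact step h ih hf.1 hf.2.1.1 hf.2.1.2
      (by simpa [Side.ordinate] using hf0.2.2.2) (by simp [Side.ordinate])
  | horiz_horiz h h0 h1 h2 ih =>
    have hf := (Grid.Reach.horiz_horiz h h0 h1 h2).free hε
    exact step h ih hf.1 h0 hf.2.1.2
      (by simp [Side.ordinate]) (by simp [Side.ordinate])

/-- A point of a monotone path in the cell `(i, j)` is reached from the left or the lower edge of
this cell. -/
theorem MonoPath.enter (hε : 0 ≤ ε) {x₀ y₀ x₁ y₁ : ℝ} (hst : IsStart SL SB x₀ y₀)
    (hσ : σ ≤ y₀ - x₀) {U : ℝ → ℝ} (hx : x₀ ≤ x₁) (hy : y₀ ≤ y₁)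
    (h1 : MonotoneOn U (Icc (x₀ + y₀) (x₁ + y₁)))
    (h2 : MonotoneOn (fun s => s - U s) (Icc (x₀ + y₀) (x₁ + y₁))) (h3 : U (x₀ + y₀) = x₀)
    (h4 : U (x₁ + y₁) = x₁) (h5 : ∀ s ∈ Icc (x₀ + y₀) (x₁ + y₁), Free p q ε (U s) (s - U s))
    {s : ℝ} (hs : s ∈ Icc (x₀ + y₀) (x₁ + y₁)) (hi0 : (i : ℝ) ≤ U s) (hi1 : U s ≤ i + 1)
    (hj0 : (j : ℝ) ≤ s - U s) (hj1 : s - U s ≤ j + 1) :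
    (∃ r ≤ s - U s, (chainGrid p q ε SL SB).Reach σ .vert i j r) ∨
      ∃ r ≤ U s, (chainGrid p q ε SL SB).Reach σ .horiz i j r := by
  -- The path enters the cell through its left or its lower edge. The point of entry also belongs to
  -- the cell on the other side of this edge, for which `i + j` is smaller.
  induction hn : i + j using Nat.strong_induction_on generalizing i j s with
  | _ n ih =>
  have hss : x₀ + y₀ ≤ x₁ + y₁ := add_le_add hx hy
  have hc := continuousOn_of_monotoneOn_sub h1 h2
  have hsub : Icc (x₀ + y₀) s ⊆ Icc (x₀ + y₀) (x₁ + y₁) := Icc_subset_Icc le_rfl hs.2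
  have hb := box hx hy h1 h2 h3 h4 hs
  have hsmem : x₀ + y₀ ∈ Icc (x₀ + y₀) (x₁ + y₁) := ⟨le_rfl, hss⟩
  have hstart : Free p q ε x₀ y₀ := by
    have := h5 _ hsmem
    rw [h3] at this
    simpa using this
  have goLeft : ∀ s' ∈ Icc (x₀ + y₀) s, U s' = i → (j : ℝ) ≤ s' - U s' → 1 ≤ i →
      ∃ r ≤ s - U s, (chainGrid p q ε SL SB).Reach σ .vert i j r := by
    intro s' hs' e hj hi
    have hle := h2 (hsub hs') hs hs'.2
    simp only at hle
    obtain ⟨i, rfl⟩ : ∃ i', i = i' + 1 := ⟨i - 1, by omega⟩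
    push_cast at e hi0 hi1
    have hfr := h5 s' (hsub hs')
    have hij := (free_vert_iff (SL := SL) (SB := SB) (i := i + 1) hε hj (by linarith)).1
      (by push_cast; rw [e] at hfr; rwa [e])
    refine ⟨s' - U s', hle, Grid.reach_vert_succ.2 ⟨hij.1, hij.2, ?_⟩⟩
    rcases ih (i + j) (by omega) (hsub hs') (by linarith) (by linarith) hj (by linarith) rfl with
      ⟨r, hr, hr'⟩ | ⟨r, -, hr'⟩
    · exact .inr ⟨r, hr, hr'⟩
    · exact .inl ⟨r, hr'⟩
  have goLower : ∀ s' ∈ Icc (x₀ + y₀) s, s' - U s' = j → (i : ℝ) ≤ U s' → 1 ≤ j →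
      ∃ r ≤ U s, (chainGrid p q ε SL SB).Reach σ .horiz i j r := by
    intro s' hs' e hi hj
    have hle := h1 (hsub hs') hs hs'.2
    obtain ⟨j, rfl⟩ : ∃ j', j = j' + 1 := ⟨j - 1, by omega⟩
    push_cast at e hj0 hj1
    have hfr := h5 s' (hsub hs')
    have hij := (free_horiz_iff (SL := SL) (SB := SB) (j := j + 1) hε hi (by linarith)).1
      (by push_cast; rwa [e] at hfr)
    refine ⟨U s', hle, Grid.reach_horiz_succ.2 ⟨hij.1, hij.2, ?_⟩⟩
    rcases ih (i + j) (by omega) (hsub hs') hi (by linarith) (by linarith) (by linarith) rfl with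
      ⟨r, -, hr'⟩ | ⟨r, hr, hr'⟩
    · exact .inl ⟨r, hr'⟩
    · exact .inr ⟨r, hr, hr'⟩
  have findLeft : x₀ ≤ i → ∃ s' ∈ Icc (x₀ + y₀) s, U s' = i := fun hxi =>
    intermediate_value_Icc hs.1 (hc.mono hsub) ⟨by rwa [h3], hi0⟩
  have findLower : y₀ ≤ j → ∃ s' ∈ Icc (x₀ + y₀) s, s' - U s' = j := fun hyj =>
    intermediate_value_Icc (f := fun s => s - U s) hs.1 (continuousOn_id.sub (hc.mono hsub))
      ⟨by simp only [h3]; linarith, hj0⟩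
  have hV : ∀ s' ∈ Icc (x₀ + y₀) s, y₀ ≤ s' - U s' := fun s' hs' =>
    (box hx hy h1 h2 h3 h4 (hsub hs')).2.1
  have hU : ∀ s' ∈ Icc (x₀ + y₀) s, x₀ ≤ U s' := fun s' hs' =>
    (box hx hy h1 h2 h3 h4 (hsub hs')).1.1
  -- A start to the right of the line u = i is on the lower side, and the path never meets this
  -- line. So it comes through the lower edge of the cell or, for `j = 0`, starts there.
  rcases lt_or_ge (i : ℝ) x₀ with hxi | hxi
  · obtain ⟨e0, hx0, hxS, hSB⟩ : y₀ = 0 ∧ 0 ≤ x₀ ∧ x₀ ≤ SB ∧ 0 < SB := by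
      rcases hst with h | h
      · have := i.cast_nonneg (α := ℝ)
        linarith [h.1]
      · exact h
    right
    rcases Nat.eq_zero_or_pos j with rfl | hj
    · have hij := (free_horiz_iff (SL := SL) (SB := SB) (j := 0) hε hxi.le (by linarith)).1
        (by push_cast; rwa [e0] at hstart)
      exact ⟨x₀, hb.1.1, .lower (by exact_mod_cast lt_of_lt_of_le hxi hxS) hij.1 le_rfl hij.2
        (by linarith)⟩
    · obtain ⟨s', hs', e⟩ := findLower (by rw [e0]; positivity)
      exact goLower s' hs' e (hxi.le.trans (hU s' hs')) hj
  rcases lt_or_ge (j : ℝ) y₀ with hyj | hyj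
  · obtain ⟨e0, hy0, hyS, hSL⟩ : x₀ = 0 ∧ 0 ≤ y₀ ∧ y₀ ≤ SL ∧ 0 < SL := by
      rcases hst with h | h
      · exact h
      · have := j.cast_nonneg (α := ℝ)
        linarith [h.1]
    left
    rcases Nat.eq_zero_or_pos i with rfl | hi
    · have hij := (free_vert_iff (SL := SL) (SB := SB) (i := 0) hε hyj.le (by linarith)).1
        (by push_cast; rwa [e0] at hstart)
      exact ⟨y₀, hb.2.1, .left (by exact_mod_cast lt_of_lt_of_le hyj hyS) hij.1 hij.2
        (by linarith)⟩
    · obtain ⟨s', hs', e⟩ := findLeft (by rw [e0]; positivity)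
      exact goLeft s' hs' e (hyj.le.trans (hV s' hs')) hi
  -- Now the path meets both lines u = i and v = j. Away from the two sides of the diagram the later
  -- meeting is the entry into the cell.
  obtain ⟨t, ht, et⟩ := findLeft hxi
  obtain ⟨t', ht', et'⟩ := findLower hyj
  rcases Nat.eq_zero_or_pos i with rfl | hi
  · rcases Nat.eq_zero_or_pos j with rfl | hj
    -- The start is the origin. The clauses `0 < SL` and `0 < SB` of `IsStart` tell on which of the
    -- two adjacent edges it counts as a start.
    · push_cast at hxi hyj
      have ex : x₀ = 0 := by rcases hst with h | h <;> linarith [h.1, h.2.1]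
      have ey : y₀ = 0 := by rcases hst with h | h <;> linarith [h.1, h.2.1]
      rw [ex, ey] at hstart
      rcases hst with h | h
      · have hij := (free_vert_iff (SL := SL) (SB := SB) (i := 0) (j := 0) (v := 0) hε (by simp)
          (by simp)).1 (by exact_mod_cast hstart)
        exact .inl ⟨0, by linarith [hb.2.1], .left h.2.2.2 hij.1 hij.2 (by linarith)⟩
      · have hij := (free_horiz_iff (SL := SL) (SB := SB) (i := 0) (j := 0) (u := 0) hε (by simp)
          (by simp)).1 (by exact_mod_cast hstart)
        exact .inr ⟨0, by linarith [hb.1.1], .lower h.2.2.2 hij.1 le_rfl hij.2 (by linarith)⟩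
    · have : (0 : ℝ) ≤ x₀ := by rcases hst with h | h <;> linarith [h.1, h.2.1]
      exact .inr (goLower t' ht' et' (by push_cast; linarith [hU t' ht']) hj)
  · rcases Nat.eq_zero_or_pos j with rfl | hj
    · have : (0 : ℝ) ≤ y₀ := by rcases hst with h | h <;> linarith [h.1, h.2.1]
      exact .inl (goLeft t ht et (by push_cast; linarith [hV t ht]) hi)
    · rcases le_total t' t with h | h
      · have := h2 (hsub ht') (hsub ht) h
        simp only [et'] at this
        exact .inl (goLeft t ht et this hi)
      · have := h1 (hsub ht) (hsub ht') h
        rw [et] at this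
        exact .inr (goLower t' ht' et' this hj)

/-- The left side itself is excluded: there `Reach` knows only start points and not the paths that
run along this side. The last step of the path leads from an edge of the cell `(i, j)`, found by
`MonoPath.enter`, to the right edge. -/
theorem reach_vert_iff (hε : 0 ≤ ε) {r : ℝ} (h0 : (j : ℝ) ≤ r) (h1 : r ≤ j + 1) :
    (chainGrid p q ε SL SB).Reach σ .vert (i + 1) j r ↔
      ∃ x y, IsStart SL SB x y ∧ σ ≤ y - x ∧ MonoPath (Free p q ε) x y (i + 1) r := by
  constructor
  · intro h
    simpa [Side.abscissa, Side.ordinate] using h.exists_path hε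
  · rintro ⟨x, y, hst, hσ, hx, hy, U, h2, h3, h4, h5, h6⟩
    have hmem : (i : ℝ) + 1 + r ∈ Icc (x + y) (i + 1 + r) := ⟨by linarith, le_rfl⟩
    have hfr := h6 _ hmem
    have hent := MonoPath.enter (i := i) (j := j) hε hst hσ hx hy h2 h3 h4 h5 h6 hmem
      (by rw [h5]; linarith) (by rw [h5]) (by rw [h5]; linarith) (by rw [h5]; linarith)
    rw [h5, add_sub_cancel_left] at hfr hent
    have hij := (free_vert_iff (SL := SL) (SB := SB) (i := i + 1) hε h0 h1).1
      (by exact_mod_cast hfr)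
    refine Grid.reach_vert_succ.2 ⟨hij.1, hij.2, ?_⟩
    rcases hent with ⟨r', hr, h⟩ | ⟨r', -, h⟩
    · exact .inr ⟨r', hr, h⟩
    · exact .inl ⟨r', h⟩

theorem reach_horiz_iff (hε : 0 ≤ ε) {r : ℝ} (h0 : (i : ℝ) ≤ r) (h1 : r ≤ i + 1) :
    (chainGrid p q ε SL SB).Reach σ .horiz i (j + 1) r ↔
      ∃ x y, IsStart SL SB x y ∧ σ ≤ y - x ∧ MonoPath (Free p q ε) x y r (j + 1) := by
  constructor
  · intro h
    simpa [Side.abscissa, Side.ordinate] using h.exists_path hε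
  · rintro ⟨x, y, hst, hσ, hx, hy, U, h2, h3, h4, h5, h6⟩
    have hmem : r + ((j : ℝ) + 1) ∈ Icc (x + y) (r + (j + 1)) := ⟨by linarith, le_rfl⟩
    have hfr := h6 _ hmem
    have hent := MonoPath.enter (i := i) (j := j) hε hst hσ hx hy h2 h3 h4 h5 h6 hmem
      (by rw [h5]; linarith) (by rw [h5]; linarith) (by rw [h5]; linarith) (by rw [h5]; linarith)
    rw [h5, add_sub_cancel_left] at hfr hent
    have hij := (free_horiz_iff (SL := SL) (SB := SB) (j := j + 1) hε h0 h1).1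
      (by exact_mod_cast hfr)
    refine Grid.reach_horiz_succ.2 ⟨hij.1, hij.2, ?_⟩
    rcases hent with ⟨r', -, h⟩ | ⟨r', hr, h⟩
    · exact .inl ⟨r', h⟩
    · exact .inr ⟨r', hr, h⟩

end Chain

/-! ### The Fréchet distance and monotone paths -/

section Continuity

variable {E : Type*} [NormedAddCommGroup E] [InnerProductSpace ℝ E]

theorem continuousOn_chain (p : ℕ → E) : ContinuousOn (chain p) (Ici 0) := by
  have hlf : LocallyFinite fun i : ℕ => Icc (i : ℝ) (i + 1) := by
    have hZ : LocallyFinite fun i : ℤ => Icc (i : ℝ) (i + 1) :=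
      locallyFinite_Icc_of_tendsto tendsto_intCast_atTop_atTop
        (Filter.tendsto_atBot_add_const_right _ (1 : ℝ)
          (tendsto_intCast_atBot_iff.2 Filter.tendsto_id))
    simpa [Function.comp_def] using hZ.comp_injective Nat.cast_injective
  refine (hlf.continuousOn_iUnion (fun i => isClosed_Icc) (g := chain p) fun i => ?_).mono ?_
  · have : ContinuousOn (fun t : ℝ => (1 - (t - i)) • p i + (t - i) • p (i + 1))
        (Icc (i : ℝ) (i + 1)) := by fun_prop
    exact this.congr fun t ht => chain_of_mem p ht.1 ht.2
  · intro t ht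
    obtain ⟨i, hi⟩ := exists_cell ht
    exact mem_iUnion.2 ⟨i, hi⟩

theorem continuous_chain_max (p : ℕ → E) : Continuous fun t => chain p (max 0 t) :=
  (continuousOn_chain p).comp_continuous (by fun_prop) fun t => mem_Ici.2 (le_max_left _ _)

theorem chain_periodic {p : ℕ → E} {m : ℕ} (hp : ∀ i, p (i + m) = p i) {t : ℝ} (ht : 0 ≤ t) :
    chain p (t + m) = chain p t := by
  obtain ⟨i, h0, h1⟩ := exists_cell ht
  rw [chain_of_mem p h0 h1, chain_of_mem p (i := i + m) (by push_cast; linarith)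
    (by push_cast; linarith), hp, show i + m + 1 = i + 1 + m by ring, hp]
  push_cast
  rw [add_sub_add_right_eq_sub]

/-- The closed monotone paths for the free spaces of all larger distances have a limit. -/
theorem exists_path_of_forall_gt {p q : ℕ → E} {ε : ℝ} {m n : ℕ}
    (h : ∀ δ, ε < δ → ∃ a : ℝ, 0 ≤ a ∧ a ≤ n ∧ MonoPath (Free p q δ) 0 a m (a + n)) :
    ∃ a : ℝ, 0 ≤ a ∧ a ≤ n ∧ MonoPath (Free p q ε) 0 a m (a + n) := by
  have hmn : (0 : ℝ) ≤ m + n := by positivity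
  -- The paths, with the parameter moved to [0, m + n], are points of a product of compact
  -- intervals. Monotonicity, the Lipschitz condition and freeness survive pointwise limits, so
  -- Tychonoff's theorem suffices and no equicontinuity argument is needed. The `max 0` keeps the
  -- arguments where the chains are continuous.
  set K : ℕ → Set (ℝ × (ℝ → ℝ)) := fun l =>
    {z | z ∈ Icc (0 : ℝ) n ×ˢ univ.pi (fun _ => Icc (0 : ℝ) m)} ∩
    ({z | z.2 0 = 0} ∩ ({z | z.2 (m + n) = m} ∩
    ({z | ∀ r r' : ℝ, 0 ≤ r → r ≤ r' → r' ≤ m + n → z.2 r ≤ z.2 r'} ∩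
    ({z | ∀ r r' : ℝ, 0 ≤ r → r ≤ r' → r' ≤ m + n → z.2 r' - z.2 r ≤ r' - r} ∩
    {z | ∀ r : ℝ, 0 ≤ r → r ≤ m + n →
      dist (chain p (max 0 (z.2 r))) (chain q (max 0 (z.1 + r - z.2 r))) ≤ ε + 1 / (l + 1)}))))
    with hK
  have hev : ∀ r : ℝ, Continuous fun z : ℝ × (ℝ → ℝ) => z.2 r := fun r =>
    (continuous_apply r).comp continuous_snd
  have hcomp : IsCompact {z : ℝ × (ℝ → ℝ) |
      z ∈ Icc (0 : ℝ) n ×ˢ univ.pi (fun _ => Icc (0 : ℝ) m)} :=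
    isCompact_Icc.prod (isCompact_univ_pi fun _ => isCompact_Icc)
  have hclosed : ∀ l, IsClosed (K l) := by
    intro l
    refine hcomp.isClosed.inter ((isClosed_eq (hev 0) continuous_const).inter
      ((isClosed_eq (hev _) continuous_const).inter (IsClosed.inter ?_ (IsClosed.inter ?_ ?_))))
    · simp only [ofPred_forall]
      exact isClosed_iInter fun r => isClosed_iInter fun r' => isClosed_iInter fun _ =>
        isClosed_iInter fun _ => isClosed_iInter fun _ => isClosed_le (hev r) (hev r')
    · simp only [ofPred_forall]
      exact isClosed_iInter fun r => isClosed_iInter fun r' => isClosed_iInter fun _ =>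
        isClosed_iInter fun _ => isClosed_iInter fun _ =>
          isClosed_le ((hev r').sub (hev r)) continuous_const
    · simp only [ofPred_forall]
      exact isClosed_iInter fun r => isClosed_iInter fun _ => isClosed_iInter fun _ =>
        isClosed_le (((continuous_chain_max p).comp (hev r)).dist
          ((continuous_chain_max q).comp ((continuous_fst.add continuous_const).sub (hev r))))
          continuous_const
  have hne : ∀ l, (K l).Nonempty := by
    intro l
    obtain ⟨a, ha0, ha1, hx, hy, U, h1, h2, h3, h4, h5⟩ := h (ε + 1 / (l + 1))
      (by have : (0 : ℝ) < 1 / (l + 1) := by positivity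
          linarith)
    have hcl : ∀ r : ℝ, a + max 0 (min r (m + n)) ∈ Icc (0 + a) (m + (a + n)) := by
      intro r
      have h6 : 0 ≤ max 0 (min r ((m : ℝ) + n)) := le_max_left _ _
      have h7 : max 0 (min r ((m : ℝ) + n)) ≤ m + n := max_le hmn (min_le_right _ _)
      constructor <;> linarith
    have hid : ∀ r : ℝ, 0 ≤ r → r ≤ m + n → max 0 (min r ((m : ℝ) + n)) = r := by
      intro r h6 h7
      rw [min_eq_left h7, max_eq_right h6]
    refine ⟨(a, fun r => U (a + max 0 (min r (m + n)))), ⟨⟨ha0, ha1⟩, fun r _ => ?_⟩, ?_, ?_, ?_,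
      ?_, ?_⟩
    · exact (MonoPath.box hx hy h1 h2 h3 h4 (hcl r)).1
    · simp only [mem_ofPred_eq]
      rw [hid 0 le_rfl hmn, add_comm, h3]
    · simp only [mem_ofPred_eq]
      rw [hid _ hmn le_rfl, show a + ((m : ℝ) + n) = m + (a + n) by ring, h4]
    · intro r r' h6 h7 h8
      exact h1 (hcl r) (hcl r') (by rw [hid r h6 (h7.trans h8), hid r' (h6.trans h7) h8]; linarith)
    · intro r r' h6 h7 h8
      have := h2 (hcl r) (hcl r')
        (by rw [hid r h6 (h7.trans h8), hid r' (h6.trans h7) h8]; linarith)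
      simp only [hid r h6 (h7.trans h8), hid r' (h6.trans h7) h8] at this ⊢
      linarith
    · intro r h6 h7
      have hb := MonoPath.box hx hy h1 h2 h3 h4 (hcl r)
      have hf := h5 _ (hcl r)
      simp only [hid r h6 h7] at hb hf ⊢
      rw [max_eq_right hb.1.1, max_eq_right (ha0.trans hb.2.1)]
      exact hf
  have hanti : ∀ l, K (l + 1) ⊆ K l := by
    rintro l z ⟨z1, z2, z3, z4, z5, z6⟩
    refine ⟨z1, z2, z3, z4, z5, fun r h6 h7 => (z6 r h6 h7).trans ?_⟩
    push_cast
    gcongr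
    linarith
  obtain ⟨z, hz⟩ := IsCompact.nonempty_iInter_of_sequence_nonempty_isCompact_isClosed K hanti hne
    (hcomp.of_isClosed_subset (hclosed 0) inter_subset_left) hclosed
  have hz' : ∀ l, z ∈ K l := fun l => mem_iInter.1 hz l
  obtain ⟨⟨⟨ha0, ha1⟩, z1⟩, z2, z3, z4, z5, -⟩ := hz' 0
  have z6 : ∀ r : ℝ, 0 ≤ r → r ≤ m + n →
      dist (chain p (max 0 (z.2 r))) (chain q (max 0 (z.1 + r - z.2 r))) ≤ ε := by
    intro r h0 h1
    refine le_of_forall_pos_le_add fun δ hδ => ?_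
    obtain ⟨l, hl⟩ := exists_nat_one_div_lt hδ
    have := (hz' l).2.2.2.2.2 r h0 h1
    linarith
  obtain ⟨a, W⟩ := z
  simp only at ha0 ha1 z6
  have z2 : W 0 = 0 := z2
  have z3 : W (m + n) = m := z3
  have z4 : ∀ r r' : ℝ, 0 ≤ r → r ≤ r' → r' ≤ m + n → W r ≤ W r' := z4
  have z5 : ∀ r r' : ℝ, 0 ≤ r → r ≤ r' → r' ≤ m + n → W r' - W r ≤ r' - r := z5
  refine ⟨a, ha0, ha1, m.cast_nonneg, by linarith [n.cast_nonneg (α := ℝ)], fun s => W (s - a),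
    ?_, ?_, ?_, ?_, ?_⟩
  · intro s hs t ht hst
    exact z4 _ _ (by linarith [hs.1]) (by linarith) (by linarith [ht.2])
  · intro s hs t ht hst
    have := z5 (s - a) (t - a) (by linarith [hs.1]) (by linarith) (by linarith [ht.2])
    simp only
    linarith
  · simp [z2]
  · simp only
    rw [show (m : ℝ) + (a + n) - a = m + n by ring, z3]
  · intro s hs
    have h0 : 0 ≤ s - a := by linarith [hs.1]
    have h1 : s - a ≤ m + n := by linarith [hs.2]
    have h2 := z4 0 (s - a) le_rfl h0 h1
    have h3 := z5 0 (s - a) le_rfl h0 h1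
    have h4 := z6 (s - a) h0 h1
    rw [z2] at h2 h3
    rw [max_eq_right h2, max_eq_right (by linarith), add_sub_cancel] at h4
    exact h4

end Continuity

/-! ### From reparametrizations of closed curves to paths -/

namespace ClosedPolygon

variable {k m n : ℕ} [NeZero m] [NeZero n]

theorem vertex_add (X : ClosedPolygon k m) (i : ℕ) : X.vertex (i + m) = X.vertex i := by
  unfold vertex
  congr 1
  ext
  simp [Fin.ofNat]

theorem chain_add_period (X : ClosedPolygon k m) {t : ℝ} (ht : 0 ≤ t) :
    chain X.vertex (t + m) = chain X.vertex t :=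
  chain_periodic X.vertex_add ht

/-- The jump back by `m` is invisible to the periodic chain, so a cyclic shift becomes a translation
of the parameter. -/
theorem curve_shift (X : ClosedPolygon k m) (t τ : ℝ) :
    X.curve (shift m τ t) = chain X.vertex (t + τ) := by
  unfold shift
  split_ifs with hc
  · rfl
  · have := X.chain_add_period (t := t + τ - m) (by linarith [not_le.1 hc])
    rw [sub_add_cancel] at this
    exact this.symm

theorem exists_norm_chain_le (X : ClosedPolygon k m) : ∃ R, ∀ t, ‖X.curve t‖ ≤ R := by
  obtain ⟨R, hR⟩ : ∃ R, ∀ i, ‖X i‖ ≤ R :=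
    ⟨∑ i, ‖X i‖, fun i => Finset.single_le_sum (f := fun i => ‖X i‖) (fun i _ => norm_nonneg _)
      (Finset.mem_univ i)⟩
  refine ⟨R, fun t => ?_⟩
  have h0 := Int.fract_nonneg t
  have h1 := (Int.fract_lt_one t).le
  refine (norm_add_le _ _).trans ?_
  rw [norm_smul, norm_smul, Real.norm_of_nonneg h0, Real.norm_of_nonneg (by linarith)]
  unfold vertex
  nlinarith [hR (Fin.ofNat m ⌊t⌋₊), hR (Fin.ofNat m (⌊t⌋₊ + 1))]

theorem free_add_period (X : ClosedPolygon k m) (Y : ClosedPolygon k n) {ε u v : ℝ} (hu : 0 ≤ u)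
    (hv : 0 ≤ v) : (Free X.vertex Y.vertex ε (u + m) v ↔ Free X.vertex Y.vertex ε u v) ∧
      (Free X.vertex Y.vertex ε u (v + n) ↔ Free X.vertex Y.vertex ε u v) := by
  simp only [Free, X.chain_add_period hu, Y.chain_add_period hv, and_self]

theorem linear_mem_timeChanges (m : ℕ) : (fun t : unitInterval => (t : ℝ) * m) ∈ timeChanges m := by
  refine ⟨by fun_prop, fun s t hst => ?_, by simp, by simp⟩
  have : (s : ℝ) ≤ t := hst
  simp only
  gcongr

/-- A monotone path for every pair of reparametrizations. -/
theorem exists_path_of_reparametrizations (X : ClosedPolygon k m) (Y : ClosedPolygon k n) {δ : ℝ}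
    {w w' : unitInterval → ℝ} (hw : w ∈ timeChanges m) (hw' : w' ∈ timeChanges n) {τ τ' : ℝ}
    (hτ : τ ∈ Icc (0 : ℝ) m) (hτ' : τ' ∈ Icc (0 : ℝ) n)
    (h : ∀ t, dist (X.curve (shift m τ (w t))) (Y.curve (shift n τ' (w' t))) ≤ δ) :
    ∃ a : ℝ, 0 ≤ a ∧ a ≤ n ∧ MonoPath (Free X.vertex Y.vertex δ) 0 a m (a + n) := by
  obtain ⟨wc, wm, w0, w1⟩ := hw
  obtain ⟨wc', wm', w0', w1'⟩ := hw'
  have hw0 : ∀ t, 0 ≤ w t := fun t => w0 ▸ wm t.2.1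
  have hw0' : ∀ t, 0 ≤ w' t := fun t => w0' ▸ wm' t.2.1
  set x : ℝ → ℝ := fun t => IccExtend zero_le_one w t + τ with hx
  set y : ℝ → ℝ := fun t => IccExtend zero_le_one w' t + τ' with hy
  have cx : Continuous x := (wc.Icc_extend').add continuous_const
  have cy : Continuous y := (wc'.Icc_extend').add continuous_const
  have mx : Monotone x := fun s t hst => add_le_add_left (wm.IccExtend _ hst) _
  have my : Monotone y := fun s t hst => add_le_add_left (wm'.IccExtend _ hst) _
  have hx0 : ∀ t, 0 ≤ x t := fun t => add_nonneg (hw0 _) hτ.1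
  have hy0 : ∀ t, 0 ≤ y t := fun t => add_nonneg (hw0' _) hτ'.1
  have hF : ∀ t, Free X.vertex Y.vertex δ (x t) (y t) := by
    intro t
    have := h (projIcc 0 1 zero_le_one t)
    rwa [X.curve_shift, Y.curve_shift] at this
  have ex0 : x 0 = τ := by
    simp only [hx, IccExtend_left]
    rw [show (⟨0, left_mem_Icc.2 zero_le_one⟩ : unitInterval) = 0 from rfl, w0, zero_add]
  have ex1 : x 1 = τ + m := by
    simp only [hx, IccExtend_right]
    rw [show (⟨1, right_mem_Icc.2 zero_le_one⟩ : unitInterval) = 1 from rfl, w1, add_comm]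
  have ey0 : y 0 = τ' := by
    simp only [hy, IccExtend_left]
    rw [show (⟨0, left_mem_Icc.2 zero_le_one⟩ : unitInterval) = 0 from rfl, w0', zero_add]
  have ey1 : y 1 = τ' + n := by
    simp only [hy, IccExtend_right]
    rw [show (⟨1, right_mem_Icc.2 zero_le_one⟩ : unitInterval) = 1 from rfl, w1', add_comm]
  -- The path leads from (τ, τ') to (τ + m, τ' + n). Cut it where the abscissa is m, append the
  -- translate of the first piece by (m, n) to the second piece, and move everything to the left by
  -- m: now it starts at abscissa 0.
  obtain ⟨t, ht, hxt⟩ : ∃ t ∈ Icc (0 : ℝ) 1, x t = m :=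
    intermediate_value_Icc zero_le_one cx.continuousOn
      ⟨by rw [ex0]; exact hτ.2, by rw [ex1]; linarith [hτ.1]⟩
  have p1 : MonoPath (Free X.vertex Y.vertex δ) (x 0) (y 0) (x t) (y t) :=
    .of_curve ht.1 cx.continuousOn cy.continuousOn (mx.monotoneOn _) (my.monotoneOn _)
      fun s _ => hF s
  have p2 : MonoPath (Free X.vertex Y.vertex δ) (x t) (y t) (x 1) (y 1) :=
    .of_curve ht.2 cx.continuousOn cy.continuousOn (mx.monotoneOn _) (my.monotoneOn _)
      fun s _ => hF s
  have p1' := p1.translate (D' := Free X.vertex Y.vertex δ) m n fun u v h1 _ h2 _ hf => by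
    have hu : 0 ≤ u := (hx0 0).trans h1
    have hv : 0 ≤ v := (hy0 0).trans h2
    rw [(X.free_add_period Y hu (add_nonneg hv n.cast_nonneg)).1, (X.free_add_period Y hu hv).2]
    exact hf
  rw [ex0, ey0] at p1'
  rw [ex1, ey1] at p2
  have p3 := p2.trans p1'
  rw [hxt] at p3
  have p4 := p3.translate (D' := Free X.vertex Y.vertex δ) (-m) 0 fun u v h1 _ h2 _ hf => by
    have := (X.free_add_period Y (u := u - m) (v := v) (ε := δ) (by linarith)
      ((hy0 t).trans h2)).1
    rw [sub_add_cancel] at this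
    simpa [← sub_eq_add_neg] using this.1 hf
  rw [add_neg_cancel, add_neg_cancel_right, add_zero, add_zero] at p4
  -- The starting ordinate lies in [0, 2n], so at most one period has to be subtracted.
  rcases le_or_gt (y t) n with hyn | hyn
  · exact ⟨y t, hy0 t, hyn, p4⟩
  · have p5 := p4.translate (D' := Free X.vertex Y.vertex δ) 0 (-n) fun u v h1 _ h2 _ hf => by
      have := (X.free_add_period Y (u := u) (v := v - n) (ε := δ) h1 (by linarith)).2
      rw [sub_add_cancel] at this
      simpa [← sub_eq_add_neg] using this.1 hf
    rw [add_zero, add_zero, show y t + n + -n = y t - n + n by ring, ← sub_eq_add_neg] at p5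
    refine ⟨y t - n, by linarith, ?_, p5⟩
    have := my ht.2
    rw [ey1] at this
    have hτm := hτ'.2
    linarith

/-- The Fréchet distance of closed polygonal curves in terms of monotone paths. -/
theorem frechetDist_le_iff (X : ClosedPolygon k m) (Y : ClosedPolygon k n) (ε : ℝ) :
    X.frechetDist Y ≤ ε ↔
      ∃ a : ℝ, 0 ≤ a ∧ a ≤ n ∧ MonoPath (Free X.vertex Y.vertex ε) 0 a m (a + n) := by
  have hnonneg : ∀ r ∈ {r | ∃ φ ∈ X.reparametrizations, ∃ ψ ∈ Y.reparametrizations,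
      r = ⨆ t : unitInterval, dist (φ t) (ψ t)}, 0 ≤ r := by
    rintro r ⟨φ, -, ψ, -, rfl⟩
    exact Real.iSup_nonneg fun t => dist_nonneg
  constructor
  · intro hle
    refine exists_path_of_forall_gt fun δ hδ => ?_
    have hne : {r | ∃ φ ∈ X.reparametrizations, ∃ ψ ∈ Y.reparametrizations,
        r = ⨆ t : unitInterval, dist (φ t) (ψ t)}.Nonempty :=
      ⟨_, _, ⟨_, linear_mem_timeChanges m, 0, ⟨le_rfl, m.cast_nonneg⟩, fun _ => rfl⟩, _,
        ⟨_, linear_mem_timeChanges n, 0, ⟨le_rfl, n.cast_nonneg⟩, fun _ => rfl⟩, rfl⟩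
    obtain ⟨r, ⟨φ, ⟨w, hw, τ, hτ, hφ⟩, ψ, ⟨w', hw', τ', hτ', hψ⟩, rfl⟩, hr⟩ :=
      exists_lt_of_csInf_lt hne (lt_of_le_of_lt hle hδ)
    refine X.exists_path_of_reparametrizations Y hw hw' hτ hτ' fun t => ?_
    rw [← hφ, ← hψ]
    refine le_trans (le_ciSup (f := fun t => dist (φ t) (ψ t)) ?_ t) hr.le
    -- The supremum of an unbounded family would be the default value 0, so boundedness of the
    -- curves is needed here.
    obtain ⟨R, hR⟩ := X.exists_norm_chain_le
    obtain ⟨R', hR'⟩ := Y.exists_norm_chain_le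
    refine ⟨R + R', ?_⟩
    rintro _ ⟨t, rfl⟩
    simp only
    rw [hφ, hψ, dist_eq_norm]
    exact (norm_sub_le _ _).trans (add_le_add (hR _) (hR' _))
  · rintro ⟨a, ha0, ha1, hx, hy, U, h1, h2, h3, h4, h5⟩
    have hmn : (0 : ℝ) ≤ m + n := by positivity
    have hmem : ∀ t : unitInterval, a + t * (m + n) ∈ Icc (0 + a) (m + (a + n)) := by
      intro t
      have := mul_nonneg t.2.1 hmn
      have := mul_le_of_le_one_left hmn t.2.2
      constructor <;> linarith
    have hmono : ∀ s t : unitInterval, s ≤ t → a + (s : ℝ) * (m + n) ≤ a + t * (m + n) := by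
      intro s t hst
      have : (s : ℝ) ≤ t := hst
      gcongr
    have hc : Continuous fun t : unitInterval => U (a + t * (m + n)) :=
      (continuousOn_of_monotoneOn_sub h1 h2).comp_continuous (by fun_prop) hmem
    have hw : (fun t : unitInterval => U (a + t * (m + n))) ∈ timeChanges m := by
      refine ⟨hc, fun s t hst => h1 (hmem s) (hmem t) (hmono s t hst), ?_, ?_⟩
      · rw [← h3]; simp
      · simp only [Icc.coe_one]
        rw [show a + 1 * ((m : ℝ) + n) = m + (a + n) by ring, h4]
    have hw' : (fun t : unitInterval => a + t * (m + n) - U (a + t * (m + n)) - a) ∈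
        timeChanges n := by
      refine ⟨(Continuous.sub (by fun_prop) hc).sub continuous_const, fun s t hst => ?_, ?_, ?_⟩
      · have := h2 (hmem s) (hmem t) (hmono s t hst)
        simp only at this ⊢
        linarith
      · rw [zero_add] at h3
        simp [h3]
      · simp only [Icc.coe_one]
        rw [show a + 1 * ((m : ℝ) + n) = m + (a + n) by ring, h4]
        ring
    refine le_trans (csInf_le ⟨0, hnonneg⟩
      ⟨_, ⟨_, hw, 0, ⟨le_rfl, m.cast_nonneg⟩, fun _ => rfl⟩, _, ⟨_, hw', a, ⟨ha0, ha1⟩,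
        fun _ => rfl⟩, rfl⟩) (ciSup_le fun t => ?_)
    rw [X.curve_shift, Y.curve_shift, add_zero, sub_add_cancel]
    exact h5 _ (hmem t)

end ClosedPolygon

/-! ### The decision in terms of two sweeps -/

section Reverse

variable {E : Type*} [NormedAddCommGroup E] [InnerProductSpace ℝ E]

theorem chain_reverse (p : ℕ → E) {M : ℕ} (hM : 0 < M) {u : ℝ} (h0 : 0 ≤ u) (h1 : u ≤ M) :
    chain (fun i => p (M - i)) u = chain p (M - u) := by
  -- The end point `u = M` is assigned to the last cell, so that `M - (i + 1)` is not truncated.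
  obtain ⟨i, hi, hi0, hi1⟩ : ∃ i : ℕ, i < M ∧ (i : ℝ) ≤ u ∧ u ≤ i + 1 := by
    obtain ⟨i, hi0, hi1⟩ := exists_cell h0
    rcases lt_or_ge i M with h | h
    · exact ⟨i, h, hi0, hi1⟩
    · have h2 : (M : ℝ) ≤ i := by exact_mod_cast h
      refine ⟨M - 1, by omega, ?_, ?_⟩ <;> rw [Nat.cast_pred hM] <;> linarith
  obtain ⟨l, rfl⟩ : ∃ l, M = i + 1 + l := ⟨M - (i + 1), by omega⟩
  push_cast at h1 ⊢
  rw [chain_of_mem _ hi0 hi1, chain_of_mem p (i := l) (by linarith) (by linarith),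
    show i + 1 + l - i = l + 1 by omega, show i + 1 + l - (i + 1) = l by omega, add_comm]
  congr 2 <;> ring

end Reverse

namespace ClosedPolygon

variable {k m n : ℕ} [NeZero m] [NeZero n] (X : ClosedPolygon k m) (Y : ClosedPolygon k n)
  {ε : ℝ} {j : ℕ} {a : ℝ}

/-- The grid with `Y`, passed twice, as the abscissa and `X` as the ordinate. -/
noncomputable def forwardGrid (ε : ℝ) : Grid := chainGrid Y.vertex X.vertex ε 0 n

/-- The grid with `X` as the abscissa and `Y`, passed twice, as the ordinate, both passed
backwards. -/
noncomputable def backwardGrid (ε : ℝ) : Grid :=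
  chainGrid (fun i => X.vertex (m - i)) (fun j => Y.vertex (2 * n - j)) ε n 0

/-- A start `(a', 0)` has the label `-a'`, so the threshold `-a` demands `a' ≤ a`. With `Y` as the
abscissa the end points are on horizontal edges, for which the sweep keeps a single label. -/
theorem forwardGrid_reach_iff (hε : 0 ≤ ε) (h0 : (j : ℝ) ≤ a) (h1 : a ≤ j + 1) :
    (X.forwardGrid Y ε).Reach (-a) .horiz (j + n) m (a + n) ↔
      ∃ a' : ℝ, 0 ≤ a' ∧ a' ≤ n ∧ a' ≤ a ∧
        MonoPath (Free X.vertex Y.vertex ε) 0 a' m (a + n) := by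
  have hn := NeZero.pos n
  obtain ⟨l, hl⟩ : ∃ l, m = l + 1 := ⟨m - 1, by have := NeZero.pos m; omega⟩
  have key := reach_horiz_iff (p := Y.vertex) (q := X.vertex) (σ := -a) (SL := 0) (SB := n)
    (i := j + n) (j := l) (r := a + n) hε (by push_cast; linarith) (by push_cast; linarith)
  have hm : ((l : ℝ) + 1) = m := by rw [hl]; push_cast; rfl
  rw [hm, ← hl] at key
  rw [forwardGrid, key]
  constructor
  · rintro ⟨x, y, (h | ⟨rfl, h2, h3, -⟩), h4, h5⟩
    · exact absurd h.2.2.2 (lt_irrefl _)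
    · exact ⟨x, h2, h3, by linarith, h5.swap fun u v h => by rwa [Free, dist_comm]⟩
  · rintro ⟨x, h2, h3, h4, h5⟩
    exact ⟨x, 0, .inr ⟨rfl, h2, h3, hn⟩, by linarith, h5.swap fun u v h => by rwa [Free, dist_comm]⟩

theorem free_reverse_iff {u v : ℝ} (hu0 : 0 ≤ u) (hu1 : u ≤ m) (hv0 : 0 ≤ v) (hv1 : v ≤ 2 * n) :
    Free (fun i => X.vertex (m - i)) (fun j => Y.vertex (2 * n - j)) ε u v ↔
      Free X.vertex Y.vertex ε (m - u) (2 * n - v) := by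
  have hn := NeZero.pos n
  rw [Free, Free, chain_reverse X.vertex (NeZero.pos m) hu0 hu1,
    chain_reverse Y.vertex (by omega) hv0 (by push_cast; exact hv1)]
  push_cast
  rfl

/-- The point reflection turns an end `(m, b)` into a start `(0, 2 n - b)` with label `2 n - b`, so
the threshold `n - a` demands `b ≤ a + n`; the start `(0, a)` becomes the target `(m, 2 n - a)`. -/
theorem backwardGrid_reach_iff (hε : 0 ≤ ε) (hj : j < n) (h0 : (j : ℝ) ≤ a) (h1 : a ≤ j + 1) :
    (X.backwardGrid Y ε).Reach (n - a) .vert m (2 * n - 1 - j) (2 * n - a) ↔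
      ∃ b : ℝ, n ≤ b ∧ b ≤ 2 * n ∧ b ≤ a + n ∧ MonoPath (Free X.vertex Y.vertex ε) 0 a m b := by
  have hn := NeZero.pos n
  have hj' : (((2 * n - 1 - j : ℕ)) : ℝ) = 2 * n - 1 - j := by
    rw [Nat.sub_sub, Nat.cast_sub (by omega)]; push_cast; ring
  have hjn : (j : ℝ) + 1 ≤ n := by exact_mod_cast hj
  have ha0 : 0 ≤ a := j.cast_nonneg.trans h0
  obtain ⟨l, hl⟩ : ∃ l, m = l + 1 := ⟨m - 1, by have := NeZero.pos m; omega⟩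
  have key := reach_vert_iff (p := fun i => X.vertex (m - i))
    (q := fun j => Y.vertex (2 * n - j)) (σ := n - a) (SL := n) (SB := 0) (i := l)
    (j := 2 * n - 1 - j) (r := 2 * n - a) hε (by rw [hj']; linarith) (by rw [hj']; linarith)
  have hm : ((l : ℝ) + 1) = m := by rw [hl]; push_cast; rfl
  rw [hm, ← hl] at key
  rw [backwardGrid, key]
  constructor
  · rintro ⟨x, y, (⟨rfl, h2, h3, -⟩ | h), h4, h5⟩
    · refine ⟨2 * n - y, by linarith, by linarith, by linarith, ?_⟩
      have := h5.reflect (D' := Free X.vertex Y.vertex ε) m (2 * n) fun u v a1 a2 a3 a4 h =>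
        (X.free_reverse_iff Y a1 a2 (h2.trans a3) (by linarith)).1 h
      simpa using this
    · exact absurd h.2.2.2 (lt_irrefl _)
  · rintro ⟨b, h2, h3, h4, h5⟩
    refine ⟨0, 2 * n - b, .inl ⟨rfl, by linarith, by linarith, hn⟩, by linarith, ?_⟩
    have := h5.reflect (D' := Free (fun i => X.vertex (m - i)) (fun j => Y.vertex (2 * n - j)) ε)
      m (2 * n) fun u v a1 a2 a3 a4 h => by
        rw [X.free_reverse_iff Y (by linarith) (by linarith) (by linarith) (by linarith),
          sub_sub_cancel, sub_sub_cancel]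
        exact h
    simpa using this

/-- The Fréchet distance in terms of reachability in two grids. -/
theorem frechetDist_le_iff_reach (hε : 0 ≤ ε) :
    X.frechetDist Y ≤ ε ↔ ∃ j < n, ∃ a : ℝ, (j : ℝ) ≤ a ∧ a ≤ j + 1 ∧
      (X.forwardGrid Y ε).Reach (-a) .horiz (j + n) m (a + n) ∧
      (X.backwardGrid Y ε).Reach (n - a) .vert m (2 * n - 1 - j) (2 * n - a) := by
  rw [frechetDist_le_iff]
  constructor
  · rintro ⟨a, ha0, ha1, h⟩
    obtain ⟨j, hj, hj0, hj1⟩ : ∃ j < n, (j : ℝ) ≤ a ∧ a ≤ j + 1 := by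
      obtain ⟨j, hj0, hj1⟩ := exists_cell ha0
      rcases lt_or_ge j n with hj | hj
      · exact ⟨j, hj, hj0, hj1⟩
      · have h2 : (n : ℝ) ≤ j := by exact_mod_cast hj
        have hn := NeZero.pos n
        refine ⟨n - 1, by omega, ?_, ?_⟩ <;> rw [Nat.cast_pred hn] <;> linarith
    exact ⟨j, hj, a, hj0, hj1, (X.forwardGrid_reach_iff Y hε hj0 hj1).2 ⟨a, ha0, ha1, le_rfl, h⟩,
      (X.backwardGrid_reach_iff Y hε hj hj0 hj1).2
        ⟨a + n, by linarith, by linarith, le_rfl, h⟩⟩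
  · rintro ⟨j, hj, a, h0, h1, h2, h3⟩
    obtain ⟨a', -, -, h4, h5⟩ := (X.forwardGrid_reach_iff Y hε h0 h1).1 h2
    obtain ⟨b, -, -, h6, h7⟩ := (X.backwardGrid_reach_iff Y hε hj h0 h1).1 h3
    have hjn : (j : ℝ) + 1 ≤ n := by exact_mod_cast hj
    exact ⟨a, j.cast_nonneg.trans h0, by linarith, h5.cross h7 h4 h6⟩

/-- The test for an edge of `Y`, given the results of the sweeps through the two grids. -/
theorem exists_reach_iff (hε : 0 ≤ ε) (hj : j < n) {p v : ℝ}
    (hrep : (X.forwardGrid Y ε).RepH (j + n) m p v) {dp dv : ℕ → ℝ} {H T : ℕ}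
    (hb : ∀ e, H ≤ e → e < T → (X.backwardGrid Y ε).VL m (2 * n - 1 - j) ≤ dp e ∧
      dp e ≤ (X.backwardGrid Y ε).VH m (2 * n - 1 - j))
    (hr : ∀ σ q, (X.backwardGrid Y ε).Reach σ .vert m (2 * n - 1 - j) q ↔
      q ≤ (X.backwardGrid Y ε).VH m (2 * n - 1 - j) ∧
        ∃ e, H ≤ e ∧ e < T ∧ dp e ≤ q ∧ σ ≤ dv e ∧ σ ≤ q) :
    (∃ a : ℝ, (j : ℝ) ≤ a ∧ a ≤ j + 1 ∧
      (X.forwardGrid Y ε).Reach (-a) .horiz (j + n) m (a + n) ∧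
      (X.backwardGrid Y ε).Reach (n - a) .vert m (2 * n - 1 - j) (2 * n - a)) ↔
    ∃ e, H ≤ e ∧ e < T ∧ p + dp e ≤ 3 * n ∧ dp e ≤ v + 2 * n ∧ dp e ≤ dv e + n := by
  have hn := NeZero.pos n
  have hj' : (((2 * n - 1 - j : ℕ)) : ℝ) = 2 * n - 1 - j := by
    rw [Nat.sub_sub, Nat.cast_sub (by omega)]; push_cast; ring
  have hjn : (j : ℝ) + 1 ≤ n := by exact_mod_cast hj
  constructor
  -- The entry that serves `2 n - a` has `dp e ≤ 2 n - a`. The three inequalities hold with `2 n -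
  -- a` in place of `dp e`, hence also for the smaller number.
  · rintro ⟨a, h0, h1, h2, h3⟩
    obtain ⟨-, e, he1, he2, he3, he4, -⟩ := (hr _ _).1 h3
    rcases hrep with ⟨-, -, -, h4⟩ | ⟨-, h4⟩
    · obtain ⟨h5, -, h6⟩ := (h4 _ _).1 h2
      exact ⟨e, he1, he2, by linarith, by linarith, by linarith⟩
    · exact absurd h2 (h4 _ _)
  · rintro ⟨e, he1, he2, h3, h4, h5⟩
    obtain ⟨hb1, hb2⟩ := hb e he1 he2
    have hm := Grid.vert_mem _ hb1 hb2
    rw [hj'] at hm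
    -- The witness is `a = 2 n - dp e`. As `dp e` is a free point of the right edge, periodicity in
    -- both variables makes the corresponding point of the first grid free; thus `a + n ≤ HR` comes
    -- for nothing.
    have hfree : Free X.vertex Y.vertex ε m (2 * n - dp e + n) := by
      have h6 := (free_vert_iff (p := fun i => X.vertex (m - i))
        (q := fun j => Y.vertex (2 * n - j)) (SL := n) (SB := 0) (i := m) (j := 2 * n - 1 - j)
        (v := dp e) hε (by rw [hj']; linarith [hm.1]) (by rw [hj']; linarith [hm.2])).2 ⟨hb1, hb2⟩
      have h0 := j.cast_nonneg (α := ℝ)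
      rw [X.free_reverse_iff Y m.cast_nonneg le_rfl (by linarith) (by linarith), sub_self] at h6
      rw [(X.free_add_period Y m.cast_nonneg (by linarith)).2]
      simpa using (X.free_add_period Y (ε := ε) (u := 0) (v := 2 * n - dp e) le_rfl
        (by linarith)).1.2 h6
    have hfr := (free_horiz_iff (SL := 0) (SB := n) (i := j + n) (j := m)
      (u := 2 * n - dp e + n) hε (by push_cast; linarith) (by push_cast; linarith)).1
      (show Free Y.vertex X.vertex ε _ _ by rw [Free, dist_comm]; exact hfree)
    refine ⟨2 * n - dp e, by linarith, by linarith, ?_, ?_⟩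
    -- The mark `p = j + n + 2` of an edge that is not reached is impossible here, since `p + dp e ≤
    -- 3 n` and `2 n - 1 - j ≤ dp e`.
    · obtain ⟨-, -, -, h7⟩ := hrep.reach (by push_cast; linarith)
      exact (h7 _ _).2 ⟨by linarith, hfr.2, by linarith⟩
    · rw [hr]
      exact ⟨by linarith, e, he1, he2, by linarith, by linarith, by linarith⟩

end ClosedPolygon

end

namespace RealRAM

/-! ### The program for a sweep

The cells for natural numbers below `20` are used as registers: `0`, `1` for the numbers of vertices
of the two curves, `2`, `3` (`4`, `5`) for the address and the number of vertices of the curve on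
the horizontal (vertical) axis, `6`, `7` for the numbers of columns and rows of the grid, `8` for
the direction, `9`, `10` for the bounds of the start points, `11` for the address of the arrays, `12`,
`13` for the current cell, `14`, `15`, `16` for the queue and `17` for the result. -/

/-- The content of a register. -/
def reg (a : ℕ) : NExpr := .load (.const a)

/-- The address of the entry `e` of the array `c`, where `c = 0, 1, 2, 3` stands for the arrays
`bp`, `bv`, `dp`, `dv` of a sweep. -/
def entry (c : ℕ) (e : NExpr) : NExpr := .add (.add (reg 11) (.mul (.const 4) e)) (.const c)

/-- The number of a vertex, in the direction of the sweep. -/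
def directed (len i : NExpr) : NExpr :=
  .add (.mul i (.sub (.const 1) (reg 8))) (.mul (.sub len i) (reg 8))

/-- The remainder of `r` modulo `l`, for `r ≤ 2 l`. -/
def wrap (l r : NExpr) : NExpr :=
  .sub (.sub r (.mul l (.sub (.const 1) (.sub l r))))
    (.mul l (.sub (.const 1) (.sub (.mul (.const 2) l) r)))

/-- The coordinates of the vertices on the horizontal axis. -/
def coordP (k : ℕ) (i : NExpr) (c : ℕ) : RExpr :=
  .load (.add (reg 2) (.add (.mul (.const k) (wrap (reg 3) (directed (reg 6) i))) (.const c)))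

/-- The coordinates of the vertices on the vertical axis. -/
def coordQ (k : ℕ) (j : NExpr) (c : ℕ) : RExpr :=
  .load (.add (reg 4) (.add (.mul (.const k) (wrap (reg 5) (directed (reg 7) j))) (.const c)))

/-- The expression for `segMin`. -/
def segMinE (a b : RExpr) : RExpr := .max (.const 0) (.min (.const 1) (.div b a))

/-- The expression for `segEmpty`. -/
def segEmptyE (a b c : RExpr) : RExpr :=
  .posInd (.add (.sub (.mul (.mul a (segMinE a b)) (segMinE a b))
    (.mul (.mul (.const 2) b) (segMinE a b))) c)

/-- The expression for the square root of the discriminant. -/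
def rootE (a b c : RExpr) : RExpr := .sqrt (.sub (.mul b b) (.mul a c))

/-- The expression for `segLo`. -/
def segLoE (a b c : RExpr) : RExpr :=
  .add (.mul (segEmptyE a b c) (.const 2)) (.mul (.sub (.const 1) (segEmptyE a b c))
    (.mul (.posInd c) (.div (.sub b (rootE a b c)) a)))

/-- The expression for `segHi`. -/
def segHiE (a b c : RExpr) : RExpr :=
  .sub (.mul (.sub (.const 1) (segEmptyE a b c))
    (.sub (.const 1) (.mul (.posInd (.add (.sub a (.mul (.const 2) b)) c))
      (.sub (.const 1) (.div (.add b (rootE a b c)) a))))) (segEmptyE a b c)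

/-- The expression for the inner product of `x - y` and `z - w`. -/
def innerE (k : ℕ) (x y z w : ℕ → RExpr) : RExpr :=
  RExpr.sum (fun c => .mul (.sub (x c) (y c)) (.sub (z c) (w c))) k

/-- The expression for the square of the given distance. -/
def radiusE : RExpr := .mul (.load (.const 0)) (.load (.const 0))

/-- The expression for `freeLo`. -/
def freeLoE (k : ℕ) (x y z : ℕ → RExpr) : RExpr :=
  segLoE (innerE k z y z y) (innerE k x y z y) (.sub (innerE k x y x y) radiusE)

/-- The expression for `freeHi`. -/
def freeHiE (k : ℕ) (x y z : ℕ → RExpr) : RExpr :=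
  segHiE (innerE k z y z y) (innerE k x y z y) (.sub (innerE k x y x y) radiusE)

/-- The successor of a natural number. -/
def succE (e : NExpr) : NExpr := .add e (.const 1)

/-- The lower end of the free interval on a vertical edge. -/
def vlE (k : ℕ) (i j : NExpr) : RExpr :=
  .add (.cast j) (freeLoE k (coordP k i) (coordQ k j) (coordQ k (succE j)))

/-- The upper end of the free interval on a vertical edge. -/
def vhE (k : ℕ) (i j : NExpr) : RExpr :=
  .add (.cast j) (freeHiE k (coordP k i) (coordQ k j) (coordQ k (succE j)))

/-- The left end of the free interval on a horizontal edge. -/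
def hlE (k : ℕ) (i j : NExpr) : RExpr :=
  .add (.cast i) (freeLoE k (coordQ k j) (coordP k i) (coordP k (succE i)))

/-- The right end of the free interval on a horizontal edge. -/
def hrE (k : ℕ) (i j : NExpr) : RExpr :=
  .add (.cast i) (freeHiE k (coordQ k j) (coordP k i) (coordP k (succE i)))

/-- The content of an entry of an array. -/
def get (c : ℕ) (e : NExpr) : RExpr := .load (entry c e)

/-- Append the label of the lower edge of the current cell to the queue. -/
def pushP : Program :=
  .seq (.setNat (.const 16) (reg 15))
    (.branch (.realLE (get 0 (reg 12)) (.cast (succE (reg 12))))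
      (.seq (.setReal (entry 2 (reg 15)) (.cast (reg 13)))
        (.seq (.setReal (entry 3 (reg 15)) (get 1 (reg 12)))
          (.setNat (.const 15) (succE (reg 15)))))
      .skip)

/-- The reached part of the upper edge of the current cell, without regard to its end. -/
def upperP (k : ℕ) : Program :=
  .branch (.natLE (succE (reg 14)) (reg 16))
    (.seq (.setReal (entry 0 (reg 12)) (hlE k (reg 12) (succE (reg 13))))
      (.setReal (entry 1 (reg 12)) (get 3 (reg 14))))
    (.setReal (entry 0 (reg 12))
      (.max (get 0 (reg 12)) (hlE k (reg 12) (succE (reg 13)))))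

/-- Mark the upper edge of the current cell if it is not reached. -/
def clearP (k : ℕ) : Program :=
  .branch (.realLE (get 0 (reg 12)) (hrE k (reg 12) (succE (reg 13)))) .skip
    (.setReal (entry 0 (reg 12)) (.cast (succE (succE (reg 12)))))

/-- The condition for the removal of the first entry of the queue. -/
def frontC (k : ℕ) : Cond :=
  .and (.natLE (succE (reg 14)) (reg 15))
    (.neg (.realLE (get 2 (reg 14)) (vhE k (succE (reg 12)) (reg 13))))

/-- The removal of the first entry of the queue. -/
def frontP : Program := .setNat (.const 14) (succE (reg 14))

/-- Bound the label of the first entry of the queue. -/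
def capP (k : ℕ) : Program :=
  .branch (.natLE (succE (reg 14)) (reg 15))
    (.setReal (entry 3 (reg 14)) (.min (get 3 (reg 14)) (vhE k (succE (reg 12)) (reg 13)))) .skip

/-- The condition for the removal of the last entry of the queue. -/
def backC (k : ℕ) : Cond :=
  .and (.natLE (succE (succE (reg 14))) (reg 15))
    (.realLE (get 2 (.sub (reg 15) (.const 2))) (vlE k (succE (reg 12)) (reg 13)))

/-- The removal of the last entry of the queue. -/
def backP : Program := .setNat (.const 15) (.sub (reg 15) (.const 1))

/-- Move the last entry of the queue into the free interval. -/
def raiseP (k : ℕ) : Program :=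
  .branch (.and (.natLE (succE (reg 14)) (reg 15))
      (.realLE (get 2 (.sub (reg 15) (.const 1))) (vlE k (succE (reg 12)) (reg 13))))
    (.setReal (entry 2 (.sub (reg 15) (.const 1))) (vlE k (succE (reg 12)) (reg 13))) .skip

/-- The passage through the current cell. -/
def cellP (k : ℕ) : Program :=
  .seq pushP (.seq (upperP k) (.seq (clearP k) (.seq (.loop (frontC k) frontP)
    (.seq (capP k) (.seq (.loop (backC k) backP) (raiseP k))))))

/-- Go to the next column. -/
def nextColumnP : Program := .setNat (.const 12) (succE (reg 12))

/-- Prepare the queue for the current row. -/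
def startRowP (k : ℕ) : Program :=
  .seq (.setNat (.const 14) (reg 15))
    (.seq (.branch (.and (.natLE (succE (reg 13)) (reg 9))
        (.realLE (vlE k (.const 0) (reg 13)) (vhE k (.const 0) (reg 13))))
      (.seq (.setReal (entry 2 (reg 15)) (vlE k (.const 0) (reg 13)))
        (.seq (.setReal (entry 3 (reg 15)) (vhE k (.const 0) (reg 13)))
          (.setNat (.const 15) (succE (reg 15)))))
      .skip) (.setNat (.const 12) (.const 0)))

/-- Record the queue and go to the next row. -/
def nextRowP : Program :=
  .seq (.setNat (.add (.const 20) (.mul (.const 2) (reg 13))) (reg 14))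
    (.seq (.setNat (.add (.const 21) (.mul (.const 2) (reg 13))) (reg 15))
      (.setNat (.const 13) (succE (reg 13))))

/-- There are further columns. -/
def columnC : Cond := .natLE (succE (reg 12)) (reg 6)

/-- There are further rows. -/
def rowC : Cond := .natLE (succE (reg 13)) (reg 7)

/-- The sweep through a row. -/
def rowP (k : ℕ) : Program :=
  .seq (startRowP k) (.seq (.loop columnC (.seq (cellP k) nextColumnP)) nextRowP)

/-- Initialize the data of a horizontal edge on the lower side. -/
def startEdgeP (k : ℕ) : Program :=
  .seq (.branch (.and (.natLE (succE (reg 12)) (reg 10))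
      (.realLE (hlE k (reg 12) (.const 0)) (hrE k (reg 12) (.const 0))))
    (.seq (.setReal (entry 0 (reg 12)) (hlE k (reg 12) (.const 0)))
      (.setReal (entry 1 (reg 12)) (.sub (.const 0) (hlE k (reg 12) (.const 0)))))
    (.setReal (entry 0 (reg 12)) (.cast (succE (succE (reg 12)))))) nextColumnP

/-- The whole sweep. -/
def sweepP (k : ℕ) : Program :=
  .seq (.setNat (.const 12) (.const 0)) (.seq (.loop columnC (startEdgeP k))
    (.seq (.seq (.setNat (.const 13) (.const 0)) (.setNat (.const 15) (.const 0)))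
      (.loop rowC (rowP k))))

/-! ### The values of the expressions -/

@[simp] theorem eval_reg (s : Store) (a : ℕ) : (reg a).eval s = s.nat a := rfl

@[simp] theorem eval_succE (s : Store) (e : NExpr) : (succE e).eval s = e.eval s + 1 := rfl

@[simp] theorem eval_entry (s : Store) (c : ℕ) (e : NExpr) :
    (entry c e).eval s = s.nat 11 + 4 * e.eval s + c := rfl

@[simp] theorem eval_get (s : Store) (c : ℕ) (e : NExpr) :
    (get c e).eval s = s.real (s.nat 11 + 4 * e.eval s + c) := rfl

@[simp] theorem Store.setNat_nat (s : Store) (a v b : ℕ) :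
    (s.setNat a v).nat b = if b = a then v else s.nat b := by
  simp [Store.setNat, Function.update_apply]

@[simp] theorem Store.setNat_real (s : Store) (a v : ℕ) : (s.setNat a v).real = s.real := rfl

@[simp] theorem Store.setReal_nat (s : Store) (a : ℕ) (v : ℝ) : (s.setReal a v).nat = s.nat := rfl

@[simp] theorem Store.setReal_real (s : Store) (a : ℕ) (v : ℝ) (b : ℕ) :
    (s.setReal a v).real b = if b = a then v else s.real b := by
  simp [Store.setReal, Function.update_apply]

theorem eval_segLoE (s : Store) (a b c : RExpr) :
    (segLoE a b c).eval s = segLo (a.eval s) (b.eval s) (c.eval s) := by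
  simp [segLoE, segLo, segEmptyE, segEmpty, segMinE, segMin, rootE, RExpr.eval]

theorem eval_segHiE (s : Store) (a b c : RExpr) :
    (segHiE a b c).eval s = segHi (a.eval s) (b.eval s) (c.eval s) := by
  simp [segHiE, segHi, segEmptyE, segEmpty, segMinE, segMin, rootE, RExpr.eval]

theorem eval_innerE {k : ℕ} (s : Store) {x y z w : ℕ → RExpr}
    {x' y' z' w' : EuclideanSpace ℝ (Fin k)}
    (hx : ∀ c : Fin k, (x c).eval s = x' c) (hy : ∀ c : Fin k, (y c).eval s = y' c)
    (hz : ∀ c : Fin k, (z c).eval s = z' c) (hw : ∀ c : Fin k, (w c).eval s = w' c) :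
    (innerE k x y z w).eval s = inner ℝ (x' - y') (z' - w') := by
  rw [innerE, RExpr.eval_sum, Finset.sum_range, PiLp.inner_apply]
  refine Finset.sum_congr rfl fun c _ => ?_
  simp [RExpr.eval, hx, hy, hz, hw, mul_comm]

theorem eval_freeLoE {k : ℕ} (s : Store) {x y z : ℕ → RExpr} {x' y' z' : EuclideanSpace ℝ (Fin k)}
    (hx : ∀ c : Fin k, (x c).eval s = x' c) (hy : ∀ c : Fin k, (y c).eval s = y' c)
    (hz : ∀ c : Fin k, (z c).eval s = z' c) :
    (freeLoE k x y z).eval s = freeLo (s.real 0) x' y' z' := by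
  rw [freeLoE, eval_segLoE, RExpr.eval, eval_innerE s hz hy hz hy, eval_innerE s hx hy hz hy,
    eval_innerE s hx hy hx hy, freeLo, real_inner_self_eq_norm_sq, real_inner_self_eq_norm_sq,
    sq (s.real 0)]
  rfl

theorem eval_freeHiE {k : ℕ} (s : Store) {x y z : ℕ → RExpr} {x' y' z' : EuclideanSpace ℝ (Fin k)}
    (hx : ∀ c : Fin k, (x c).eval s = x' c) (hy : ∀ c : Fin k, (y c).eval s = y' c)
    (hz : ∀ c : Fin k, (z c).eval s = z' c) :
    (freeHiE k x y z).eval s = freeHi (s.real 0) x' y' z' := by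
  rw [freeHiE, eval_segHiE, RExpr.eval, eval_innerE s hz hy hz hy, eval_innerE s hx hy hz hy,
    eval_innerE s hx hy hx hy, freeHi, real_inner_self_eq_norm_sq, real_inner_self_eq_norm_sq,
    sq (s.real 0)]
  rfl

/-- The number of a vertex in the input, as computed by `wrap` and `directed`. -/
def vertexIndex (l len rev i : ℕ) : ℕ :=
  let r := i * (1 - rev) + (len - i) * rev
  r - l * (1 - (l - r)) - l * (1 - (2 * l - r))

/-- The address of a coordinate of a vertex on the horizontal axis. -/
def addrP (k : ℕ) (s : Store) (i c : ℕ) : ℕ :=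
  s.nat 2 + (k * vertexIndex (s.nat 3) (s.nat 6) (s.nat 8) i + c)

/-- The address of a coordinate of a vertex on the vertical axis. -/
def addrQ (k : ℕ) (s : Store) (j c : ℕ) : ℕ :=
  s.nat 4 + (k * vertexIndex (s.nat 5) (s.nat 7) (s.nat 8) j + c)

/-- The registers and the input describe two chains, and the arrays of the sweep lie behind the
input. -/
structure Ctx {k : ℕ} (p q : ℕ → EuclideanSpace ℝ (Fin k)) (ε : ℝ) (M N SL SB : ℕ)
    (s : Store) : Prop where
  columns : s.nat 6 = M
  rows : s.nat 7 = N
  left : s.nat 9 = SL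
  lower : s.nat 10 = SB
  pos : 0 < s.nat 11
  radius : s.real 0 = ε
  chainP : ∀ i ≤ M, ∀ c : Fin k, addrP k s i c < s.nat 11 ∧ s.real (addrP k s i c) = p i c
  chainQ : ∀ j ≤ N, ∀ c : Fin k, addrQ k s j c < s.nat 11 ∧ s.real (addrQ k s j c) = q j c

/-- Two memories agree outside the working storage. -/
structure Agree (s s' : Store) : Prop where
  nat : ∀ a < 12, s'.nat a = s.nat a
  real : ∀ a < s.nat 11, s'.real a = s.real a

theorem Agree.trans {s s' s'' : Store} (h : Agree s s') (h' : Agree s' s'') : Agree s s'' :=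
  ⟨fun a ha => (h'.nat a ha).trans (h.nat a ha),
    fun a ha => (h'.real a (by rwa [h.nat 11 (by norm_num)])).trans (h.real a ha)⟩

variable {k : ℕ} {p q : ℕ → EuclideanSpace ℝ (Fin k)} {ε : ℝ} {M N SL SB : ℕ} {s s' s'' : Store}

/-- All coordinates are stored below the beginning `s.nat 11` of the arrays, and their addresses
depend on registers below 12 only; the work of a sweep changes neither. -/
theorem Ctx.congr (h : Ctx p q ε M N SL SB s) (ha : Agree s s') : Ctx p q ε M N SL SB s' := by
  have e := ha.nat
  have eP : ∀ i c, addrP k s' i c = addrP k s i c := fun i c => by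
    simp [addrP, e 2, e 3, e 6, e 8]
  have eQ : ∀ i c, addrQ k s' i c = addrQ k s i c := fun i c => by
    simp [addrQ, e 4, e 5, e 7, e 8]
  refine ⟨by rw [e 6 (by norm_num), h.columns], by rw [e 7 (by norm_num), h.rows],
    by rw [e 9 (by norm_num), h.left], by rw [e 10 (by norm_num), h.lower],
    by rw [e 11 (by norm_num)]; exact h.pos, by rw [ha.real 0 h.pos, h.radius], ?_, ?_⟩
  · intro i hi c
    obtain ⟨h1, h2⟩ := h.chainP i hi c
    rw [eP, e 11 (by norm_num), ha.real _ h1]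
    exact ⟨h1, h2⟩
  · intro i hi c
    obtain ⟨h1, h2⟩ := h.chainQ i hi c
    rw [eQ, e 11 (by norm_num), ha.real _ h1]
    exact ⟨h1, h2⟩

theorem Ctx.eval_coordP (h : Ctx p q ε M N SL SB s) {i : NExpr} (hi : i.eval s ≤ M) (c : Fin k) :
    (coordP k i c).eval s = p (i.eval s) c := (h.chainP _ hi c).2

theorem Ctx.eval_coordQ (h : Ctx p q ε M N SL SB s) {j : NExpr} (hj : j.eval s ≤ N) (c : Fin k) :
    (coordQ k j c).eval s = q (j.eval s) c := (h.chainQ _ hj c).2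

theorem Ctx.eval_vlE (h : Ctx p q ε M N SL SB s) {i j : NExpr} (hi : i.eval s ≤ M)
    (hj : j.eval s < N) :
    (vlE k i j).eval s = (chainGrid p q ε SL SB).VL (i.eval s) (j.eval s) := by
  rw [vlE, RExpr.eval, eval_freeLoE s (h.eval_coordP hi) (h.eval_coordQ hj.le)
    (h.eval_coordQ (j := succE j) hj), h.radius]
  rfl

theorem Ctx.eval_vhE (h : Ctx p q ε M N SL SB s) {i j : NExpr} (hi : i.eval s ≤ M)
    (hj : j.eval s < N) :
    (vhE k i j).eval s = (chainGrid p q ε SL SB).VH (i.eval s) (j.eval s) := by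
  rw [vhE, RExpr.eval, eval_freeHiE s (h.eval_coordP hi) (h.eval_coordQ hj.le)
    (h.eval_coordQ (j := succE j) hj), h.radius]
  rfl

theorem Ctx.eval_hlE (h : Ctx p q ε M N SL SB s) {i j : NExpr} (hi : i.eval s < M)
    (hj : j.eval s ≤ N) :
    (hlE k i j).eval s = (chainGrid p q ε SL SB).HL (i.eval s) (j.eval s) := by
  rw [hlE, RExpr.eval, eval_freeLoE s (h.eval_coordQ hj) (h.eval_coordP hi.le)
    (h.eval_coordP (i := succE i) hi), h.radius]
  rfl

theorem Ctx.eval_hrE (h : Ctx p q ε M N SL SB s) {i j : NExpr} (hi : i.eval s < M)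
    (hj : j.eval s ≤ N) :
    (hrE k i j).eval s = (chainGrid p q ε SL SB).HR (i.eval s) (j.eval s) := by
  rw [hrE, RExpr.eval, eval_freeHiE s (h.eval_coordQ hj) (h.eval_coordP hi.le)
    (h.eval_coordP (i := succE i) hi), h.radius]
  rfl

/-! ### The data of the sweep in the memory -/

/-- The data of the sweep. -/
def st (s : Store) : Grid.State where
  bp e := s.real (s.nat 11 + 4 * e + 0)
  bv e := s.real (s.nat 11 + 4 * e + 1)
  dp e := s.real (s.nat 11 + 4 * e + 2)
  dv e := s.real (s.nat 11 + 4 * e + 3)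
  H := s.nat 14
  T := s.nat 15

/-- The four arrays are interleaved: entries have stride 4 and the arrays have the offsets 0 to 3,
so all of them can grow without colliding. -/
theorem st_setReal_bp (s : Store) (e : ℕ) (v : ℝ) :
    st (s.setReal (s.nat 11 + 4 * e + 0) v) =
      { st s with bp := Function.update (st s).bp e v } := by
  simp only [st, Store.setReal_nat, Store.setReal_real, Grid.State.mk.injEq, and_true]
  refine ⟨?_, ?_, ?_, ?_⟩ <;> funext e'
  · rw [Function.update_apply]; congr 1; exact propext (by omega)
  all_goals exact if_neg (by omega)

theorem st_setReal_bv (s : Store) (e : ℕ) (v : ℝ) :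
    st (s.setReal (s.nat 11 + 4 * e + 1) v) =
      { st s with bv := Function.update (st s).bv e v } := by
  simp only [st, Store.setReal_nat, Store.setReal_real, Grid.State.mk.injEq, and_true]
  refine ⟨?_, ?_, ?_, ?_⟩ <;> funext e'
  on_goal 2 => rw [Function.update_apply]; congr 1; exact propext (by omega)
  all_goals exact if_neg (by omega)

theorem st_setReal_dp (s : Store) (e : ℕ) (v : ℝ) :
    st (s.setReal (s.nat 11 + 4 * e + 2) v) =
      { st s with dp := Function.update (st s).dp e v } := by
  simp only [st, Store.setReal_nat, Store.setReal_real, Grid.State.mk.injEq, and_true]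
  refine ⟨?_, ?_, ?_, ?_⟩ <;> funext e'
  on_goal 3 => rw [Function.update_apply]; congr 1; exact propext (by omega)
  all_goals exact if_neg (by omega)

theorem st_setReal_dv (s : Store) (e : ℕ) (v : ℝ) :
    st (s.setReal (s.nat 11 + 4 * e + 3) v) =
      { st s with dv := Function.update (st s).dv e v } := by
  simp only [st, Store.setReal_nat, Store.setReal_real, Grid.State.mk.injEq, and_true]
  refine ⟨?_, ?_, ?_, ?_⟩ <;> funext e'
  on_goal 4 => rw [Function.update_apply]; congr 1; exact propext (by omega)
  all_goals exact if_neg (by omega)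

theorem st_setNat (s : Store) {a : ℕ} (v : ℕ) (h : a ≠ 11) (h1 : a ≠ 14) (h2 : a ≠ 15) :
    st (s.setNat a v) = st s := by
  simp [st, h.symm, h1.symm, h2.symm]

theorem st_setNat_head (s : Store) (v : ℕ) : st (s.setNat 14 v) = { st s with H := v } := by
  simp [st]

theorem st_setNat_tail (s : Store) (v : ℕ) : st (s.setNat 15 v) = { st s with T := v } := by
  simp [st]

/-- What the passage through a part of a row leaves unchanged; the entries of the queue below `R`
belong to other rows. -/
structure Frame (R : ℕ) (s s' : Store) : Prop where
  nat : ∀ a, a ≠ 12 → a ≠ 14 → a ≠ 15 → a ≠ 16 → s'.nat a = s.nat a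
  real : ∀ a < s.nat 11, s'.real a = s.real a
  dp : ∀ e < R, (st s').dp e = (st s).dp e
  dv : ∀ e < R, (st s').dv e = (st s).dv e

namespace Frame

variable {R e : ℕ} {v : ℝ}

theorem trans (h : Frame R s s') (h' : Frame R s' s'') : Frame R s s'' where
  nat a h1 h2 h3 h4 := (h'.nat a h1 h2 h3 h4).trans (h.nat a h1 h2 h3 h4)
  real a ha := (h'.real a (by rwa [h.nat 11 (by decide) (by decide) (by decide) (by decide)])).trans
    (h.real a ha)
  dp e he := (h'.dp e he).trans (h.dp e he)
  dv e he := (h'.dv e he).trans (h.dv e he)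

theorem agree (h : Frame R s s') : Agree s s' :=
  ⟨fun a ha => h.nat a (by omega) (by omega) (by omega) (by omega), h.real⟩

theorem row (h : Frame R s s') : s'.nat 13 = s.nat 13 :=
  h.nat 13 (by decide) (by decide) (by decide) (by decide)

theorem setNat {a : ℕ} (ha : a = 12 ∨ a = 14 ∨ a = 15 ∨ a = 16) (v : ℕ) :
    Frame R s (s.setNat a v) where
  nat b h1 h2 h3 h4 := by rw [Store.setNat_nat, if_neg (by omega)]
  real b _ := rfl
  dp e _ := by simp only [st, Store.setNat_nat, Store.setNat_real]; rw [if_neg (by omega)]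
  dv e _ := by simp only [st, Store.setNat_nat, Store.setNat_real]; rw [if_neg (by omega)]

theorem setReal_bp : Frame R s (s.setReal (s.nat 11 + 4 * e + 0) v) where
  nat b _ _ _ _ := rfl
  real b hb := by rw [Store.setReal_real, if_neg (by omega)]
  dp e' _ := by rw [st_setReal_bp]
  dv e' _ := by rw [st_setReal_bp]

theorem setReal_bv : Frame R s (s.setReal (s.nat 11 + 4 * e + 1) v) where
  nat b _ _ _ _ := rfl
  real b hb := by rw [Store.setReal_real, if_neg (by omega)]
  dp e' _ := by rw [st_setReal_bv]
  dv e' _ := by rw [st_setReal_bv]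

theorem setReal_dp (h : R ≤ e) : Frame R s (s.setReal (s.nat 11 + 4 * e + 2) v) where
  nat b _ _ _ _ := rfl
  real b hb := by rw [Store.setReal_real, if_neg (by omega)]
  dp e' he := by rw [st_setReal_dp]; exact Function.update_of_ne (by omega) _ _
  dv e' _ := by rw [st_setReal_dp]

theorem setReal_dv (h : R ≤ e) : Frame R s (s.setReal (s.nat 11 + 4 * e + 3) v) where
  nat b _ _ _ _ := rfl
  real b hb := by rw [Store.setReal_real, if_neg (by omega)]
  dp e' _ := by rw [st_setReal_dv]
  dv e' he := by rw [st_setReal_dv]; exact Function.update_of_ne (by omega) _ _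

end Frame

end RealRAM

namespace RealRAM

variable {k : ℕ} {p q : ℕ → EuclideanSpace ℝ (Fin k)} {ε : ℝ} {M N SL SB : ℕ} {s s' s'' : Store}

/-! ### The passage through a cell -/

/-- The program is in the cell `(i, j)`; since the memory was `s₀`, it has only changed data of
the row `j`, whose entries in the queue start at `R`. -/
structure InCell (p q : ℕ → EuclideanSpace ℝ (Fin k)) (ε : ℝ) (M N SL SB R : ℕ) (s₀ : Store)
    (i j : ℕ) (s : Store) : Prop where
  ctx : Ctx p q ε M N SL SB s
  column : s.nat 12 = i
  row : s.nat 13 = j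
  lt_columns : i < M
  lt_rows : j < N
  head : R ≤ s.nat 14
  frame : Frame R s₀ s

variable {R i j : ℕ} {s₀ : Store}

theorem InCell.step (h : InCell p q ε M N SL SB R s₀ i j s) (hf : Frame R s s')
    (hc : s'.nat 12 = s.nat 12) (hh : R ≤ s'.nat 14) : InCell p q ε M N SL SB R s₀ i j s' :=
  ⟨h.ctx.congr hf.agree, hc.trans h.column, hf.row.trans h.row, h.lt_columns, h.lt_rows, hh,
    h.frame.trans hf⟩

theorem InCell.setReal_bp (h : InCell p q ε M N SL SB R s₀ i j s) (e : ℕ) (v : ℝ) :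
    InCell p q ε M N SL SB R s₀ i j (s.setReal (s.nat 11 + 4 * e + 0) v) :=
  h.step .setReal_bp rfl h.head

theorem InCell.setReal_bv (h : InCell p q ε M N SL SB R s₀ i j s) (e : ℕ) (v : ℝ) :
    InCell p q ε M N SL SB R s₀ i j (s.setReal (s.nat 11 + 4 * e + 1) v) :=
  h.step .setReal_bv rfl h.head

theorem InCell.setReal_dp (h : InCell p q ε M N SL SB R s₀ i j s) {e : ℕ} (he : R ≤ e) (v : ℝ) :
    InCell p q ε M N SL SB R s₀ i j (s.setReal (s.nat 11 + 4 * e + 2) v) :=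
  h.step (.setReal_dp he) rfl h.head

theorem InCell.setReal_dv (h : InCell p q ε M N SL SB R s₀ i j s) {e : ℕ} (he : R ≤ e) (v : ℝ) :
    InCell p q ε M N SL SB R s₀ i j (s.setReal (s.nat 11 + 4 * e + 3) v) :=
  h.step (.setReal_dv he) rfl h.head

theorem InCell.setNat_head (h : InCell p q ε M N SL SB R s₀ i j s) {v : ℕ} (hv : R ≤ v) :
    InCell p q ε M N SL SB R s₀ i j (s.setNat 14 v) :=
  h.step (.setNat (by simp) v) (by simp) (by simpa using hv)

theorem InCell.setNat_tail (h : InCell p q ε M N SL SB R s₀ i j s) (v : ℕ) :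
    InCell p q ε M N SL SB R s₀ i j (s.setNat 15 v) :=
  h.step (.setNat (by simp) v) (by simp) (by simpa using h.head)

theorem InCell.setNat_mark (h : InCell p q ε M N SL SB R s₀ i j s) (v : ℕ) :
    InCell p q ε M N SL SB R s₀ i j (s.setNat 16 v) :=
  h.step (.setNat (by simp) v) (by simp) (by simpa using h.head)

/-- Register 16 keeps the tail from before the push; afterwards it tells whether the left edge had
reached points, which the queue itself no longer shows. -/
theorem InCell.exec_pushP (h : InCell p q ε M N SL SB R s₀ i j s) (hT : s.nat 14 ≤ s.nat 15) :
    InCell p q ε M N SL SB R s₀ i j (pushP.exec s) ∧ st (pushP.exec s) = (st s).push i j ∧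
      (pushP.exec s).nat 16 = s.nat 15 := by
  have hR : R ≤ s.nat 15 := h.head.trans hT
  obtain ⟨s₁, hs₁⟩ : ∃ s₁, s₁ = s.setNat 16 (s.nat 15) := ⟨_, rfl⟩
  have h₁ : InCell p q ε M N SL SB R s₀ i j s₁ := hs₁ ▸ h.setNat_mark _
  have e₁ : st s₁ = st s := hs₁ ▸ st_setNat s _ (by decide) (by decide) (by decide)
  have e15 : s₁.nat 15 = s.nat 15 := by simp [hs₁]
  have e16 : s₁.nat 16 = s.nat 15 := by simp [hs₁]
  have hb : s₁.real (s₁.nat 11 + 4 * i + 0) = (st s).bp i := by rw [← e₁]; rfl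
  have hv : (s₁.setReal (s₁.nat 11 + 4 * s.nat 15 + 2) (j : ℝ)).real (s₁.nat 11 + 4 * i + 1) =
      (st s).bv i := by
    rw [Store.setReal_real, if_neg (by omega), ← e₁]; rfl
  have he : pushP.exec s = if (st s).bp i ≤ i + 1 then
      ((s₁.setReal (s₁.nat 11 + 4 * s.nat 15 + 2) j).setReal
        (s₁.nat 11 + 4 * s.nat 15 + 3) ((st s).bv i)).setNat 15 (s.nat 15 + 1) else s₁ := by
    rw [pushP, Program.exec,
      show (Program.setNat (.const 16) (reg 15)).exec s = s₁ from hs₁.symm]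
    simp only [Program.exec, Cond.Holds, RExpr.eval, eval_get, eval_entry, eval_reg, eval_succE,
      NExpr.eval]
    simp only [Store.setReal_nat, h₁.column, h₁.row, e15, hb, Nat.cast_add, Nat.cast_one, hv]
  rw [he, Grid.State.push]
  split_ifs with hc
  · refine ⟨((h₁.setReal_dp hR _).setReal_dv hR _).setNat_tail _, ?_, by simp [e16]⟩
    rw [st_setNat_tail]
    have := st_setReal_dv (s₁.setReal (s₁.nat 11 + 4 * s.nat 15 + 2) (j : ℝ)) (s.nat 15)
      ((st s).bv i)
    rw [Store.setReal_nat] at this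
    rw [this, st_setReal_dp, e₁]
    rfl
  · exact ⟨h₁, e₁, e16⟩

theorem InCell.exec_upperP (h : InCell p q ε M N SL SB R s₀ i j s) :
    InCell p q ε M N SL SB R s₀ i j ((Program.seq (upperP k) (clearP k)).exec s) ∧
    st ((Program.seq (upperP k) (clearP k)).exec s) =
      (st s).upper (chainGrid p q ε SL SB) i j (s.nat 16) := by
  have key : InCell p q ε M N SL SB R s₀ i j ((upperP k).exec s) ∧
      st ((upperP k).exec s) = if (st s).H + 1 ≤ s.nat 16 then
        { st s with
          bp := Function.update (st s).bp i ((chainGrid p q ε SL SB).HL i (j + 1))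
          bv := Function.update (st s).bv i ((st s).dv (st s).H) }
      else { st s with
        bp := Function.update (st s).bp i
                (max ((st s).bp i) ((chainGrid p q ε SL SB).HL i (j + 1))) } := by
    have hl := h.ctx.eval_hlE (i := reg 12) (j := succE (reg 13))
      (by simpa [h.column] using h.lt_columns) (by simpa [h.row] using h.lt_rows)
    simp only [eval_reg, eval_succE, h.column, h.row] at hl
    simp only [upperP, Program.exec, Cond.Holds, eval_get, eval_entry, eval_reg, eval_succE, hl,
      RExpr.eval_max, Store.setReal_nat, h.column]
    by_cases hc : s.nat 14 + 1 ≤ s.nat 16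
    · rw [if_pos hc, if_pos (show (st s).H + 1 ≤ s.nat 16 from hc)]
      refine ⟨(h.setReal_bp i _).setReal_bv i _, ?_⟩
      have := st_setReal_bv (s.setReal (s.nat 11 + 4 * i + 0)
        ((chainGrid p q ε SL SB).HL i (j + 1))) i
      rw [Store.setReal_nat] at this
      rw [this, st_setReal_bp, Store.setReal_real, if_neg (by omega)]
      rfl
    · rw [if_neg hc, if_neg (show ¬ (st s).H + 1 ≤ s.nat 16 from hc)]
      refine ⟨h.setReal_bp i _, ?_⟩
      rw [st_setReal_bp]
      rfl
  rw [Program.exec, Grid.State.upper]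
  rw [← key.2]
  generalize (upperP k).exec s = s₁ at key
  obtain ⟨h, -⟩ := key
  have hr := h.ctx.eval_hrE (i := reg 12) (j := succE (reg 13))
    (by simpa [h.column] using h.lt_columns) (by simpa [h.row] using h.lt_rows)
  simp only [eval_reg, eval_succE, h.column, h.row] at hr
  simp only [clearP, Program.exec, Cond.Holds, eval_get, eval_entry, eval_reg, eval_succE, hr,
    RExpr.eval, h.column]
  by_cases hc : s₁.real (s₁.nat 11 + 4 * i + 0) ≤ (chainGrid p q ε SL SB).HR i (j + 1)
  · rw [if_pos hc, if_pos (show (st s₁).bp i ≤ _ from hc)]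
    exact ⟨h, rfl⟩
  · rw [if_neg hc, if_neg (show ¬ (st s₁).bp i ≤ _ from hc)]
    refine ⟨h.setReal_bp i _, ?_⟩
    rw [st_setReal_bp]
    push_cast
    rw [add_assoc, one_add_one_eq_two]

theorem InCell.eval_vhE (h : InCell p q ε M N SL SB R s₀ i j s) :
    (vhE k (succE (reg 12)) (reg 13)).eval s = (chainGrid p q ε SL SB).VH (i + 1) j := by
  have := h.ctx.eval_vhE (i := succE (reg 12)) (j := reg 13)
    (by simpa [h.column] using h.lt_columns) (by simpa [h.row] using h.lt_rows)
  simpa only [eval_reg, eval_succE, h.column, h.row] using this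

theorem InCell.eval_vlE (h : InCell p q ε M N SL SB R s₀ i j s) :
    (vlE k (succE (reg 12)) (reg 13)).eval s = (chainGrid p q ε SL SB).VL (i + 1) j := by
  have := h.ctx.eval_vlE (i := succE (reg 12)) (j := reg 13)
    (by simpa [h.column] using h.lt_columns) (by simpa [h.row] using h.lt_rows)
  simpa only [eval_reg, eval_succE, h.column, h.row] using this

theorem InCell.exec_capP (h : InCell p q ε M N SL SB R s₀ i j s) :
    InCell p q ε M N SL SB R s₀ i j ((capP k).exec s) ∧
    st ((capP k).exec s) = if (st s).H < (st s).T then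
      { st s with
        dv := Function.update (st s).dv (st s).H
                (min ((st s).dv (st s).H) ((chainGrid p q ε SL SB).VH (i + 1) j)) }
      else st s := by
  simp only [capP, Program.exec, Cond.Holds, eval_get, eval_entry, eval_reg, eval_succE,
    RExpr.eval_min, h.eval_vhE]
  by_cases hc : s.nat 14 + 1 ≤ s.nat 15
  · rw [if_pos hc, if_pos (show (st s).H < (st s).T from hc)]
    exact ⟨h.setReal_dv h.head _, st_setReal_dv _ _ _⟩
  · rw [if_neg hc, if_neg (show ¬ (st s).H < (st s).T from hc)]
    exact ⟨h, rfl⟩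

theorem InCell.exec_raiseP (h : InCell p q ε M N SL SB R s₀ i j s) :
    InCell p q ε M N SL SB R s₀ i j ((raiseP k).exec s) ∧
    st ((raiseP k).exec s) = (st s).raise ((chainGrid p q ε SL SB).VL (i + 1) j) := by
  simp only [raiseP, Program.exec, Cond.Holds, eval_get, eval_entry, eval_reg, eval_succE,
    NExpr.eval, h.eval_vlE]
  rw [Grid.State.raise]
  have hh := h.head
  by_cases hc : s.nat 14 + 1 ≤ s.nat 15 ∧ s.real (s.nat 11 + 4 * (s.nat 15 - 1) + 2) ≤
      (chainGrid p q ε SL SB).VL (i + 1) j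
  · rw [if_pos hc, if_pos (show (st s).H + 1 ≤ (st s).T ∧ (st s).dp ((st s).T - 1) ≤ _ from hc)]
    exact ⟨h.setReal_dp (by omega) _, st_setReal_dp _ _ _⟩
  · rw [if_neg hc,
      if_neg (show ¬ ((st s).H + 1 ≤ (st s).T ∧ (st s).dp ((st s).T - 1) ≤ _) from hc)]
    exact ⟨h, rfl⟩

/-! ### Amortized time of a cell -/

/-- A bound for the time of the removal of an entry of the queue. -/
def popCost (k : ℕ) : ℕ :=
  ((frontC k).cost + 1 + frontP.bound) + ((backC k).cost + 1 + backP.bound)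

theorem front_le_popCost (k : ℕ) : (frontC k).cost + 1 + frontP.bound ≤ popCost k :=
  Nat.le_add_right _ _

theorem back_le_popCost (k : ℕ) : (backC k).cost + 1 + backP.bound ≤ popCost k :=
  Nat.le_add_left _ _

theorem popCost_mul_succ (k l : ℕ) : popCost k * (l + 1) = popCost k * l + popCost k :=
  Nat.mul_succ _ _

/-- A removal shortens the queue by one, and the drop of the potential `popCost k * (T - H)` pays
for it. Only the last, failing test needs extra time; `d` is the credit reserved for what follows.
-/
theorem InCell.wp_popFront (h : InCell p q ε M N SL SB R s₀ i j s)
    (hM : (chainGrid p q ε SL SB).MidInv M j i (st s)) {c d : ℕ}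
    (hc : popCost k * (s.nat 15 - s.nat 14) + ((frontC k).cost + 1) + d ≤ c) :
    WP (.loop (frontC k) frontP) s c fun s' c' => InCell p q ε M N SL SB R s₀ i j s' ∧
      (chainGrid p q ε SL SB).MidInv M j i (st s') ∧
      ((st s').H < (st s').T → (st s').dp (st s').H ≤ (chainGrid p q ε SL SB).VH (i + 1) j) ∧
      s'.nat 15 - s'.nat 14 ≤ s.nat 15 - s.nat 14 ∧
      popCost k * (s'.nat 15 - s'.nat 14) + d ≤ c' := by
  refine WP.loop (fun s' c' => InCell p q ε M N SL SB R s₀ i j s' ∧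
      (chainGrid p q ε SL SB).MidInv M j i (st s') ∧ s'.nat 15 - s'.nat 14 ≤ s.nat 15 - s.nat 14 ∧
      popCost k * (s'.nat 15 - s'.nat 14) + ((frontC k).cost + 1) + d ≤ c') ?_ ⟨h, hM, le_rfl, hc⟩
  rintro s' c' ⟨h', hM', hl, hc'⟩
  refine ⟨c' - ((frontC k).cost + 1), by omega, ?_, ?_⟩
  · rintro ⟨hb1, hb2⟩
    simp only [Cond.Holds, eval_reg, eval_succE, eval_get, h'.eval_vhE] at hb1 hb2
    have e : s'.nat 15 - s'.nat 14 = s'.nat 15 - (s'.nat 14 + 1) + 1 := by omega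
    rw [e, popCost_mul_succ] at hc'
    have hk := front_le_popCost k
    have ex : frontP.exec s' = s'.setNat 14 (s'.nat 14 + 1) := rfl
    refine WP.loopFree (by simp [frontP, Program.LoopFree])
      (c' - ((frontC k).cost + 1) - frontP.bound) (by omega) ?_
    rw [ex]
    have n15 : (s'.setNat 14 (s'.nat 14 + 1)).nat 15 = s'.nat 15 := by simp
    have n14 : (s'.setNat 14 (s'.nat 14 + 1)).nat 14 = s'.nat 14 + 1 := by simp
    refine ⟨h'.setNat_head (Nat.le_succ_of_le h'.head), ?_, ?_, ?_⟩
    · rw [st_setNat_head]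
      exact hM'.popFront hb1 hb2
    · rw [n15, n14]; omega
    · rw [n15, n14]; omega
  · intro hb
    refine ⟨h', hM', fun hL => ?_, hl, by omega⟩
    by_contra hp
    refine hb ⟨hL, ?_⟩
    simp only [Cond.Holds, eval_reg, eval_get, h'.eval_vhE]
    exact hp

/-- The potential pays as at the front. Contents and head stay as they are, so the upper bounds by
`VH` that were established before remain valid. -/
theorem InCell.wp_popBack (h : InCell p q ε M N SL SB R s₀ i j s)
    (hM : (chainGrid p q ε SL SB).MidInv M j i (st s)) {c d : ℕ}
    (hc : popCost k * (s.nat 15 - s.nat 14) + ((backC k).cost + 1) + d ≤ c) :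
    WP (.loop (backC k) backP) s c fun s' c' => InCell p q ε M N SL SB R s₀ i j s' ∧
      (chainGrid p q ε SL SB).MidInv M j i (st s') ∧
      ((st s').H + 2 ≤ (st s').T →
        (chainGrid p q ε SL SB).VL (i + 1) j < (st s').dp ((st s').T - 2)) ∧
      (st s').H = (st s).H ∧ (st s').T ≤ (st s).T ∧ (st s').dp = (st s).dp ∧
      (st s').dv = (st s).dv ∧ popCost k * (s'.nat 15 - s'.nat 14) + d ≤ c' := by
  refine WP.loop (fun s' c' => InCell p q ε M N SL SB R s₀ i j s' ∧
      (chainGrid p q ε SL SB).MidInv M j i (st s') ∧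
      ((st s').H = (st s).H ∧ (st s').T ≤ (st s).T ∧ (st s').dp = (st s).dp ∧
      (st s').dv = (st s).dv) ∧
      popCost k * (s'.nat 15 - s'.nat 14) + ((backC k).cost + 1) + d ≤ c') ?_
      ⟨h, hM, ⟨rfl, le_rfl, rfl, rfl⟩, hc⟩
  rintro s' c' ⟨h', hM', hl, hc'⟩
  refine ⟨c' - ((backC k).cost + 1), by omega, ?_, ?_⟩
  · rintro ⟨hb1, hb2⟩
    simp only [Cond.Holds, eval_reg, eval_succE, eval_get, NExpr.eval, h'.eval_vlE] at hb1 hb2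
    have e : s'.nat 15 - s'.nat 14 = s'.nat 15 - 1 - s'.nat 14 + 1 := by omega
    rw [e, popCost_mul_succ] at hc'
    have hk := back_le_popCost k
    have ex : backP.exec s' = s'.setNat 15 (s'.nat 15 - 1) := rfl
    refine WP.loopFree (by simp [backP, Program.LoopFree])
      (c' - ((backC k).cost + 1) - backP.bound) (by omega) ?_
    rw [ex]
    have n15 : (s'.setNat 15 (s'.nat 15 - 1)).nat 15 = s'.nat 15 - 1 := by simp
    have n14 : (s'.setNat 15 (s'.nat 15 - 1)).nat 14 = s'.nat 14 := by simp
    refine ⟨h'.setNat_tail _, ?_, ?_, ?_⟩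
    · rw [st_setNat_tail]
      exact hM'.popBack hb1 hb2
    · rw [st_setNat_tail]
      exact ⟨hl.1, (Nat.sub_le _ _).trans hl.2.1, hl.2.2⟩
    · rw [n15, n14]; omega
  · intro hb
    refine ⟨h', hM', fun hL => ?_, hl.1, hl.2.1, hl.2.2.1, hl.2.2.2, by omega⟩
    by_contra hp
    refine hb ⟨hL, ?_⟩
    simp only [Cond.Holds, eval_reg, eval_get, NExpr.eval, h'.eval_vlE]
    exact not_lt.1 hp

/-- A bound for the time of the passage through a cell, without the removal of entries, and of the
potential of a new entry. -/
def cellCost (k : ℕ) : ℕ :=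
  pushP.bound + ((upperP k).bound + (clearP k).bound) + ((frontC k).cost + 1) + (capP k).bound +
    ((backC k).cost + 1) + (raiseP k).bound + popCost k

/-- The single push raises the potential by at most `popCost k`, which `cellCost` contains. The
order of the steps matters: the push reads the data of the lower edge before they are overwritten,
the head is capped once it is final, and the last entry is raised after the superfluous ones are
gone. -/
theorem InCell.wp_cell (h : InCell p q ε M N SL SB R s₀ i j s)
    (hM : (chainGrid p q ε SL SB).RowInv M j i (st s)) {c d : ℕ}
    (hc : cellCost k + popCost k * (s.nat 15 - s.nat 14) + d ≤ c) :
    WP (cellP k) s c fun s' c' => InCell p q ε M N SL SB R s₀ i j s' ∧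
      (chainGrid p q ε SL SB).RowInv M j (i + 1) (st s') ∧
      s'.nat 15 - s'.nat 14 ≤ s.nat 15 - s.nat 14 + 1 ∧
      popCost k * (s'.nat 15 - s'.nat 14) + d ≤ c' := by
  have hT : s.nat 14 ≤ s.nat 15 := hM.le
  obtain ⟨a1, a2, a3⟩ := h.exec_pushP hT
  obtain ⟨b1, b2⟩ := a1.exec_upperP
  rw [a2, a3] at b2
  have hmid := hM.mid h.lt_columns
  have hspec := Grid.upper_push_spec (st s) (chainGrid p q ε SL SB) i j
  have hpush : ((st s).push i j).T ≤ s.nat 15 + 1 := by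
    rcases Grid.push_cases (st s) i j with hh | hh
    · exact hh.2.1.le
    · rw [hh.2]; exact Nat.le_succ _
  rw [show s.nat 15 = (st s).T from rfl] at b2
  rw [← b2] at hmid
  have eH : (((upperP k).seq (clearP k)).exec (pushP.exec s)).nat 14 = s.nat 14 :=
    (congrArg Grid.State.H b2).trans hspec.1
  have eT : (((upperP k).seq (clearP k)).exec (pushP.exec s)).nat 15 ≤ s.nat 15 + 1 :=
    ((congrArg Grid.State.T b2).trans hspec.2.1).le.trans hpush
  refine WP.seq (WP.loopFree (by simp [pushP, Program.LoopFree]) (c - pushP.bound)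
    (by unfold cellCost at hc; omega) ?_)
  refine WP.seq (WP.loopFree (by simp [upperP, Program.LoopFree])
    (c - pushP.bound - (upperP k).bound) (by unfold cellCost at hc; omega) ?_)
  refine WP.seq (WP.loopFree (by simp [clearP, Program.LoopFree])
    (c - pushP.bound - (upperP k).bound - (clearP k).bound)
    (by unfold cellCost at hc; omega) ?_)
  change WP _ (((upperP k).seq (clearP k)).exec (pushP.exec s)) _ _
  generalize ((upperP k).seq (clearP k)).exec (pushP.exec s) = s₁ at *
  have hl : s₁.nat 15 - s₁.nat 14 ≤ s.nat 15 - s.nat 14 + 1 := by omega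
  have hpot : popCost k * (s₁.nat 15 - s₁.nat 14) ≤
      popCost k * (s.nat 15 - s.nat 14) + popCost k :=
    (Nat.mul_le_mul_left _ hl).trans_eq (popCost_mul_succ _ _)
  refine WP.seq ((b1.wp_popFront hmid
    (d := (capP k).bound + ((backC k).cost + 1) + (raiseP k).bound + d)
    (by unfold cellCost at hc; omega)).mono ?_)
  rintro s₂ c₂ ⟨h₂, hM₂, hf₂, hl₂, hc₂⟩
  obtain ⟨d1, d2⟩ := h₂.exec_capP
  refine WP.seq (WP.loopFree (by simp [capP, Program.LoopFree]) (c₂ - (capP k).bound)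
    (by omega) ?_)
  have hcap : (chainGrid p q ε SL SB).MidInv M j i (st ((capP k).exec s₂)) ∧
      (∀ e, (st ((capP k).exec s₂)).H ≤ e → e < (st ((capP k).exec s₂)).T →
        (st ((capP k).exec s₂)).dp e ≤ (chainGrid p q ε SL SB).VH (i + 1) j ∧
        (st ((capP k).exec s₂)).dv e ≤ (chainGrid p q ε SL SB).VH (i + 1) j) ∧
      (st ((capP k).exec s₂)).H = (st s₂).H ∧
      (st ((capP k).exec s₂)).T = (st s₂).T := by
    by_cases hL : (st s₂).H < (st s₂).T
    · have hM₃ := hM₂.cap hL (hf₂ hL)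
      have hn := hM₂.nonempty hL (hf₂ hL)
      rw [if_pos hL] at d2
      rw [← d2] at hM₃
      refine ⟨hM₃, fun e he1 he2 => ?_, by rw [d2], by rw [d2]⟩
      have f1 : (st ((capP k).exec s₂)).dp (st s₂).H ≤
          (chainGrid p q ε SL SB).VH (i + 1) j := by rw [d2]; exact hf₂ hL
      have f2 : (st ((capP k).exec s₂)).dv (st s₂).H ≤
          (chainGrid p q ε SL SB).VH (i + 1) j := by
        rw [d2]; simp only [Function.update_self]; exact min_le_right _ _
      have eH₃ : (st ((capP k).exec s₂)).H = (st s₂).H := by rw [d2]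
      rcases he1.eq_or_lt with he | he
      · rw [← he, eH₃]; exact ⟨f1, f2⟩
      · refine ⟨(hM₃.dp_mono _ _ le_rfl he he2).trans ?_, (hM₃.dv_mono _ _ le_rfl he he2).trans ?_⟩
        · rw [eH₃]; exact f1
        · rw [eH₃]; exact f2
    · rw [if_neg hL] at d2
      rw [d2]
      exact ⟨hM₂, fun e he1 he2 => absurd (he1.trans_lt he2) hL, rfl, rfl⟩
  obtain ⟨hM₃, hf₃, eH₃, eT₃⟩ := hcap
  generalize (capP k).exec s₂ = s₃ at *
  have eH₃' : s₃.nat 14 = s₂.nat 14 := eH₃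
  have eT₃' : s₃.nat 15 = s₂.nat 15 := eT₃
  refine WP.seq ((d1.wp_popBack hM₃ (d := (raiseP k).bound + d)
    (by rw [eH₃', eT₃']; omega)).mono ?_)
  rintro s₄ c₄ ⟨h₄, hM₄, hb₄, eH₄, eT₄, edp, edv, hc₄⟩
  obtain ⟨g1, g2⟩ := h₄.exec_raiseP
  have hR := hM₄.raise (fun e he1 he2 => by
    rw [edp, edv]
    exact hf₃ e (eH₄ ▸ he1) (he2.trans_le eT₄)) hb₄
  have r1 : ((st s₄).raise ((chainGrid p q ε SL SB).VL (i + 1) j)).H = (st s₄).H := by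
    unfold Grid.State.raise; split_ifs <;> rfl
  have r2 : ((st s₄).raise ((chainGrid p q ε SL SB).VL (i + 1) j)).T = (st s₄).T := by
    unfold Grid.State.raise; split_ifs <;> rfl
  rw [← g2] at hR r1 r2
  refine WP.loopFree (by simp [raiseP, Program.LoopFree]) (c₄ - (raiseP k).bound)
    (by omega) ⟨g1, hR, ?_, ?_⟩
  · have : ((raiseP k).exec s₄).nat 14 = s₄.nat 14 := r1
    have : ((raiseP k).exec s₄).nat 15 = s₄.nat 15 := r2
    have : s₄.nat 14 = s₃.nat 14 := eH₄
    have : s₄.nat 15 ≤ s₃.nat 15 := eT₄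
    omega
  · rw [show ((raiseP k).exec s₄).nat 14 = s₄.nat 14 from r1,
      show ((raiseP k).exec s₄).nat 15 = s₄.nat 15 from r2]
    omega

end RealRAM

/-! ### The queues of finished rows -/

namespace Grid

variable {G : Grid} {M j H T : ℕ}

/-- The entries `H ≤ e < T` of a queue describe the reached points of the right edge of the
row `j`. -/
structure Record (G : Grid) (M j : ℕ) (dp dv : ℕ → ℝ) (H T : ℕ) : Prop where
  length : T - H ≤ M + 1
  bounds : ∀ e, H ≤ e → e < T → G.VL M j ≤ dp e ∧ dp e ≤ G.VH M j
  reach : ∀ σ q, G.Reach σ .vert M j q ↔ q ≤ G.VH M j ∧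
    ∃ e, H ≤ e ∧ e < T ∧ dp e ≤ q ∧ σ ≤ dv e ∧ σ ≤ q

theorem RowInv.record {S : State} (h : RowInv G M j M S) (hl : S.T - S.H ≤ M + 1) :
    Record G M j S.dp S.dv S.H S.T :=
  ⟨hl, fun e h1 h2 => ⟨(h.bounds e h1 h2).1, (h.bounds e h1 h2).2.1⟩, h.reach⟩

theorem Record.congr {dp dv dp' dv' : ℕ → ℝ} (h : Record G M j dp dv H T)
    (hp : ∀ e < T, dp' e = dp e) (hv : ∀ e < T, dv' e = dv e) : Record G M j dp' dv' H T where
  length := h.length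
  bounds e h1 h2 := by rw [hp e h2]; exact h.bounds e h1 h2
  reach σ q := by
    rw [h.reach]
    refine and_congr_right fun _ => exists_congr fun e => and_congr_right fun _ => ?_
    refine and_congr_right fun he => ?_
    rw [hp e he, hv e he]

end Grid

namespace RealRAM

variable {k : ℕ} {p q : ℕ → EuclideanSpace ℝ (Fin k)} {ε : ℝ} {M N SL SB : ℕ} {s s' s'' : Store}

/-! ### The sweep through a row -/

/-- The queue of a row begins at the old tail and not at 0: the entries of the earlier rows must
stay in place for the final comparison. -/
theorem Ctx.exec_startRowP (h : Ctx p q ε M N SL SB s) {j : ℕ} (hj : s.nat 13 = j) (hjN : j < N)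
    (hL : (chainGrid p q ε SL SB).LineInv M j (st s).bp (st s).bv) :
    Frame (s.nat 15) s ((startRowP k).exec s) ∧ ((startRowP k).exec s).nat 12 = 0 ∧
      ((startRowP k).exec s).nat 14 = s.nat 15 ∧
      ((startRowP k).exec s).nat 15 ≤ s.nat 15 + 1 ∧
      (chainGrid p q ε SL SB).RowInv M j 0 (st ((startRowP k).exec s)) := by
  obtain ⟨s₁, hs₁⟩ : ∃ s₁, s₁ = s.setNat 14 (s.nat 15) := ⟨_, rfl⟩
  have f₁ : Frame (s.nat 15) s s₁ := hs₁ ▸ .setNat (by simp) _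
  have h₁ := h.congr f₁.agree
  have e₁ : st s₁ = { st s with H := s.nat 15 } := hs₁ ▸ st_setNat_head s _
  have e15 : s₁.nat 15 = s.nat 15 := by simp [hs₁]
  have e14 : s₁.nat 14 = s.nat 15 := by simp [hs₁]
  have e13 : s₁.nat 13 = j := f₁.row.trans hj
  have hl := h₁.eval_vlE (i := .const 0) (j := reg 13) (Nat.zero_le _) (by simpa [e13] using hjN)
  have hh := h₁.eval_vhE (i := .const 0) (j := reg 13) (Nat.zero_le _) (by simpa [e13] using hjN)
  simp only [eval_reg, NExpr.eval, e13] at hl hh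
  have f₂ : Frame (s.nat 15) s (s₁.setReal (s₁.nat 11 + 4 * s.nat 15 + 2)
      ((chainGrid p q ε SL SB).VL 0 j)) := f₁.trans (.setReal_dp le_rfl)
  have h₂ := h.congr f₂.agree
  -- The upper end is evaluated after the lower end has been written; its operands are not in the
  -- arrays.
  have hh' := h₂.eval_vhE (i := .const 0) (j := reg 13) (Nat.zero_le _)
    (by simpa [e13] using hjN)
  simp only [eval_reg, NExpr.eval, Store.setReal_nat, e13] at hh'
  rw [startRowP, Program.exec,
    show (Program.setNat (.const 14) (reg 15)).exec s = s₁ from hs₁.symm]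
  simp only [Program.exec, Cond.Holds, eval_entry, eval_reg, eval_succE, NExpr.eval, hl, hh, e13,
    e15, h₁.left, Store.setReal_nat, hh']
  by_cases hc : j + 1 ≤ SL ∧ (chainGrid p q ε SL SB).VL 0 j ≤ (chainGrid p q ε SL SB).VH 0 j
  · rw [if_pos hc]
    have e₂ := st_setReal_dv (s₁.setReal (s₁.nat 11 + 4 * s.nat 15 + 2)
      ((chainGrid p q ε SL SB).VL 0 j)) (s.nat 15) ((chainGrid p q ε SL SB).VH 0 j)
    rw [Store.setReal_nat, st_setReal_dp, e₁] at e₂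
    refine ⟨((f₂.trans (.setReal_dv le_rfl)).trans (.setNat (by simp) _)).trans
      (.setNat (by simp) _), by simp, by simp [e14], by simp, ?_⟩
    rw [st_setNat _ _ (by decide) (by decide) (by decide), st_setNat_tail]
    erw [e₂]
    exact Grid.LineInv.rowInv_single hL rfl hc.1 hc.2 (by simp) (by simp)
  · rw [if_neg hc]
    refine ⟨f₁.trans (.setNat (by simp) _), by simp, by simp [e14], by simp [e15], ?_⟩
    rw [st_setNat _ _ (by decide) (by decide) (by decide), e₁]
    exact Grid.LineInv.rowInv_empty hL rfl hc

/-- A bound for the time of a pass through the loop over the columns. -/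
def columnCost (k : ℕ) : ℕ := cellCost k + nextColumnP.bound + (columnC.cost + 1)

/-- A bound for the time of a row, without the passage through the cells. -/
def rowCost (k : ℕ) : ℕ :=
  (startRowP k).bound + popCost k + (columnC.cost + 1) + nextRowP.bound

/-- A row starts with at most one entry, whose potential is part of `rowCost`, and every column adds
at most one. Hence at most `M + 1` entries are recorded, which later limits the time of the
comparison. -/
theorem Ctx.wp_row (h : Ctx p q ε M N SL SB s) {j : ℕ} (hj : s.nat 13 = j) (hjN : j < N)
    (hL : (chainGrid p q ε SL SB).LineInv M j (st s).bp (st s).bv) {c d : ℕ}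
    (hc : rowCost k + M * columnCost k + d ≤ c) :
    WP (rowP k) s c fun s' c' => Agree s s' ∧ s'.nat 13 = j + 1 ∧ s.nat 15 ≤ s'.nat 15 ∧
      (chainGrid p q ε SL SB).LineInv M (j + 1) (st s').bp (st s').bv ∧
      (∀ e < s.nat 15, (st s').dp e = (st s).dp e) ∧
      (∀ e < s.nat 15, (st s').dv e = (st s).dv e) ∧
      (∀ a, 20 ≤ a → a < 20 + 2 * j → s'.nat a = s.nat a) ∧
      s'.nat (21 + 2 * j) ≤ s'.nat 15 ∧
      (chainGrid p q ε SL SB).Record M j (st s').dp (st s').dv (s'.nat (20 + 2 * j))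
        (s'.nat (21 + 2 * j)) ∧ d ≤ c' := by
  obtain ⟨f₁, e12, e14, e15, hR⟩ := h.exec_startRowP hj hjN hL
  refine WP.seq (WP.loopFree (by simp [startRowP, Program.LoopFree]) (c - (startRowP k).bound)
    (by unfold rowCost at hc; omega) ?_)
  generalize (startRowP k).exec s = s₁ at *
  refine WP.seq (WP.loop (fun s' c' => ∃ i ≤ M, Frame (s.nat 15) s s' ∧ s'.nat 12 = i ∧
    s.nat 15 ≤ s'.nat 14 ∧ (chainGrid p q ε SL SB).RowInv M j i (st s') ∧
    s'.nat 15 - s'.nat 14 ≤ i + 1 ∧ (M - i) * columnCost k +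
      popCost k * (s'.nat 15 - s'.nat 14) + (columnC.cost + 1) + nextRowP.bound + d ≤ c') ?_ ?_)
  · rintro s' c' ⟨i, hi, hf, h12, h14, hRow, hlen, hc'⟩
    refine ⟨c' - (columnC.cost + 1), by omega, fun hb => ?_, fun hb => ?_⟩
    · have hctx := h.congr hf.agree
      have hb' : i < M := by
        have : s'.nat 12 + 1 ≤ s'.nat 6 := hb
        rw [h12, hctx.columns] at this
        exact this
      have hcell : InCell p q ε M N SL SB (s.nat 15) s i j s' :=
        ⟨hctx, h12, hf.row.trans hj, hb', hjN, h14, hf⟩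
      obtain ⟨x, hx⟩ : ∃ x, M - i = x + 1 := ⟨M - i - 1, by omega⟩
      rw [hx, Nat.succ_mul] at hc'
      refine WP.seq ((hcell.wp_cell hRow (d := x * columnCost k + nextColumnP.bound +
        (columnC.cost + 1) + nextRowP.bound + d) (by unfold columnCost at hc' ⊢; omega)).mono ?_)
      rintro s₂ c₂ ⟨h₂, hR₂, hl₂, hc₂⟩
      refine WP.loopFree (by simp [nextColumnP, Program.LoopFree]) (c₂ - nextColumnP.bound)
        (by omega) ?_
      rw [show nextColumnP.exec s₂ = s₂.setNat 12 (s₂.nat 12 + 1) from rfl]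
      have n15 : (s₂.setNat 12 (s₂.nat 12 + 1)).nat 15 = s₂.nat 15 := by simp
      have n14 : (s₂.setNat 12 (s₂.nat 12 + 1)).nat 14 = s₂.nat 14 := by simp
      refine ⟨i + 1, hb', h₂.frame.trans (.setNat (by simp) _), by simp [h₂.column],
        by rw [n14]; exact h₂.head, ?_, by rw [n15, n14]; omega, ?_⟩
      · rw [st_setNat _ _ (by decide) (by decide) (by decide)]
        exact hR₂
      · rw [n15, n14, show M - (i + 1) = x by omega]
        omega
    · obtain rfl : i = M := by
        have : ¬ s'.nat 12 + 1 ≤ s'.nat 6 := hb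
        rw [h12, (h.congr hf.agree).columns] at this
        omega
      have e13 : s'.nat 13 = j := hf.row.trans hj
      have hle : s'.nat 14 ≤ s'.nat 15 := hRow.le
      refine WP.loopFree (by simp [nextRowP, Program.LoopFree])
        (c' - (columnC.cost + 1) - nextRowP.bound) (by omega) ?_
      have ex : nextRowP.exec s' = ((s'.setNat (20 + 2 * j) (s'.nat 14)).setNat (21 + 2 * j)
          (s'.nat 15)).setNat 13 (j + 1) := by
        simp only [nextRowP, Program.exec, NExpr.eval, eval_reg, eval_succE, Store.setNat_nat, e13]
        rw [if_neg (by omega), if_neg (by omega), if_neg (by omega)]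
      have est : st (nextRowP.exec s') = st s' := by
        rw [ex, st_setNat _ _ (by decide) (by decide) (by decide),
          st_setNat _ _ (by omega) (by omega) (by omega),
          st_setNat _ _ (by omega) (by omega) (by omega)]
      have hn : ∀ a, a ≠ 13 → a ≠ 20 + 2 * j → a ≠ 21 + 2 * j →
          (nextRowP.exec s').nat a = s'.nat a := by
        intro a h1 h2 h3
        rw [ex]; simp [h1, h2, h3]
      have n20 : (nextRowP.exec s').nat (20 + 2 * j) = s'.nat 14 := by
        rw [ex]; simp only [Store.setNat_nat]
        rw [if_neg (by omega), if_neg (by omega), if_pos trivial]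
      have n21 : (nextRowP.exec s').nat (21 + 2 * j) = s'.nat 15 := by
        rw [ex]; simp only [Store.setNat_nat]
        rw [if_neg (by omega), if_pos trivial]
      have n15 : (nextRowP.exec s').nat 15 = s'.nat 15 := hn 15 (by omega) (by omega) (by omega)
      refine ⟨hf.agree.trans ⟨fun a ha => hn a (by omega) (by omega) (by omega), fun a _ => ?_⟩,
        by rw [ex]; simp, by rw [n15]; omega, ?_, ?_, ?_, ?_, by rw [n21, n15], ?_, by omega⟩
      · rw [ex]; rfl
      · rw [est]; exact hRow.line
      · rw [est]; exact hf.dp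
      · rw [est]; exact hf.dv
      · intro a h1 h2
        rw [hn a (by omega) (by omega) (by omega)]
        exact hf.nat a (by omega) (by omega) (by omega) (by omega)
      · rw [est, n20, n21]; exact hRow.record hlen
  · refine ⟨0, Nat.zero_le _, f₁, e12, e14.ge, hR, by omega, ?_⟩
    have : popCost k * (s₁.nat 15 - s₁.nat 14) ≤ popCost k * 1 :=
      Nat.mul_le_mul_left _ (by omega)
    rw [Nat.sub_zero]
    unfold rowCost at hc
    omega

/-! ### The whole sweep -/

/-- A bound for the time of the initialization of an edge. -/
def edgeCost (k : ℕ) : ℕ := (startEdgeP k).bound + (columnC.cost + 1)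

/-- The result of a sweep. -/
structure Swept (p q : ℕ → EuclideanSpace ℝ (Fin k)) (ε : ℝ) (M N SL SB : ℕ) (s : Store) :
    Prop where
  line : (chainGrid p q ε SL SB).LineInv M N (st s).bp (st s).bv
  record : ∀ j < N, (chainGrid p q ε SL SB).Record M j (st s).dp (st s).dv
    (s.nat (20 + 2 * j)) (s.nat (21 + 2 * j))

theorem Ctx.exec_startEdgeP (h : Ctx p q ε M N SL SB s) {i : ℕ} (hi : s.nat 12 = i) (hiM : i < M) :
    Agree s ((startEdgeP k).exec s) ∧ ((startEdgeP k).exec s).nat 12 = i + 1 ∧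
    (∀ i' < i, (st ((startEdgeP k).exec s)).bp i' = (st s).bp i' ∧
      (st ((startEdgeP k).exec s)).bv i' = (st s).bv i') ∧
    ((i < SB ∧ (chainGrid p q ε SL SB).HL i 0 ≤ (chainGrid p q ε SL SB).HR i 0 ∧
      (st ((startEdgeP k).exec s)).bp i = (chainGrid p q ε SL SB).HL i 0 ∧
      (st ((startEdgeP k).exec s)).bv i = -(chainGrid p q ε SL SB).HL i 0) ∨
    (¬ (i < SB ∧ (chainGrid p q ε SL SB).HL i 0 ≤ (chainGrid p q ε SL SB).HR i 0) ∧
      (st ((startEdgeP k).exec s)).bp i = i + 2)) := by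
  have hl := h.eval_hlE (i := reg 12) (j := .const 0) (by simpa [hi] using hiM) (Nat.zero_le _)
  have hr := h.eval_hrE (i := reg 12) (j := .const 0) (by simpa [hi] using hiM) (Nat.zero_le _)
  simp only [eval_reg, NExpr.eval, hi] at hl hr
  have f₂ : Frame 0 s (s.setReal (s.nat 11 + 4 * i + 0)
      ((chainGrid p q ε SL SB).HL i 0)) := .setReal_bp
  have hl' := (h.congr f₂.agree).eval_hlE (i := reg 12) (j := .const 0)
    (by simpa [hi] using hiM) (Nat.zero_le _)
  simp only [eval_reg, NExpr.eval, Store.setReal_nat, hi] at hl'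
  have ex : ∀ s', s'.nat 12 = i → nextColumnP.exec s' = s'.setNat 12 (i + 1) := by
    rintro s' rfl; rfl
  simp only [startEdgeP, Program.exec, Cond.Holds, eval_entry, eval_reg, eval_succE, RExpr.eval,
    hl, hr, hi, h.lower, Store.setReal_nat, hl']
  by_cases hc : i + 1 ≤ SB ∧ (chainGrid p q ε SL SB).HL i 0 ≤ (chainGrid p q ε SL SB).HR i 0
  · rw [if_pos hc, ex _ (by simpa using hi)]
    have e₂ := st_setReal_bv (s.setReal (s.nat 11 + 4 * i + 0)
      ((chainGrid p q ε SL SB).HL i 0)) i (((0 : ℚ) : ℝ) - (chainGrid p q ε SL SB).HL i 0)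
    rw [Store.setReal_nat, st_setReal_bp] at e₂
    refine ⟨((f₂.trans (.setReal_bv)).trans (.setNat (by simp) _)).agree, by simp, ?_⟩
    rw [st_setNat _ _ (by decide) (by decide) (by decide)]
    erw [e₂]
    refine ⟨fun i' hi' => ?_, .inl ⟨hc.1, hc.2, by simp, by simp⟩⟩
    simp [Function.update_of_ne hi'.ne]
  · rw [if_neg hc, ex _ (by simpa using hi)]
    refine ⟨((Frame.setReal_bp (R := 0)).trans (.setNat (by simp) _)).agree, by simp, ?_⟩
    rw [st_setNat _ _ (by decide) (by decide) (by decide), st_setReal_bp]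
    refine ⟨fun i' hi' => ?_, .inr ⟨hc, ?_⟩⟩
    · simp [Function.update_of_ne hi'.ne]
    · simp only [Function.update_self]
      push_cast
      ring

/-- A bound for the time of a sweep. -/
def sweepTime (k M N : ℕ) : ℕ :=
  3 + M * edgeCost k + (columnC.cost + 1) + 6 +
    N * (rowCost k + M * columnCost k + (rowC.cost + 1)) + (rowC.cost + 1)

theorem Ctx.wp_sweep (h : Ctx p q ε M N SL SB s) {c d : ℕ} (hc : sweepTime k M N + d ≤ c) :
    WP (sweepP k) s c fun s' c' => Agree s s' ∧ Swept p q ε M N SL SB s' ∧ d ≤ c' := by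
  unfold sweepTime at hc
  -- Writing a constant into a fixed cell takes 3 units: address, value and the access itself.
  refine WP.seq (WP.loopFree (by simp [Program.LoopFree]) (c - 3)
    (by simp only [Program.bound, NExpr.cost]; omega) ?_)
  rw [show (Program.setNat (.const 12) (.const 0)).exec s = s.setNat 12 0 from rfl]
  refine WP.seq ((WP.loop (fun s' c' => ∃ i ≤ M, Agree s s' ∧ s'.nat 12 = i ∧
    (∀ i' < i, (i' < SB ∧ (chainGrid p q ε SL SB).HL i' 0 ≤ (chainGrid p q ε SL SB).HR i' 0 ∧
      (st s').bp i' = (chainGrid p q ε SL SB).HL i' 0 ∧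
      (st s').bv i' = -(chainGrid p q ε SL SB).HL i' 0) ∨
    (¬ (i' < SB ∧ (chainGrid p q ε SL SB).HL i' 0 ≤ (chainGrid p q ε SL SB).HR i' 0) ∧
      (st s').bp i' = i' + 2)) ∧ (M - i) * edgeCost k + (columnC.cost + 1) + 6 +
      N * (rowCost k + M * columnCost k + (rowC.cost + 1)) + (rowC.cost + 1) + d ≤ c')
    (Q := fun s' c' => Agree s s' ∧
      (chainGrid p q ε SL SB).LineInv M 0 (st s').bp (st s').bv ∧
      6 + N * (rowCost k + M * columnCost k + (rowC.cost + 1)) + (rowC.cost + 1) + d ≤ c')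
    ?_ ?_).mono ?_)
  · rintro s' c' ⟨i, hi, ha, h12, hrep, hc'⟩
    refine ⟨c' - (columnC.cost + 1), by omega, fun hb => ?_, fun hb => ?_⟩
    · have hctx := h.congr ha
      have hb' : i < M := by
        have : s'.nat 12 + 1 ≤ s'.nat 6 := hb
        rw [h12, hctx.columns] at this
        exact this
      obtain ⟨g1, g2, g3, g4⟩ := hctx.exec_startEdgeP h12 hb'
      obtain ⟨x, hx⟩ : ∃ x, M - i = x + 1 := ⟨M - i - 1, by omega⟩
      rw [hx, Nat.succ_mul] at hc'
      unfold edgeCost at hc'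
      refine WP.loopFree (by simp [startEdgeP, nextColumnP, Program.LoopFree])
        (c' - (columnC.cost + 1) - (startEdgeP k).bound) (by omega)
        ⟨i + 1, hb', ha.trans g1, g2, fun i' hi' => ?_, ?_⟩
      · rcases Nat.lt_succ_iff_lt_or_eq.1 hi' with h' | rfl
        · rw [(g3 i' h').1, (g3 i' h').2]; exact hrep i' h'
        · exact g4
      · rw [show M - (i + 1) = x by omega]
        unfold edgeCost
        omega
    · obtain rfl : i = M := by
        have : ¬ s'.nat 12 + 1 ≤ s'.nat 6 := hb
        rw [h12, (h.congr ha).columns] at this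
        omega
      exact ⟨ha, Grid.lineInv_zero hrep, by omega⟩
  · refine ⟨0, Nat.zero_le _, (Frame.setNat (R := 0) (by simp) _).agree, by simp, by omega, ?_⟩
    rw [Nat.sub_zero]
    omega
  rintro s₁ c₁ ⟨ha₁, hL₁, hc₁⟩
  refine WP.seq (WP.loopFree (by simp [Program.LoopFree]) (c₁ - 6)
    (by simp only [Program.bound, NExpr.cost]; omega) ?_)
  rw [show (Program.seq (.setNat (.const 13) (.const 0)) (.setNat (.const 15) (.const 0))).exec s₁ =
    (s₁.setNat 13 0).setNat 15 0 from rfl]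
  -- Recorded tails do not exceed the current tail, and later rows write entries only from there on;
  -- this keeps the earlier records valid.
  refine WP.loop (fun s' c' => ∃ j ≤ N, Agree s s' ∧ s'.nat 13 = j ∧
    (chainGrid p q ε SL SB).LineInv M j (st s').bp (st s').bv ∧
    (∀ j' < j, s'.nat (21 + 2 * j') ≤ s'.nat 15 ∧
      (chainGrid p q ε SL SB).Record M j' (st s').dp (st s').dv (s'.nat (20 + 2 * j'))
        (s'.nat (21 + 2 * j'))) ∧
    (N - j) * (rowCost k + M * columnCost k + (rowC.cost + 1)) + (rowC.cost + 1) + d ≤ c') ?_ ?_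
  · rintro s' c' ⟨j, hj, ha, h13, hL, hrec, hc'⟩
    refine ⟨c' - (rowC.cost + 1), by omega, fun hb => ?_, fun hb => ?_⟩
    · have hctx := h.congr ha
      have hb' : j < N := by
        have : s'.nat 13 + 1 ≤ s'.nat 7 := hb
        rw [h13, hctx.rows] at this
        exact this
      obtain ⟨x, hx⟩ : ∃ x, N - j = x + 1 := ⟨N - j - 1, by omega⟩
      rw [hx, Nat.succ_mul] at hc'
      refine (hctx.wp_row h13 hb' hL (d := x * (rowCost k + M * columnCost k + (rowC.cost + 1)) +
        (rowC.cost + 1) + d) (by omega)).mono ?_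
      rintro s₂ c₂ ⟨r1, r2, r3, r4, r5, r6, r7, r8, r9, r10⟩
      refine ⟨j + 1, hb', ha.trans r1, r2, r4, fun j' hj' => ?_, ?_⟩
      · rcases Nat.lt_succ_iff_lt_or_eq.1 hj' with h' | rfl
        · obtain ⟨u1, u2⟩ := hrec j' h'
          rw [r7 (21 + 2 * j') (by omega) (by omega), r7 (20 + 2 * j') (by omega) (by omega)]
          exact ⟨u1.trans r3, u2.congr (fun e he => r5 e (by omega)) fun e he => r6 e (by omega)⟩
        · exact ⟨r8, r9⟩
      · rw [show N - (j + 1) = x by omega]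
        exact r10
    · obtain rfl : j = N := by
        have : ¬ s'.nat 13 + 1 ≤ s'.nat 7 := hb
        rw [h13, (h.congr ha).rows] at this
        omega
      exact ⟨ha, ⟨hL, fun j' hj' => (hrec j' hj').2⟩, by omega⟩
  · refine ⟨0, Nat.zero_le _, ha₁.trans ⟨fun a ha => ?_, fun _ _ => rfl⟩, by simp, ?_, by omega, ?_⟩
    · simp only [Store.setNat_nat]
      rw [if_neg (by omega), if_neg (by omega)]
    · rw [st_setNat_tail, st_setNat _ _ (by decide) (by decide) (by decide)]
      exact hL₁
    · rw [Nat.sub_zero]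
      omega

end RealRAM

namespace RealRAM

/-! ### The program -/

/-- Write into a register. -/
def setReg (a : ℕ) (e : NExpr) : Program := .setNat (.const a) e

/-- Prepare the sweep through the grid with `Y`, passed twice, as the abscissa and `X` as the
ordinate. -/
def forwardP (k : ℕ) : Program :=
  .seq (setReg 2 (.add (.const 1) (.mul (reg 0) (.const k)))) (.seq (setReg 3 (reg 1))
    (.seq (setReg 4 (.const 1)) (.seq (setReg 5 (reg 0))
    (.seq (setReg 6 (.mul (.const 2) (reg 1))) (.seq (setReg 7 (reg 0))
    (.seq (setReg 8 (.const 0)) (.seq (setReg 9 (.const 0)) (.seq (setReg 10 (reg 1))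
    (setReg 11 (.add (.const 1) (.mul (.add (reg 0) (reg 1)) (.const k))))))))))))

/-- Prepare the sweep through the grid with `X` as the abscissa and `Y`, passed twice, as the
ordinate, both passed backwards. -/
def backwardP (k : ℕ) : Program :=
  .seq (setReg 2 (.const 1)) (.seq (setReg 3 (reg 0))
    (.seq (setReg 4 (.add (.const 1) (.mul (reg 0) (.const k)))) (.seq (setReg 5 (reg 1))
    (.seq (setReg 6 (reg 0)) (.seq (setReg 7 (.mul (.const 2) (reg 1)))
    (.seq (setReg 8 (.const 1)) (.seq (setReg 9 (reg 1)) (.seq (setReg 10 (.const 0))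
    (setReg 11 (.add (reg 11) (.mul (.const 8) (reg 1))))))))))))

/-- The row of the second sweep that belongs to the current column of the first sweep. -/
def rowE : NExpr := .sub (.sub (.mul (.const 2) (reg 1)) (.const 1)) (reg 13)

/-- The data of the current column from the first sweep. -/
def firstE (c : ℕ) : RExpr :=
  .load (.add (.add (.sub (reg 11) (.mul (.const 8) (reg 1)))
    (.mul (.const 4) (.add (reg 13) (reg 1)))) (.const c))

/-- The current entry matches the current column. -/
def matchC : Cond :=
  .and (.realLE (.add (firstE 0) (get 2 (reg 12))) (.cast (.mul (.const 3) (reg 1))))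
    (.and (.realLE (get 2 (reg 12)) (.add (firstE 1) (.cast (.mul (.const 2) (reg 1)))))
      (.realLE (get 2 (reg 12)) (.add (get 3 (reg 12)) (.cast (reg 1)))))

/-- There are further entries. -/
def entryC : Cond :=
  .natLE (succE (reg 12)) (.load (.add (.const 21) (.mul (.const 2) rowE)))

/-- Test the current entry. -/
def entryP : Program :=
  .seq (.branch matchC (setReg 17 (.const 1)) .skip) (setReg 12 (succE (reg 12)))

/-- Go to the first entry. -/
def firstEntryP : Program := setReg 12 (.load (.add (.const 20) (.mul (.const 2) rowE)))

/-- There are further columns to be compared. -/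
def compareC : Cond := .natLE (succE (reg 13)) (reg 1)

/-- Compare the results of the two sweeps. -/
def compareP : Program :=
  .seq (.seq (setReg 17 (.const 0)) (setReg 13 (.const 0)))
    (.seq (.loop compareC (.seq firstEntryP
      (.seq (.loop entryC entryP) (setReg 13 (succE (reg 13))))))
    (setReg 0 (reg 17)))

/-- The program that decides whether the Fréchet distance is at most the given number. -/
def decideP (k : ℕ) : Program :=
  .branch (.realLE (.const 0) (.load (.const 0)))
    (.seq (forwardP k) (.seq (sweepP k) (.seq (backwardP k) (.seq (sweepP k) compareP))))
    (setReg 0 (.const 0))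

/-! ### The input -/

/-- With truncated subtraction `1 - (l - r)` is 1 if `l ≤ r` and 0 otherwise. The machine has no
division of naturals, but for `r ≤ 2 l` at most two subtractions of `l` are needed. -/
theorem wrap_eq_mod {l r : ℕ} (hr : r ≤ 2 * l) :
    r - l * (1 - (l - r)) - l * (1 - (2 * l - r)) = r % l := by
  rcases lt_or_ge r l with h | h
  · rw [Nat.mod_eq_of_lt h, show 1 - (l - r) = 0 by omega, show 1 - (2 * l - r) = 0 by omega]
    simp
  · rw [show 1 - (l - r) = 1 by omega]
    rcases hr.eq_or_lt with rfl | h'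
    · simp; omega
    · rw [show 1 - (2 * l - r) = 0 by omega, Nat.mod_eq_sub_mod h, Nat.mod_eq_of_lt (by omega)]
      simp

theorem vertexIndex_forward {l i : ℕ} (len : ℕ) (hi : i ≤ 2 * l) :
    vertexIndex l len 0 i = i % l := by
  simp only [vertexIndex, Nat.sub_zero, Nat.mul_one, Nat.mul_zero, Nat.add_zero]
  exact wrap_eq_mod hi

theorem vertexIndex_backward {l len i : ℕ} (hi : len - i ≤ 2 * l) :
    vertexIndex l len 1 i = (len - i) % l := by
  simp only [vertexIndex, Nat.sub_self, Nat.mul_one, Nat.mul_zero, Nat.zero_add]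
  exact wrap_eq_mod hi

theorem coordinate_index_lt {k m i c : ℕ} (hi : i < m) (hc : c < k) : k * i + c < m * k := by
  calc k * i + c < k * (i + 1) := by rw [Nat.mul_succ]; omega
    _ ≤ k * m := Nat.mul_le_mul_left _ hi
    _ = m * k := Nat.mul_comm _ _

variable {k m n : ℕ} {X : ClosedPolygon k m} {Y : ClosedPolygon k n} {ε : ℝ} {s s' : Store}

theorem coordinates_apply (X : ClosedPolygon k m) (i : Fin m) (c : Fin k) :
    coordinates X (k * i + c) = X i c := by
  have h := coordinate_index_lt i.2 c.2
  have e : finProdFinEquiv.symm ⟨k * i + c, h⟩ = (i, c) := by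
    rw [Equiv.symm_apply_eq]
    ext
    simp [add_comm]
  rw [coordinates, dif_pos h, e]

/-- The input is in the memory. -/
structure Loaded (X : ClosedPolygon k m) (Y : ClosedPolygon k n) (ε : ℝ) (s : Store) : Prop where
  lengthX : s.nat 0 = m
  lengthY : s.nat 1 = n
  radius : s.real 0 = ε
  coordX : ∀ (i : Fin m) (c : Fin k), s.real (1 + (k * i + c)) = X i c
  coordY : ∀ (i : Fin n) (c : Fin k), s.real (1 + m * k + (k * i + c)) = Y i c

theorem loaded_input (X : ClosedPolygon k m) (Y : ClosedPolygon k n) (ε : ℝ) :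
    Loaded X Y ε (input X Y ε) where
  lengthX := rfl
  lengthY := rfl
  radius := rfl
  coordX i c := by
    have h := coordinate_index_lt i.2 c.2
    simp only [input]
    rw [if_neg (by omega), Nat.add_sub_cancel_left, if_pos h, coordinates_apply]
  coordY i c := by
    simp only [input]
    rw [if_neg (by omega), if_neg (by omega),
      show 1 + m * k + (k * i + c) - 1 - m * k = k * i + c by omega, coordinates_apply]

theorem Loaded.congr (h : Loaded X Y ε s) (hm : s'.nat 0 = s.nat 0) (hn : s'.nat 1 = s.nat 1)
    (hr : ∀ a < 1 + (m + n) * k, s'.real a = s.real a) : Loaded X Y ε s' where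
  lengthX := hm.trans h.lengthX
  lengthY := hn.trans h.lengthY
  radius := (hr 0 (by omega)).trans h.radius
  coordX i c := by
    have := coordinate_index_lt i.2 c.2
    rw [hr _ (by rw [Nat.add_mul]; omega), h.coordX]
  coordY i c := by
    have := coordinate_index_lt i.2 c.2
    rw [hr _ (by rw [Nat.add_mul]; omega), h.coordY]

theorem Loaded.vertexX [NeZero m] (h : Loaded X Y ε s) (r : ℕ) (c : Fin k) :
    s.real (1 + (k * (r % m) + c)) = X.vertex r c :=
  h.coordX ⟨r % m, Nat.mod_lt _ (NeZero.pos m)⟩ c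

theorem Loaded.vertexY [NeZero n] (h : Loaded X Y ε s) (r : ℕ) (c : Fin k) :
    s.real (1 + m * k + (k * (r % n) + c)) = Y.vertex r c :=
  h.coordY ⟨r % n, Nat.mod_lt _ (NeZero.pos n)⟩ c

theorem setReg_exec (a : ℕ) (e : NExpr) (s : Store) :
    (setReg a e).exec s = s.setNat a (e.eval s) := rfl

theorem Loaded.ctx_forward [NeZero m] [NeZero n] (h : Loaded X Y ε s) :
    Loaded X Y ε ((forwardP k).exec s) ∧ ((forwardP k).exec s).nat 11 = 1 + (m + n) * k ∧
      Ctx Y.vertex X.vertex ε (2 * n) m 0 n ((forwardP k).exec s) := by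
  have hm := h.lengthX
  have hn := h.lengthY
  have hl : Loaded X Y ε ((forwardP k).exec s) := h.congr
    (by simp [forwardP, Program.exec, setReg_exec])
    (by simp [forwardP, Program.exec, setReg_exec])
    (fun a _ => by simp [forwardP, Program.exec, setReg_exec])
  have h11 : ((forwardP k).exec s).nat 11 = 1 + (m + n) * k := by
    simp [forwardP, Program.exec, setReg_exec, NExpr.eval, hm, hn]
  have h2 : ((forwardP k).exec s).nat 2 = 1 + m * k := by
    simp [forwardP, Program.exec, setReg_exec, NExpr.eval, hm]
  have h3 : ((forwardP k).exec s).nat 3 = n := by simp [forwardP, Program.exec, setReg_exec, hn]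
  have h4 : ((forwardP k).exec s).nat 4 = 1 := by
    simp [forwardP, Program.exec, setReg_exec, NExpr.eval]
  have h5 : ((forwardP k).exec s).nat 5 = m := by simp [forwardP, Program.exec, setReg_exec, hm]
  have h6 : ((forwardP k).exec s).nat 6 = 2 * n := by
    simp [forwardP, Program.exec, setReg_exec, NExpr.eval, hn]
  have h7 : ((forwardP k).exec s).nat 7 = m := by simp [forwardP, Program.exec, setReg_exec, hm]
  have h8 : ((forwardP k).exec s).nat 8 = 0 := by
    simp [forwardP, Program.exec, setReg_exec, NExpr.eval]
  refine ⟨hl, h11, h6, h7, by simp [forwardP, Program.exec, setReg_exec, NExpr.eval],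
    by simp [forwardP, Program.exec, setReg_exec, hn], by omega, hl.radius, ?_, ?_⟩
  · intro i hi c
    rw [addrP, h2, h3, h6, h8, h11, vertexIndex_forward _ hi, hl.vertexY]
    have := coordinate_index_lt (Nat.mod_lt i (NeZero.pos n)) c.2
    exact ⟨by rw [Nat.add_mul]; omega, rfl⟩
  · intro i hi c
    rw [addrQ, h4, h5, h7, h8, h11, vertexIndex_forward _ (by omega), hl.vertexX]
    have := coordinate_index_lt (Nat.mod_lt i (NeZero.pos m)) c.2
    exact ⟨by rw [Nat.add_mul]; omega, rfl⟩

/-- The arrays of the second sweep start `8 n = 4 * (2 n)` cells after those of the first, so the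
data of all `2 n` columns of the first sweep survive. The queues of the first sweep may be
overwritten, because the comparison does not use them. -/
theorem Loaded.ctx_backward [NeZero m] [NeZero n] (h : Loaded X Y ε s)
    (hW : s.nat 11 = 1 + (m + n) * k) :
    Loaded X Y ε ((backwardP k).exec s) ∧
      ((backwardP k).exec s).nat 11 = 1 + (m + n) * k + 8 * n ∧
      ((backwardP k).exec s).real = s.real ∧
      Ctx (fun i => X.vertex (m - i)) (fun j => Y.vertex (2 * n - j)) ε m (2 * n) n 0
        ((backwardP k).exec s) := by
  have hm := h.lengthX
  have hn := h.lengthY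
  have hl : Loaded X Y ε ((backwardP k).exec s) := h.congr
    (by simp [backwardP, Program.exec, setReg_exec])
    (by simp [backwardP, Program.exec, setReg_exec])
    (fun a _ => by simp [backwardP, Program.exec, setReg_exec])
  have h11 : ((backwardP k).exec s).nat 11 = 1 + (m + n) * k + 8 * n := by
    simp [backwardP, Program.exec, setReg_exec, NExpr.eval, hn, hW]
  have h2 : ((backwardP k).exec s).nat 2 = 1 := by
    simp [backwardP, Program.exec, setReg_exec, NExpr.eval]
  have h3 : ((backwardP k).exec s).nat 3 = m := by simp [backwardP, Program.exec, setReg_exec, hm]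
  have h4 : ((backwardP k).exec s).nat 4 = 1 + m * k := by
    simp [backwardP, Program.exec, setReg_exec, NExpr.eval, hm]
  have h5 : ((backwardP k).exec s).nat 5 = n := by simp [backwardP, Program.exec, setReg_exec, hn]
  have h6 : ((backwardP k).exec s).nat 6 = m := by simp [backwardP, Program.exec, setReg_exec, hm]
  have h7 : ((backwardP k).exec s).nat 7 = 2 * n := by
    simp [backwardP, Program.exec, setReg_exec, NExpr.eval, hn]
  have h8 : ((backwardP k).exec s).nat 8 = 1 := by
    simp [backwardP, Program.exec, setReg_exec, NExpr.eval]
  refine ⟨hl, h11, by simp [backwardP, Program.exec, setReg_exec], h6, h7,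
    by simp [backwardP, Program.exec, setReg_exec, hn],
    by simp [backwardP, Program.exec, setReg_exec, NExpr.eval], by omega, hl.radius, ?_, ?_⟩
  · intro i hi c
    rw [addrP, h2, h3, h6, h8, h11, vertexIndex_backward (by omega), hl.vertexX]
    have := coordinate_index_lt (Nat.mod_lt (m - i) (NeZero.pos m)) c.2
    exact ⟨by rw [Nat.add_mul]; omega, rfl⟩
  · intro i hi c
    rw [addrQ, h4, h5, h7, h8, h11, vertexIndex_backward (by omega), hl.vertexY]
    have := coordinate_index_lt (Nat.mod_lt (2 * n - i) (NeZero.pos n)) c.2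
    exact ⟨by rw [Nat.add_mul]; omega, rfl⟩

/-! ### The comparison of the two sweeps -/

/-- The entry `e` of the second sweep matches the column `j + n` of the first sweep. -/
def Matches (n : ℕ) (s : Store) (j e : ℕ) : Prop :=
  s.real (s.nat 11 - 8 * n + 4 * (j + n) + 0) + (st s).dp e ≤ 3 * n ∧
    (st s).dp e ≤ s.real (s.nat 11 - 8 * n + 4 * (j + n) + 1) + 2 * n ∧
    (st s).dp e ≤ (st s).dv e + n

/-- An entry of the row that belongs to `j` matches. -/
def MatchesRow (n : ℕ) (s : Store) (j : ℕ) : Prop :=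
  ∃ e, s.nat (20 + 2 * (2 * n - 1 - j)) ≤ e ∧ e < s.nat (21 + 2 * (2 * n - 1 - j)) ∧
    Matches n s j e

/-- The result register holds the truth value of a proposition. -/
def Flag (s : Store) (P : Prop) : Prop := P ∧ s.nat 17 = 1 ∨ ¬ P ∧ s.nat 17 = 0

theorem Flag.congr {P P' : Prop} (h : Flag s P) (hP : P ↔ P') (hs : s'.nat 17 = s.nat 17) :
    Flag s' P' := by
  rwa [Flag, hs, ← hP]

/-- Only registers of the comparison have changed. -/
structure Scan (s s' : Store) : Prop where
  nat : ∀ a, a ≠ 12 → a ≠ 13 → a ≠ 17 → s'.nat a = s.nat a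
  real : s'.real = s.real

theorem Scan.setNat (h : Scan s s') {a : ℕ} (ha : a = 12 ∨ a = 13 ∨ a = 17) (v : ℕ) :
    Scan s (s'.setNat a v) :=
  ⟨fun b h1 h2 h3 => by rw [Store.setNat_nat, if_neg (by omega), h.nat b h1 h2 h3], h.real⟩

theorem Scan.holds_matchC (h : Scan s s') (hn : s.nat 1 = n) :
    matchC.Holds s' ↔ Matches n s (s'.nat 13) (s'.nat 12) := by
  have e1 : s'.nat 1 = n := (h.nat 1 (by omega) (by omega) (by omega)).trans hn
  have e11 : s'.nat 11 = s.nat 11 := h.nat 11 (by omega) (by omega) (by omega)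
  simp only [matchC, firstE, Cond.Holds, RExpr.eval, NExpr.eval, eval_get, eval_reg, e1, e11,
    h.real, Matches, st]
  push_cast
  rfl

theorem Scan.eval_rowE (h : Scan s s') (hn : s.nat 1 = n) :
    rowE.eval s' = 2 * n - 1 - s'.nat 13 := by
  have e1 : s'.nat 1 = n := (h.nat 1 (by omega) (by omega) (by omega)).trans hn
  simp only [rowE, NExpr.eval, eval_reg, e1]

/-- A bound for the time of the comparison of an entry. -/
def entryCost : ℕ := entryP.bound + (entryC.cost + 1)

/-- A bound for the time of the comparison of a column with a row. -/
def compareCost (L : ℕ) : ℕ :=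
  firstEntryP.bound + L * entryCost + (entryC.cost + 1) + 6 + (compareC.cost + 1)

theorem Scan.wp_compareRow (h : Scan s s') (hn : s.nat 1 = n) {j L : ℕ} (hj : s'.nat 13 = j)
    (hL : s.nat (21 + 2 * (2 * n - 1 - j)) - s.nat (20 + 2 * (2 * n - 1 - j)) ≤ L) {P : Prop}
    (hP : Flag s' P) {c d : ℕ} (hc : compareCost L + d ≤ c) :
    WP (.seq firstEntryP (.seq (.loop entryC entryP) (setReg 13 (succE (reg 13))))) s' c
      fun s'' c' => Scan s s'' ∧ s''.nat 13 = j + 1 ∧ Flag s'' (P ∨ MatchesRow n s j) ∧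
        (compareC.cost + 1) + d ≤ c' := by
  unfold compareCost at hc
  have hH : ∀ s', Scan s s' → s'.nat 13 = j →
      s'.nat (20 + 2 * rowE.eval s') = s.nat (20 + 2 * (2 * n - 1 - j)) := by
    intro s' h hj
    rw [h.eval_rowE hn, hj]
    exact h.nat _ (by omega) (by omega) (by omega)
  have hT : ∀ s', Scan s s' → s'.nat 13 = j →
      s'.nat (21 + 2 * rowE.eval s') = s.nat (21 + 2 * (2 * n - 1 - j)) := by
    intro s' h hj
    rw [h.eval_rowE hn, hj]
    exact h.nat _ (by omega) (by omega) (by omega)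
  refine WP.seq (WP.loopFree (by simp [firstEntryP, setReg, Program.LoopFree])
    (c - firstEntryP.bound) (by omega) ?_)
  rw [show firstEntryP.exec s' = s'.setNat 12 (s'.nat (20 + 2 * rowE.eval s')) from rfl, hH s' h hj]
  refine WP.seq (WP.loop (fun s'' c' => ∃ e, s.nat (20 + 2 * (2 * n - 1 - j)) ≤ e ∧
    Scan s s'' ∧ s''.nat 13 = j ∧ s''.nat 12 = e ∧
    Flag s'' (P ∨ ∃ e', s.nat (20 + 2 * (2 * n - 1 - j)) ≤ e' ∧
      e' < s.nat (21 + 2 * (2 * n - 1 - j)) ∧ e' < e ∧ Matches n s j e') ∧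
    (s.nat (21 + 2 * (2 * n - 1 - j)) - e) * entryCost + (entryC.cost + 1) + 6 +
      (compareC.cost + 1) + d ≤ c') ?_ ?_)
  · rintro s₁ c₁ ⟨e, he, h₁, h13, h12, hF, hc₁⟩
    refine ⟨c₁ - (entryC.cost + 1), by omega, fun hb => ?_, fun hb => ?_⟩
    · have hb' : e < s.nat (21 + 2 * (2 * n - 1 - j)) := by
        have : s₁.nat 12 + 1 ≤ s₁.nat (21 + 2 * rowE.eval s₁) := hb
        rw [h12, hT s₁ h₁ h13] at this
        exact this
      obtain ⟨x, hx⟩ : ∃ x, s.nat (21 + 2 * (2 * n - 1 - j)) - e = x + 1 :=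
        ⟨s.nat (21 + 2 * (2 * n - 1 - j)) - e - 1, by omega⟩
      rw [hx, Nat.succ_mul] at hc₁
      unfold entryCost at hc₁
      refine WP.loopFree (by simp [entryP, setReg, Program.LoopFree])
        (c₁ - (entryC.cost + 1) - entryP.bound) (by omega) ?_
      have hm := h₁.holds_matchC hn
      rw [h13, h12] at hm
      have hcred : (s.nat (21 + 2 * (2 * n - 1 - j)) - (e + 1)) * entryCost + (entryC.cost + 1) +
          6 + (compareC.cost + 1) + d ≤ c₁ - (entryC.cost + 1) - entryP.bound := by
        rw [show s.nat (21 + 2 * (2 * n - 1 - j)) - (e + 1) = x by omega]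
        unfold entryCost
        omega
      by_cases hM : Matches n s j e
      · have ex : entryP.exec s₁ = (s₁.setNat 17 1).setNat 12 (e + 1) := by
          simp only [entryP, Program.exec, if_pos (hm.2 hM), setReg_exec, eval_succE, eval_reg,
            Store.setNat_nat, NExpr.eval]
          simp [h12]
        rw [ex]
        refine ⟨e + 1, by omega, (h₁.setNat (by simp) _).setNat (by simp) _, by simp [h13], by simp,
          .inl ⟨.inr ⟨e, he, hb', by omega, hM⟩, by simp⟩, hcred⟩
      · have ex : entryP.exec s₁ = s₁.setNat 12 (e + 1) := by
          simp only [entryP, Program.exec, if_neg (fun hh => hM (hm.1 hh)), setReg_exec,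
            eval_succE, eval_reg, h12]
        rw [ex]
        refine ⟨e + 1, by omega, h₁.setNat (by simp) _, by simp [h13], by simp,
          hF.congr (or_congr_right (exists_congr fun e' => ?_)) (by simp), hcred⟩
        refine and_congr_right fun _ => and_congr_right fun _ => ?_
        constructor
        · rintro ⟨h1, h2⟩; exact ⟨by omega, h2⟩
        · rintro ⟨h1, h2⟩
          refine ⟨lt_of_le_of_ne (by omega) ?_, h2⟩
          rintro rfl
          exact hM h2
    · have hb' : s.nat (21 + 2 * (2 * n - 1 - j)) ≤ e := by
        have : ¬ s₁.nat 12 + 1 ≤ s₁.nat (21 + 2 * rowE.eval s₁) := hb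
        rw [h12, hT s₁ h₁ h13] at this
        omega
      refine WP.loopFree (by simp [setReg, Program.LoopFree]) (c₁ - (entryC.cost + 1) - 6)
        (by simp only [setReg, succE, reg, Program.bound, NExpr.cost]; omega) ?_
      rw [show (setReg 13 (succE (reg 13))).exec s₁ = s₁.setNat 13 (s₁.nat 13 + 1) from rfl]
      refine ⟨h₁.setNat (by simp) _, by simp [h13],
        hF.congr (or_congr_right (exists_congr fun e' => ?_)) (by simp), by omega⟩
      refine and_congr_right fun _ => ⟨fun hh => ⟨hh.1, hh.2.2⟩, fun hh => ⟨hh.1, by omega, hh.2⟩⟩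
  · refine ⟨_, le_rfl, h.setNat (by simp) _, by simp [hj], by simp,
      hP.congr (or_iff_left ?_).symm (by simp), ?_⟩
    · rintro ⟨e, h1, h2, h3, -⟩; omega
    · have := Nat.mul_le_mul_right entryCost hL
      omega

/-- A bound for the time of the comparison. -/
def compareTime (n L : ℕ) : ℕ := 6 + n * compareCost L + (compareC.cost + 1) + 4

theorem wp_compare (hn : s.nat 1 = n) {L : ℕ}
    (hL : ∀ j < n,
      s.nat (21 + 2 * (2 * n - 1 - j)) - s.nat (20 + 2 * (2 * n - 1 - j)) ≤ L) {c : ℕ}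
    (hc : compareTime n L ≤ c) :
    WP compareP s c fun s' _ => (∃ j < n, MatchesRow n s j) ∧ s'.nat 0 = 1 ∨
      (¬ ∃ j < n, MatchesRow n s j) ∧ s'.nat 0 = 0 := by
  unfold compareTime at hc
  refine WP.seq (WP.loopFree (by simp [setReg, Program.LoopFree]) (c - 6)
    (by simp only [setReg, Program.bound, NExpr.cost]; omega) ?_)
  rw [show (Program.seq (setReg 17 (.const 0)) (setReg 13 (.const 0))).exec s =
    (s.setNat 17 0).setNat 13 0 from rfl]
  refine WP.seq (WP.loop (fun s' c' => ∃ j ≤ n, Scan s s' ∧ s'.nat 13 = j ∧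
    Flag s' (∃ j' < j, MatchesRow n s j') ∧
    (n - j) * compareCost L + (compareC.cost + 1) + 4 ≤ c') ?_ ?_)
  · rintro s₁ c₁ ⟨j, hj, h₁, h13, hF, hc₁⟩
    have e1 : s₁.nat 1 = n := (h₁.nat 1 (by omega) (by omega) (by omega)).trans hn
    refine ⟨c₁ - (compareC.cost + 1), by omega, fun hb => ?_, fun hb => ?_⟩
    · have hb' : j < n := by
        have : s₁.nat 13 + 1 ≤ s₁.nat 1 := hb
        rw [h13, e1] at this
        exact this
      obtain ⟨x, hx⟩ : ∃ x, n - j = x + 1 := ⟨n - j - 1, by omega⟩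
      rw [hx, Nat.succ_mul] at hc₁
      refine (h₁.wp_compareRow hn h13 (hL j hb') hF (d := x * compareCost L + 4)
        (by omega)).mono ?_
      rintro s₂ c₂ ⟨h₂, g13, gF, hc₂⟩
      refine ⟨j + 1, hb', h₂, g13, gF.congr ?_ rfl, ?_⟩
      · constructor
        · rintro (⟨j', hj', hh⟩ | hh)
          · exact ⟨j', by omega, hh⟩
          · exact ⟨j, by omega, hh⟩
        · rintro ⟨j', hj', hh⟩
          rcases Nat.lt_succ_iff_lt_or_eq.1 hj' with h' | rfl
          · exact .inl ⟨j', h', hh⟩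
          · exact .inr hh
      · rw [show n - (j + 1) = x by omega]
        omega
    · obtain rfl : j = n := by
        have : ¬ s₁.nat 13 + 1 ≤ s₁.nat 1 := hb
        rw [h13, e1] at this
        omega
      refine WP.loopFree (by simp [setReg, Program.LoopFree]) 0
        (by simp only [setReg, reg, Program.bound, NExpr.cost]; omega) ?_
      rw [show (setReg 0 (reg 17)).exec s₁ = s₁.setNat 0 (s₁.nat 17) from rfl]
      simpa [Flag] using hF
  · refine ⟨0, Nat.zero_le _, (Scan.setNat ⟨fun _ _ _ _ => rfl, rfl⟩ (by simp) _).setNat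
      (by simp) _, by simp, .inr ⟨by simp, by simp⟩, ?_⟩
    rw [Nat.sub_zero]
    omega

/-! ### The correctness of the program -/

/-- A factor of the bound for the time of a sweep. -/
def sweepFactor (k : ℕ) : ℕ :=
  3 + edgeCost k + (columnC.cost + 1) + 6 + (rowCost k + columnCost k + (rowC.cost + 1)) +
    (rowC.cost + 1)

theorem sweepTime_le (k : ℕ) {M N : ℕ} (hM : 0 < M) (hN : 0 < N) :
    sweepTime k M N ≤ sweepFactor k * (M * N) := by
  have h1 : 1 ≤ M * N := Nat.mul_pos hM hN
  have h2 : M ≤ M * N := Nat.le_mul_of_pos_right _ hN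
  have h3 : N ≤ M * N := Nat.le_mul_of_pos_left _ hM
  unfold sweepTime sweepFactor
  generalize edgeCost k = a, columnC.cost + 1 = b, rowCost k = c, columnCost k = d,
    rowC.cost + 1 = e
  calc 3 + M * a + b + 6 + N * (c + M * d + e) + e
      = (9 + b + e) * 1 + a * M + (c + e) * N + d * (M * N) := by ring
    _ ≤ (9 + b + e) * (M * N) + a * (M * N) + (c + e) * (M * N) + d * (M * N) := by gcongr
    _ = (3 + a + b + 6 + (c + d + e) + e) * (M * N) := by ring

/-- A factor of the bound for the time of the comparison. -/
def compareFactor : ℕ := 6 + compareCost 2 + (compareC.cost + 1) + 4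

/-- At most `n * (m + 1) ≤ 2 * (m * n)` entries are compared, hence `compareCost 2` in the factor.
-/
theorem compareTime_le {m n : ℕ} (hm : 0 < m) (hn : 0 < n) :
    compareTime n (m + 1) ≤ compareFactor * (m * n) := by
  have h1 : 1 ≤ m * n := Nat.mul_pos hm hn
  have h3 : n ≤ m * n := Nat.le_mul_of_pos_left _ hm
  unfold compareTime compareFactor compareCost
  generalize entryCost = a, compareC.cost + 1 = b, firstEntryP.bound = c, entryC.cost + 1 = d
  calc 6 + n * (c + (m + 1) * a + d + 6 + b) + b + 4
      = (10 + b) * 1 + (c + a + d + 6 + b) * n + a * (m * n) := by ring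
    _ ≤ (10 + b) * (m * n) + (c + a + d + 6 + b) * (m * n) + a * (m * n) := by gcongr
    _ = (6 + (c + 2 * a + d + 6 + b) + b + 4) * (m * n) := by ring

/-- The matching entries decide the question. -/
theorem frechetDist_le_iff_matches [NeZero m] [NeZero n] (hε : 0 ≤ ε) {s₁ s₂ : Store}
    (h₁ : Swept Y.vertex X.vertex ε (2 * n) m 0 n s₁)
    (h₂ : Swept (fun i => X.vertex (m - i)) (fun j => Y.vertex (2 * n - j)) ε m (2 * n) n 0 s₂)
    (hW : s₂.nat 11 = s₁.nat 11 + 8 * n) (hr : ∀ a < s₂.nat 11, s₂.real a = s₁.real a) :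
    X.frechetDist Y ≤ ε ↔ ∃ j < n, MatchesRow n s₂ j := by
  rw [X.frechetDist_le_iff_reach Y hε]
  refine exists_congr fun j => and_congr_right fun hj => ?_
  have hrec := h₂.record (2 * n - 1 - j) (by omega)
  rw [X.exists_reach_iff Y hε hj (h₁.line.rep (j + n) (by omega)) hrec.bounds hrec.reach]
  refine exists_congr fun e => and_congr_right fun _ => and_congr_right fun _ => ?_
  -- The column `j + n` is less than `2 n`, so its two cells lie below the arrays of the second
  -- sweep and still hold the values of the first.
  rw [Matches, show s₂.nat 11 - 8 * n = s₁.nat 11 by omega, hr _ (by omega), hr _ (by omega)]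
  rfl

/-- The factor in the bound for the time of the program. -/
def decideFactor (k : ℕ) : ℕ :=
  5 + (forwardP k).bound + sweepFactor k * 2 + (backwardP k).bound + sweepFactor k * 2 +
    compareFactor

theorem wp_decide [NeZero m] [NeZero n] (X : ClosedPolygon k m) (Y : ClosedPolygon k n) (ε : ℝ) :
    WP (decideP k) (input X Y ε) (decideFactor k * (m * n)) fun s _ =>
      X.frechetDist Y ≤ ε ∧ s.nat 0 = 1 ∨ ¬ X.frechetDist Y ≤ ε ∧ s.nat 0 = 0 := by
  have hm := NeZero.pos m
  have hn := NeZero.pos n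
  have h1 : 1 ≤ m * n := Nat.mul_pos hm hn
  have htime : 5 + (forwardP k).bound + sweepTime k (2 * n) m + (backwardP k).bound +
      sweepTime k m (2 * n) + compareTime n (m + 1) ≤ decideFactor k * (m * n) := by
    have t1 := sweepTime_le k (M := 2 * n) (N := m) (by omega) hm
    have t2 := sweepTime_le k (M := m) (N := 2 * n) hm (by omega)
    have t3 := compareTime_le hm hn
    have t4 := Nat.mul_le_mul_left (5 + (forwardP k).bound + (backwardP k).bound) h1
    have e : decideFactor k * (m * n) =
        (5 + (forwardP k).bound + (backwardP k).bound) * (m * n) + sweepFactor k * (2 * n * m) +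
          sweepFactor k * (m * (2 * n)) + compareFactor * (m * n) := by
      unfold decideFactor; ring
    omega
  generalize decideFactor k * (m * n) = c at htime
  have hload := loaded_input X Y ε
  have hcost : (Cond.realLE (.const 0) (.load (.const 0))).cost = 4 := rfl
  have hholds : (Cond.realLE (.const 0) (.load (.const 0))).Holds (input X Y ε) ↔ 0 ≤ ε := by
    simp [Cond.Holds, RExpr.eval, NExpr.eval, hload.radius]
  have hf : 3 ≤ (forwardP k).bound := by
    simp only [forwardP, setReg, Program.bound, NExpr.cost]; omega
  refine WP.branch (c - 5) (by omega) (fun hε => ?_) (fun hε => ?_)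
  · rw [hholds] at hε
    obtain ⟨l₁, w₁, c₁⟩ := hload.ctx_forward
    refine WP.seq (WP.loopFree (by simp [forwardP, setReg, Program.LoopFree])
      (c - 5 - (forwardP k).bound) (by omega) ?_)
    generalize (forwardP k).exec (input X Y ε) = s₁ at *
    refine WP.seq ((c₁.wp_sweep (d := (backwardP k).bound + sweepTime k m (2 * n) +
      compareTime n (m + 1)) (by omega)).mono ?_)
    rintro s₂ c₂ ⟨ha, hsw, hc₂⟩
    have l₂ := l₁.congr (ha.nat 0 (by omega)) (ha.nat 1 (by omega))
      (fun a h => ha.real a (w₁ ▸ h))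
    have w₂ := (ha.nat 11 (by omega)).trans w₁
    obtain ⟨l₃, w₃, r₃, c₃⟩ := l₂.ctx_backward w₂
    refine WP.seq (WP.loopFree (by simp [backwardP, setReg, Program.LoopFree])
      (c₂ - (backwardP k).bound) (by omega) ?_)
    generalize (backwardP k).exec s₂ = s₃ at *
    refine WP.seq ((c₃.wp_sweep (d := compareTime n (m + 1)) (by omega)).mono ?_)
    rintro s₄ c₄ ⟨ha₄, hsw₄, hc₄⟩
    have hn₄ : s₄.nat 1 = n := (ha₄.nat 1 (by omega)).trans l₃.lengthY
    have h11 : s₄.nat 11 = s₃.nat 11 := ha₄.nat 11 (by omega)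
    rw [frechetDist_le_iff_matches hε hsw hsw₄ (by omega)
      (fun a h => (ha₄.real a (h11 ▸ h)).trans (congrFun r₃ a))]
    exact wp_compare hn₄ (fun j hj => (hsw₄.record (2 * n - 1 - j) (by omega)).length) hc₄
  -- The sweeps see only the square of ε, so a negative ε is treated apart: the answer is no,
  -- because the Fréchet distance is not negative.
  · rw [hholds] at hε
    refine WP.loopFree (by simp [setReg, Program.LoopFree]) 0 ?_ (.inr ⟨fun hle => hε ?_, rfl⟩)
    · simp only [setReg, Program.bound, NExpr.cost]; omega
    · refine le_trans (Real.sInf_nonneg ?_) hle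
      rintro r ⟨φ, -, ψ, -, rfl⟩
      exact Real.iSup_nonneg fun t => dist_nonneg

end RealRAM

theorem mainTheorem1 (k : ℕ) :
    ∃ (P : RealRAM.Program) (C : ℕ), ∀ (m n : ℕ) [NeZero m] [NeZero n]
      (X : ClosedPolygon k m) (Y : ClosedPolygon k n) (ε : ℝ),
      ∃ (s : RealRAM.Store) (t : ℕ), RealRAM.Runs P (RealRAM.input X Y ε) s t ∧
        t ≤ C * (m * n) ∧
        (X.frechetDist Y ≤ ε ∧ s.nat 0 = 1 ∨ ¬ X.frechetDist Y ≤ ε ∧ s.nat 0 = 0) := by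
  refine ⟨RealRAM.decideP k, RealRAM.decideFactor k, fun m n _ _ X Y ε => ?_⟩
  obtain ⟨s, t, c, hr, ht, hs⟩ := RealRAM.wp_decide X Y ε
  exact ⟨s, t, hr, by omega, hs⟩
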